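/- Let $M$ be a transitive model (set or proper class) of ZFC in the universe $V$. Definitions. Let $M\models\langle X,\tau\rangle$ be a topological space; all spaces are $T_0$. A preinterpretation of $X$ over $M$ is a topological space $\langle\hat X,\hat\tau\rangle$ in $V$ with maps $\pi\colon X\to\hat X$ and $\pi\colon\tau\to\hat\tau$ such that $x\in O\Leftrightarrow\pi(x)\in\pi(O)$ for $x\in X$, $O\in\tau$; $\pi$ commutes with finite intersections and with those unions of families of open sets which belong to $M$; $\pi(\emptyset)=\emptyset$ and $\pi(X)=\hat X$; and $\{\pi(O):O\in\tau\}$ is a basis of $\hat\tau$. A reduction of a preinterpretation $\pi_0\colon X\to\hat X_0$ to $\pi_1\colon X\to\hat X_1$ is a map $h\colon\hat X_0\to\hat X_1$ with $\pi_1=h\circ\pi_0$ on $X$ and $h^{-1}(\pi_1(O))=\pi_0(O)$ for all $O\in\tau$. An interpretation of $X$ is a preinterpretation to which every preinterpretation of $X$ reduces; a map defined on the points of $X$ is called an interpretation if it extends to one. If $\pi\colon X\to\hat X$ and $\chi\colon Y\to\hat Y$ are interpretations and $M\models f\colon X\to Y$ is continuous, the interpretation of $f$ is the continuous $\hat f\colon\hat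 X\to\hat Y$ with $\hat f\circ\pi=\chi\circ f$. The reals $\mathbb{R}^M$ of $M$ are interpreted by the inclusion $\mathbb{R}^M\subseteq\mathbb{R}$, and products by products of interpretations (that these maps are interpretations of the spaces below is part of the claim). Theorem. Suppose that $M\models$ "$X$ is a real Banach space with norm $\phi$", let $X^*$ and $\phi^*$ be the dual of $X$ and the dual norm, computed in $M$, and let $\pi\colon X\to\hat X$ be an interpretation of $X$ with its norm topology. Then the interpretations of addition, of multiplication by scalars and of $\phi$ turn $\hat X$ into a real Banach space with norm $\pi(\phi)$, which induces the topology of $\hat X$. Let $(\hat X)^*$ be its normed dual, with norm $\pi(\phi)^*$. For $x^*\in X^*$ let $\pi(x^*)\colon\hat X\to\mathbb{R}$ be the interpretation of the function $x^*$. Then: 1. there is a closed linear subspace $C$ of $(\hat X)^*$ such that $x^*\mapsto\pi(x^*)$ maps $X^*$ into $C$ and is an interpretation $X^*\to C$ of $X^*$ with its dual norm topology; 2. with respect to it, the norm $\phi^*$ is interpreted as the restriction of $\pi(\phi)^*$ to $C$; 3. the evaluation bracket $X\times X^*\to\mathbb{R}^M$, $(x,x^*)\mapsto x^*(x)$, is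 interpreted as the restriction to $\hat X\times C$ of the evaluation bracket $\hat X\times(\hat X)^*\to\mathbb{R}$; 4. if $M\models$ "$X$ is uniformly convex", then $C=(\hat X)^*$. -/

import Mathlib

universe u v w w'

/-! ### Transitive models of ZFC

The universe `V` is `ZFSet.{u}`; a set of `V` is, up to bijection, a type in `Type u`.
A class `M` is a `Set ZFSet.{u}`; it may be a set or a proper class. -/

/-- The only relation symbol of the language of set theory. -/
inductive MemSymbol : ℕ → Type
  | mem : MemSymbol 2

/-- The first-order language of set theory. -/
def setLang : FirstOrder.Language.{0, 0} := ⟨fun _ => Empty, MemSymbol⟩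

/-- A class of sets is a structure `(M, ∈)` for the language of set theory. -/
instance memStructure (M : Set ZFSet.{u}) : setLang.Structure M where
  funMap := fun {_} f => nomatch f
  RelMap := fun {_} r => match r with
    | MemSymbol.mem => fun a => (a 0 : ZFSet.{u}) ∈ (a 1 : ZFSet.{u})

/-- `M` is a transitive model of ZFC. Each axiom is the usual one with its quantifiers restricted
to `M`; the two schemes range over all relations that are first-order definable over `(M, ∈)` with
parameters from `M`. Extensionality and foundation hold in every transitive class. -/
structure IsTransitiveModelZFC (M : Set ZFSet.{u}) : Prop where
  transitive : ∀ x ∈ M, ∀ y ∈ x, y ∈ M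
  pairing : ∀ x ∈ M, ∀ y ∈ M, ∃ z ∈ M, ∀ t ∈ M, t ∈ z ↔ t = x ∨ t = y
  union : ∀ x ∈ M, ∃ z ∈ M, ∀ t ∈ M, t ∈ z ↔ ∃ y ∈ M, y ∈ x ∧ t ∈ y
  powerset : ∀ x ∈ M, ∃ z ∈ M, ∀ t ∈ M, t ∈ z ↔ ∀ y ∈ M, y ∈ t → y ∈ x
  infinity : ∃ z ∈ M, (∃ e ∈ M, (∀ t ∈ M, t ∉ e) ∧ e ∈ z) ∧
    ∀ n ∈ M, n ∈ z → ∃ s ∈ M, s ∈ z ∧ ∀ t ∈ M, t ∈ s ↔ t ∈ n ∨ t = n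
  separation : ∀ S : Set M, (Set.univ : Set M).Definable₁ setLang S →
    ∀ x : M, ∃ z : M, ∀ t : M, t.1 ∈ z.1 ↔ t.1 ∈ x.1 ∧ t ∈ S
  replacement : ∀ R : Set (M × M), (Set.univ : Set M).Definable₂ setLang R →
    ∀ x : M, (∀ a : M, a.1 ∈ x.1 → ∃! b : M, (a, b) ∈ R) →
      ∃ z : M, ∀ b : M, b.1 ∈ z.1 ↔ ∃ a : M, a.1 ∈ x.1 ∧ (a, b) ∈ R
  choice : ∀ x ∈ M, (∀ a ∈ M, a ∈ x → ∃ t ∈ M, t ∈ a) →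
    (∀ a ∈ M, a ∈ x → ∀ b ∈ M, b ∈ x → (∃ t ∈ M, t ∈ a ∧ t ∈ b) → a = b) →
    ∃ c ∈ M, ∀ a ∈ M, a ∈ x → ∃! t, t ∈ M ∧ t ∈ a ∧ t ∈ c

/-- The collection `S` of sets is (the extension of) an element of `M`. -/
def InModel (M : Set ZFSet.{u}) (S : Set ZFSet.{u}) : Prop :=
  ∃ z ∈ M, (z : Set ZFSet.{u}) = S

/-- The von Neumann natural number `n`. -/
def natCode : ℕ → ZFSet.{u}
  | 0 => ∅
  | n + 1 => insert (natCode n) (natCode n)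

/-- The real number `r` as a set: its (strict, lower) Dedekind cut, where the rational
`(m - n) / (k + 1)` is given by each of the triples `(m, n, k)` of natural numbers. -/
noncomputable def realCode (r : ℝ) : ZFSet.{u} :=
  ZFSet.range fun p : {p : ℕ × ℕ × ℕ // ((p.1 : ℝ) - p.2.1) / (p.2.2 + 1) < r} =>
    ZFSet.pair (natCode p.1.1) (ZFSet.pair (natCode p.1.2.1) (natCode p.1.2.2))

/-- The set `ℝ^M` of real numbers of `M`. -/
def MReal (M : Set ZFSet.{u}) : Type := {r : ℝ // realCode.{u} r ∈ M}

/-- The inclusion of `ℝ^M` in `ℝ`. -/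
def MReal.val {M : Set ZFSet.{u}} (r : MReal M) : ℝ := Subtype.val r

/-! ### Topological spaces in a model and their interpretations -/

/-- A topological space as seen by a model: the points (each one coded by a set) and the open sets
which belong to the model. -/
structure MSpace : Type (max (u + 1) (w + 1)) where
  Pt : Type w
  code : Pt → ZFSet.{u}
  opens : Set (Set Pt)

/-- A topological space in `V`, with its topology as a plain field. -/
structure VSpace : Type (u + 1) where
  Pt : Type u
  top : TopologicalSpace Pt

/-- The real line of `M`. -/
noncomputable def realSpace (M : Set ZFSet.{u}) : MSpace.{u, 0} where
  Pt := MReal M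
  code := fun r => realCode r.val
  opens := {O | InModel M ((fun r : MReal M => realCode r.val) '' O) ∧
    ∀ r ∈ O, ∃ ε > 0, ∀ s : MReal M, |s.val - r.val| < ε → s ∈ O}

/-- The product of two spaces, computed in `M`. -/
def MSpace.prod (M : Set ZFSet.{u}) (S : MSpace.{u, w}) (T : MSpace.{u, w'}) :
    MSpace.{u, max w w'} where
  Pt := S.Pt × T.Pt
  code := fun p => ZFSet.pair (S.code p.1) (T.code p.2)
  opens := {O | InModel M ((fun p : S.Pt × T.Pt => ZFSet.pair (S.code p.1) (T.code p.2)) '' O) ∧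
    ∀ p ∈ O, ∃ U ∈ S.opens, ∃ W ∈ T.opens, p.1 ∈ U ∧ p.2 ∈ W ∧ U ×ˢ W ⊆ O}

/-- A collection of open sets of `S` is an element of `M`. -/
def MSpace.FamilyIn (M : Set ZFSet.{u}) (S : MSpace.{u, w}) (F : Set (Set S.Pt)) : Prop :=
  F ⊆ S.opens ∧ InModel M {z | ∃ O ∈ F, (z : Set ZFSet.{u}) = S.code '' O}

/-- The maps `pt` on points and `op` on open sets form a topological preinterpretation of `S`
over `M` into the (`T₀`) space `Y`. -/
structure IsPreinterpretation (M : Set ZFSet.{u}) (S : MSpace.{u, w}) {Y : Type v}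
    (top : TopologicalSpace Y) (pt : S.Pt → Y) (op : Set S.Pt → Set Y) : Prop where
  t0 : T0Space Y
  isOpen : ∀ O ∈ S.opens, IsOpen (op O)
  mem_iff : ∀ x, ∀ O ∈ S.opens, x ∈ O ↔ pt x ∈ op O
  inter : ∀ O ∈ S.opens, ∀ P ∈ S.opens, op (O ∩ P) = op O ∩ op P
  sUnion : ∀ F : Set (Set S.Pt), S.FamilyIn M F → op (⋃₀ F) = ⋃ O ∈ F, op O
  empty : op ∅ = ∅
  univ : op Set.univ = Set.univ
  basis : TopologicalSpace.IsTopologicalBasis (op '' S.opens)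

/-- `h` is a reduction of the preinterpretation `(pt₀, op₀)` to `(pt₁, op₁)`. -/
def IsReduction (S : MSpace.{u, w}) {Y₀ : Type v} {Y₁ : Type w'}
    (pt₀ : S.Pt → Y₀) (op₀ : Set S.Pt → Set Y₀) (pt₁ : S.Pt → Y₁) (op₁ : Set S.Pt → Set Y₁)
    (h : Y₀ → Y₁) : Prop :=
  pt₁ = h ∘ pt₀ ∧ ∀ O ∈ S.opens, h ⁻¹' (op₁ O) = op₀ O

/-- `(pt, op)` is an interpretation of `S` over `M`: a preinterpretation to which every
preinterpretation in `V` can be reduced. -/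
def IsInterpretation (M : Set ZFSet.{u}) (S : MSpace.{u, w}) {Y : Type v}
    (top : TopologicalSpace Y) (pt : S.Pt → Y) (op : Set S.Pt → Set Y) : Prop :=
  IsPreinterpretation M S top pt op ∧
    ∀ (Y' : Type u) (top' : TopologicalSpace Y') (pt' : S.Pt → Y') (op' : Set S.Pt → Set Y'),
      IsPreinterpretation M S top' pt' op' → ∃ h : Y' → Y, IsReduction S pt' op' pt op h

/-- The map `pt` on points extends to an interpretation of `S` over `M`. -/
def Interprets (M : Set ZFSet.{u}) (S : MSpace.{u, w}) {Y : Type v}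
    (top : TopologicalSpace Y) (pt : S.Pt → Y) : Prop :=
  ∃ op : Set S.Pt → Set Y, IsInterpretation M S top pt op

/-- With respect to the interpretations `π` of `S` and `χ` of `T`, the continuous function `g` is
the interpretation of `f`. -/
def InterpretsMap {S : MSpace.{u, w}} {T : MSpace.{u, w'}} (M : Set ZFSet.{u})
    {Y : Type*} {Z : Type*} [TopologicalSpace Y] [TopologicalSpace Z]
    (π : S.Pt → Y) (χ : T.Pt → Z) (f : S.Pt → T.Pt) (g : Y → Z) : Prop :=
  Interprets M S inferInstance π ∧ Interprets M T inferInstance χ ∧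
    Continuous g ∧ ∀ x, g (π x) = χ (f x)

/-! ### Banach spaces in a model and their duals -/

/-- `M ⊨` "`carrier` is a real Banach space with norm `norm`". The set and the operations belong
to `M`, the scalars are the reals of `M`, and the sequences considered in the completeness axiom
are those in `M`. Sums, products and the order of reals of `M` are computed in `ℝ`. -/
structure BanachIn (M : Set ZFSet.{u}) where
  carrier : ZFSet.{u}
  carrier_mem : carrier ∈ M
  [group : AddCommGroup carrier]
  smul : MReal M → carrier → carrier
  norm : carrier → MReal M
  add_mem : InModel M {z | ∃ x y : carrier, z = ZFSet.pair (ZFSet.pair x y) (x + y : carrier)}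
  smul_mem : InModel M
    {z | ∃ (r : MReal M) (x : carrier), z = ZFSet.pair (ZFSet.pair (realCode r.val) x) (smul r x)}
  norm_mem : InModel M {z | ∃ x : carrier, z = ZFSet.pair x (realCode (norm x).val)}
  smul_add : ∀ r x y, smul r (x + y) = smul r x + smul r y
  add_smul : ∀ r s t x, t.val = r.val + s.val → smul t x = smul r x + smul s x
  mul_smul : ∀ r s t x, t.val = r.val * s.val → smul t x = smul r (smul s x)
  one_smul : ∀ r x, r.val = 1 → smul r x = x
  norm_add_le : ∀ x y, (norm (x + y)).val ≤ (norm x).val + (norm y).val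
  norm_smul : ∀ r x, (norm (smul r x)).val = |r.val| * (norm x).val
  eq_zero_of_norm : ∀ x, (norm x).val = 0 → x = 0
  complete : ∀ s : ℕ → carrier,
    InModel M {z | ∃ n, z = ZFSet.pair (natCode n) (s n)} →
    (∀ ε : ℝ, 0 < ε → ∃ N, ∀ m ≥ N, ∀ n ≥ N, (norm (s m - s n)).val < ε) →
    ∃ x : carrier, ∀ ε : ℝ, 0 < ε → ∃ N, ∀ n ≥ N, (norm (s n - x)).val < ε

namespace BanachIn

variable {M : Set ZFSet.{u}}

instance (X : BanachIn M) : AddCommGroup X.carrier := X.group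

/-- The topological space underlying `X`, in `M`. -/
def space (X : BanachIn M) : MSpace.{u, u + 1} where
  Pt := X.carrier
  code := fun x => x
  opens := {O | InModel M ((fun x : X.carrier => (x : ZFSet.{u})) '' O) ∧
    ∀ x ∈ O, ∃ ε > 0, ∀ y, (X.norm (y - x)).val < ε → y ∈ O}

/-- `M ⊨ X` is uniformly convex. -/
def UniformlyConvex (X : BanachIn M) : Prop :=
  ∀ ε : ℝ, 0 < ε → ∃ δ : ℝ, 0 < δ ∧ ∀ x y, (X.norm x).val = 1 → (X.norm y).val = 1 →
    ε ≤ (X.norm (x - y)).val → (X.norm (x + y)).val ≤ 2 - δ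

/-- The elements of the dual `X^*` computed in `M`: the bounded linear functionals `X → ℝ^M`
whose graph belongs to `M`. -/
structure Dual (X : BanachIn M) where
  toFun : X.carrier → MReal M
  graph : ZFSet.{u}
  graph_mem : graph ∈ M
  coe_graph : (graph : Set ZFSet.{u}) = 
    {z | ∃ x : X.carrier, z = ZFSet.pair x (realCode (toFun x).val)}
  map_add : ∀ x y, (toFun (x + y)).val = (toFun x).val + (toFun y).val
  map_smul : ∀ r x, (toFun (X.smul r x)).val = r.val * (toFun x).val
  bounded : ∃ C : ℝ, ∀ x, |(toFun x).val| ≤ C * (X.norm x).val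

/-- The supremum of `|f|` over the closed unit ball of `X`. -/
noncomputable def supNorm (X : BanachIn M) (f : X.carrier → ℝ) : ℝ :=
  sSup {t | ∃ x, (X.norm x).val ≤ 1 ∧ t = |f x|}

/-- The dual `X^*` with the topology of the dual norm, in `M`. -/
noncomputable def dualSpace (X : BanachIn M) : MSpace.{u, u + 1} where
  Pt := X.Dual
  code := Dual.graph
  opens := {O | InModel M (Dual.graph '' O) ∧
    ∀ f ∈ O, ∃ ε > 0, ∀ g : X.Dual,
      X.supNorm (fun x => (g.toFun x).val - (f.toFun x).val) < ε → g ∈ O}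

end BanachIn

-- A metric space of `M` is interpreted by its metric completion in `V`: an open set O of `M` goes
-- to the points of the completion that have a ball whose trace on the dense set lies in O. The one
-- substantial point is that this commutes with unions of families in `M`
-- (`IsMetricIn.exists_op_of_cover`). Suppose a family covers the trace of a ball around z, but z
-- lies in no interpreted member. Then all small balls close around z are bad: covered by the
-- family, yet contained in no member. Nested bad balls of increasing index form a relation in `M`.
-- `M` sees no infinite descent in it, because the centres would converge in `M` and a member
-- containing the limit would swallow one of the balls. Well-foundedness is absolute for transitive
-- models (`wellFounded_of_minimal`, a Mostowski collapse inside `M`), so there is no descent in `V`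
-- either, although z produces one.
--
-- Conversely, a point of any preinterpretation selects a ball of each index. The centres of these
-- balls converge in the completion, and the limits define the reduction
-- (`IsMetricIn.isInterpretation`). Interpretations are unique up to homeomorphism
-- (`exists_homeomorph_of_interprets`), so the Banach space structure of the completion is carried
-- to the given interpretation.
--
-- The same criterion handles the dual. Each functional of `M` extends to the completion, and C is
-- the closure of these extensions. The norm of an extension is a supremum over the unit ball of X,
-- so the dual metric is definable. A limit of a sequence of functionals of `M` has definable cuts
-- at the points of X, so the dual is complete in `M` (`isMetricIn_dualEmb`). The norm and the
-- bracket are continuous and have the right values on the dense sets.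
--
-- If X is uniformly convex, so is its completion, which is then reflexive by Milman–Pettis
-- (`exists_forall_apply_eq`). If C were proper, a nonzero functional vanishing on C would be
-- evaluation at some y ≠ 0. But a functional of `M` with value 1 at a point x of X near y, and of
-- norm at most 2/‖x‖, cannot vanish at y. This functional must lie in `M`, hence the Hahn–Banach
-- theorem is proved inside `M` (`exists_dual_eq_one`), by a maximal cone obtained from Zorn's lemma
-- in `M`.
--
-- The axioms of `M` enter through definability. Types are coded by elements of `M` (`Coded`), and
-- `DSet` and `DFun` express definability with parameters. Their closure properties make separation,
-- replacement, recursion and choice applicable to ordinary mathematical predicates.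

universe v'

set_option linter.unusedSectionVars false

namespace ModelInterpretation

/-! ### First-order definability over `M` with parameters -/

section Raw

variable {M : Set ZFSet.{u}} {α : Type}

/-- A predicate on assignments `α → M` which is first-order definable with parameters. -/
def RawDef {α : Type} (P : (α → M) → Prop) : Prop :=
  (Set.univ : Set M).Definable setLang {v | P v}

namespace RawDef

theorem congr {P Q : (α → M) → Prop} (h : RawDef P) (hPQ : ∀ v, Q v ↔ P v) : RawDef Q := by
  have : Q = P := funext fun v => propext (hPQ v)
  rw [this]; exact h

theorem and {P Q : (α → M) → Prop} (hP : RawDef P) (hQ : RawDef Q) :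
    RawDef fun v => P v ∧ Q v := Set.Definable.inter hP hQ

theorem or {P Q : (α → M) → Prop} (hP : RawDef P) (hQ : RawDef Q) :
    RawDef fun v => P v ∨ Q v := Set.Definable.union hP hQ

theorem not {P : (α → M) → Prop} (hP : RawDef P) : RawDef fun v => ¬ P v :=
  Set.Definable.compl hP

theorem imp {P Q : (α → M) → Prop} (hP : RawDef P) (hQ : RawDef Q) :
    RawDef fun v => P v → Q v :=
  (hP.not.or hQ).congr fun _ => imp_iff_not_or

theorem iff {P Q : (α → M) → Prop} (hP : RawDef P) (hQ : RawDef Q) :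
    RawDef fun v => (P v ↔ Q v) :=
  ((hP.imp hQ).and (hQ.imp hP)).congr fun _ => iff_def

/-- The bound variable is the coordinate `none`; existential quantification is the projection of a
definable set that forgets this coordinate. -/
theorem ex [Finite α] {P : (α → M) → M → Prop}
    (h : RawDef fun w : Option α → M => P (fun a => w (some a)) (w none)) :
    RawDef fun v => ∃ x, P v x := by
  have := Set.Definable.image_comp h (some : α → Option α)
  refine congr (Q := fun v => ∃ x, P v x) this fun v => ?_
  constructor
  · rintro ⟨x, hx⟩
    exact ⟨fun o => o.elim x v, hx, rfl⟩
  · rintro ⟨w, hw, rfl⟩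
    exact ⟨w none, hw⟩

theorem all [Finite α] {P : (α → M) → M → Prop}
    (h : RawDef fun w : Option α → M => P (fun a => w (some a)) (w none)) :
    RawDef fun v => ∀ x, P v x :=
  (RawDef.ex (P := fun v x => ¬ P v x) h.not).not.congr fun v => by simp

theorem comp {β : Type} {P : (β → M) → Prop} (h : RawDef P) (f : β → α) :
    RawDef fun v : α → M => P fun b => v (f b) := Set.Definable.preimage_comp f h

theorem subst₁ {S : M → Prop} (h : RawDef fun v : Fin 1 → M => S (v 0)) (i : α) :
    RawDef fun v : α → M => S (v i) := h.comp fun _ => i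

theorem subst₂ {S : M → M → Prop} (h : RawDef fun v : Fin 2 → M => S (v 0) (v 1)) (i j : α) :
    RawDef fun v : α → M => S (v i) (v j) := h.comp ![i, j]

theorem subst₃ {S : M → M → M → Prop}
    (h : RawDef fun v : Fin 3 → M => S (v 0) (v 1) (v 2)) (i j k : α) :
    RawDef fun v : α → M => S (v i) (v j) (v k) := h.comp ![i, j, k]

theorem mem (i j : α) : RawDef fun v : α → M => (v i : ZFSet.{u}) ∈ (v j : ZFSet.{u}) := by
  refine RawDef.comp (β := Fin 2) (P := fun v => (v 0 : ZFSet.{u}) ∈ (v 1 : ZFSet.{u})) ?_ ![i, j]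
  have : (∅ : Set M).Definable setLang
      {v : Fin 2 → M | (v 0 : ZFSet.{u}) ∈ (v 1 : ZFSet.{u})} := by
    rw [Set.empty_definable_iff]
    refine ⟨FirstOrder.Language.Relations.formula (L := setLang) MemSymbol.mem
      ![FirstOrder.Language.Term.var 0, FirstOrder.Language.Term.var 1], ?_⟩
    ext v
    simp only [Set.mem_ofPred_eq]
    exact Iff.rfl
  exact this.mono (Set.empty_subset _)

theorem eq (i j : α) : RawDef fun v : α → M => v i = v j :=
  RawDef.comp (β := Fin 2) (P := fun v => v 0 = v 1)
    (Set.Definable.diagonal setLang (Set.univ : Set M)) ![i, j]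

theorem eqConst (i : α) (c : M) : RawDef fun v : α → M => v i = c :=
  RawDef.comp (β := Fin 1) (P := fun v => v 0 = c)
    (Set.Definable.singleton_of_mem setLang (Set.mem_univ c)) ![i]

end RawDef

/-! ### Extensionality and ordered pairs in a transitive model -/

section Closure

theorem inModel_iff {S : Set ZFSet.{u}} : InModel M S ↔ ∃ z : M, ∀ t, t ∈ z.1 ↔ t ∈ S := by
  constructor
  · rintro ⟨z, hz, rfl⟩
    exact ⟨⟨z, hz⟩, fun t => Iff.rfl⟩
  · rintro ⟨z, hz⟩
    exact ⟨z.1, z.2, Set.ext hz⟩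

variable [hM : Fact (IsTransitiveModelZFC M)]

theorem mem_of_mem {x y : ZFSet.{u}} (hy : y ∈ M) (h : x ∈ y) : x ∈ M :=
  hM.out.transitive y hy x h

/-- By transitivity no element of x or y escapes a quantifier that ranges over `M`. -/
theorem ext_M {x y : M} (h : ∀ t : M, t.1 ∈ x.1 ↔ t.1 ∈ y.1) : x = y := by
  apply Subtype.ext
  apply ZFSet.ext
  intro t
  exact ⟨fun ht => (h ⟨t, mem_of_mem x.2 ht⟩).1 ht, fun ht => (h ⟨t, mem_of_mem y.2 ht⟩).2 ht⟩

theorem upair_mem {x y : ZFSet.{u}} (hx : x ∈ M) (hy : y ∈ M) : ({x, y} : ZFSet.{u}) ∈ M := by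
  obtain ⟨z, hz, h⟩ := hM.out.pairing x hx y hy
  have : ({x, y} : ZFSet.{u}) = z := by
    ext t
    rw [ZFSet.mem_pair]
    constructor
    · rintro (rfl | rfl)
      · exact (h _ hx).2 (Or.inl rfl)
      · exact (h _ hy).2 (Or.inr rfl)
    · intro ht
      exact (h t (mem_of_mem hz ht)).1 ht
  rwa [this]

theorem pair_mem {x y : ZFSet.{u}} (hx : x ∈ M) (hy : y ∈ M) : ZFSet.pair x y ∈ M := by
  unfold ZFSet.pair
  have : ({x} : ZFSet.{u}) ∈ M := by
    rw [← ZFSet.pair_eq_singleton]; exact upair_mem hx hx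
  exact upair_mem this (upair_mem hx hy)

/-- The ordered pair as an operation on `M`. -/
def mpair (x y : M) : M := ⟨ZFSet.pair x.1 y.1, pair_mem x.2 y.2⟩

theorem mpair_inj {x y x' y' : M} : mpair x y = mpair x' y' ↔ x = x' ∧ y = y' := by
  simp only [mpair, Subtype.mk.injEq, ZFSet.pair_inj]
  simp only [Subtype.ext_iff]

/-- The Kuratowski pair is written out with quantifiers over `M`; transitivity makes the result
agree with the pair of `V`. -/
theorem RawDef.isPair (i j k : α) : RawDef fun v : α → M => v k = mpair (v i) (v j) := by
  refine RawDef.subst₃ (S := fun x y z => z = mpair x y) ?_ i j k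
  have h : RawDef fun v : Fin 3 → M => ∀ t : M, t.1 ∈ (v 2).1 ↔
      ((∀ s : M, s.1 ∈ t.1 ↔ s = v 0) ∨ (∀ s : M, s.1 ∈ t.1 ↔ (s = v 0 ∨ s = v 1))) := by
    refine RawDef.all (RawDef.iff (RawDef.mem _ _) (RawDef.or (RawDef.all ?_) (RawDef.all ?_)))
    · exact (RawDef.mem _ _).iff (RawDef.eq _ _)
    · exact (RawDef.mem _ _).iff ((RawDef.eq _ _).or (RawDef.eq _ _))
  refine h.congr fun v => ?_
  have h1 : ∀ t : M, (∀ s : M, s.1 ∈ t.1 ↔ s = v 0) ↔ t.1 = {(v 0).1} := by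
    intro t
    constructor
    · intro h
      ext s
      rw [ZFSet.mem_singleton]
      constructor
      · intro hs
        exact congrArg Subtype.val ((h ⟨s, mem_of_mem t.2 hs⟩).1 hs)
      · rintro rfl
        exact (h (v 0)).2 rfl
    · intro h s
      rw [h, ZFSet.mem_singleton, Subtype.ext_iff]
  have h2 : ∀ t : M, (∀ s : M, s.1 ∈ t.1 ↔ (s = v 0 ∨ s = v 1)) ↔ t.1 = {(v 0).1, (v 1).1} := by
    intro t
    constructor
    · intro h
      ext s
      rw [ZFSet.mem_pair]
      constructor
      · intro hs
        simpa [Subtype.ext_iff] using (h ⟨s, mem_of_mem t.2 hs⟩).1 hs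
      · rintro (rfl | rfl)
        · exact (h (v 0)).2 (Or.inl rfl)
        · exact (h (v 1)).2 (Or.inr rfl)
    · intro h s
      rw [h, ZFSet.mem_pair, Subtype.ext_iff, Subtype.ext_iff]
  simp only [h1, h2]
  constructor
  · intro h t
    rw [h]
    simp [mpair, ZFSet.pair]
  · intro h
    apply ext_M
    intro t
    rw [h]
    simp [mpair, ZFSet.pair]

end Closure
end Raw

/-! ### Types coded in `M`, definable predicates and definable functions -/

section Coded

/-- The elements of the type `A` are coded by elements of `M`; the codes form a definable class. -/
class Coded (M : Set ZFSet.{u}) (A : Type v) where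
  code : A → M
  inj : Function.Injective code
  raw : RawDef fun v : Fin 1 → M => ∃ a, v 0 = code a

/-- The codes of the elements of `A` form a set in `M`. -/
class IsSmall (M : Set ZFSet.{u}) (A : Type v) [Coded M A] : Prop where
  out : ∃ z : M, ∀ t : M, t.1 ∈ z.1 ↔ ∃ a : A, t = Coded.code a

variable {M : Set ZFSet.{u}}

/-- A predicate on a coded type is definable over `M` with parameters. -/
def DSet (M : Set ZFSet.{u}) {A : Type v} [Coded M A] (P : A → Prop) : Prop :=
  RawDef fun v : Fin 1 → M => ∃ a, v 0 = Coded.code a ∧ P a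

/-- A function between coded types is definable over `M` with parameters. -/
def DFun (M : Set ZFSet.{u}) {A : Type v} {B : Type w} [Coded M A] [Coded M B]
    (f : A → B) : Prop :=
  RawDef fun v : Fin 2 → M => ∃ a, v 0 = Coded.code a ∧ v 1 = Coded.code (f a)

open Coded

variable {A : Type v} {B : Type w} {C : Type w'} [Coded M A] [Coded M B] [Coded M C]

theorem code_inj {a b : A} : (code a : M) = code b ↔ a = b := Coded.inj.eq_iff

instance instCodedM : Coded M M where
  code := id
  inj := Function.injective_id
  raw := (RawDef.eq 0 0).congr fun v => by simp

variable [hM : Fact (IsTransitiveModelZFC M)]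

instance instCodedProd : Coded M (A × B) where
  code p := mpair (code p.1) (code p.2)
  inj := by
    rintro ⟨a, b⟩ ⟨a', b'⟩ h
    rw [mpair_inj, code_inj, code_inj] at h
    exact Prod.ext h.1 h.2
  raw := by
    have : RawDef fun v : Fin 1 → M => ∃ x y, (∃ a : A, x = code a) ∧ (∃ b : B, y = code b) ∧
        v 0 = mpair x y := by
      refine RawDef.ex (RawDef.ex ?_)
      refine RawDef.and ?_ (RawDef.and ?_ (RawDef.isPair _ _ _))
      · exact RawDef.subst₁ (S := fun x => ∃ a : A, x = code a) Coded.raw _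
      · exact RawDef.subst₁ (S := fun x => ∃ a : B, x = code a) Coded.raw _
    refine this.congr fun v => ?_
    constructor
    · rintro ⟨p, hp⟩
      exact ⟨_, _, ⟨_, rfl⟩, ⟨_, rfl⟩, hp⟩
    · rintro ⟨_, _, ⟨a, rfl⟩, ⟨b, rfl⟩, h⟩
      exact ⟨(a, b), h⟩

theorem code_prod (a : A) (b : B) : (code (a, b) : M) = mpair (code a) (code b) := rfl

namespace DSet

variable {P Q : A → Prop}

theorem raw (h : DSet M P) {α : Type} (i : α) :
    RawDef fun v : α → M => ∃ a, v i = code a ∧ P a :=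
  RawDef.subst₁ (S := fun x => ∃ a, x = code a ∧ P a) h i

theorem and (hP : DSet M P) (hQ : DSet M Q) : DSet M fun a => P a ∧ Q a := by
  refine (RawDef.and hP hQ).congr fun v => ?_
  constructor
  · rintro ⟨a, ha, h⟩
    exact ⟨⟨a, ha, h.1⟩, ⟨a, ha, h.2⟩⟩
  · rintro ⟨⟨a, ha, h⟩, ⟨b, hb, h'⟩⟩
    rw [ha, code_inj] at hb
    subst hb
    exact ⟨a, ha, h, h'⟩

theorem not (hP : DSet M P) : DSet M fun a => ¬ P a := by
  refine (RawDef.and (Coded.raw (A := A)) (RawDef.not hP)).congr fun v => ?_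
  constructor
  · rintro ⟨a, ha, h⟩
    refine ⟨⟨a, ha⟩, ?_⟩
    rintro ⟨b, hb, h'⟩
    rw [ha, code_inj] at hb
    subst hb
    exact h h'
  · rintro ⟨⟨a, ha⟩, h'⟩
    exact ⟨a, ha, fun h => h' ⟨a, ha, h⟩⟩

theorem ex {R : A → B → Prop} (h : DSet M fun p : A × B => R p.1 p.2) :
    DSet M fun a => ∃ b, R a b := by
  have : RawDef fun v : Fin 1 → M => ∃ y z, (∃ p : A × B, z = code p ∧ R p.1 p.2) ∧
      z = mpair (v 0) y := by
    refine RawDef.ex (RawDef.ex (RawDef.and ?_ (RawDef.isPair _ _ _)))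
    exact h.raw _
  refine this.congr fun v => ?_
  constructor
  · rintro ⟨a, ha, b, h⟩
    exact ⟨code b, code (a, b), ⟨(a, b), rfl, h⟩, by rw [ha]; rfl⟩
  · rintro ⟨y, z, ⟨⟨a, b⟩, rfl, h⟩, hz⟩
    rw [code_prod, mpair_inj] at hz
    exact ⟨a, hz.1.symm, b, h⟩

end DSet

namespace DFun

theorem raw {f : A → B} (h : DFun M f) {α : Type} (i j : α) :
    RawDef fun v : α → M => ∃ a, v i = code a ∧ v j = code (f a) :=
  RawDef.subst₂ (S := fun x y => ∃ a, x = code a ∧ y = code (f a)) h i j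

theorem comp_set {f : A → B} {P : B → Prop} (hP : DSet M P) (hf : DFun M f) :
    DSet M fun a => P (f a) := by
  have : RawDef fun v : Fin 1 → M => ∃ y, (∃ a, v 0 = code a ∧ y = code (f a)) ∧
      ∃ b, y = code b ∧ P b :=
    RawDef.ex ((hf.raw _ _).and (hP.raw _))
  refine this.congr fun v => ?_
  constructor
  · rintro ⟨a, ha, h⟩
    exact ⟨_, ⟨a, ha, rfl⟩, _, rfl, h⟩
  · rintro ⟨y, ⟨a, ha, hy⟩, b, hb, h⟩
    rw [hy, code_inj] at hb
    subst hb
    exact ⟨a, ha, h⟩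

theorem comp {f : A → B} {g : B → C} (hg : DFun M g) (hf : DFun M f) :
    DFun M fun a => g (f a) := by
  have : RawDef fun v : Fin 2 → M => ∃ y, (∃ a, v 0 = code a ∧ y = code (f a)) ∧
      ∃ b, y = code b ∧ v 1 = code (g b) :=
    RawDef.ex ((hf.raw _ _).and (hg.raw _ _))
  refine this.congr fun v => ?_
  constructor
  · rintro ⟨a, ha, h⟩
    exact ⟨_, ⟨a, ha, rfl⟩, _, rfl, h⟩
  · rintro ⟨y, ⟨a, ha, hy⟩, b, hb, h⟩
    rw [hy, code_inj] at hb
    subst hb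
    exact ⟨a, ha, h⟩

theorem id : DFun M fun a : A => a := by
  have : RawDef fun v : Fin 2 → M => (∃ a : A, v 0 = code a) ∧ v 0 = v 1 :=
    (RawDef.subst₁ (S := fun x => ∃ a : A, x = code a) Coded.raw _).and (RawDef.eq _ _)
  refine this.congr fun v => ?_
  constructor
  · rintro ⟨a, h, h'⟩
    exact ⟨⟨a, h⟩, h.trans h'.symm⟩
  · rintro ⟨⟨a, h⟩, h'⟩
    exact ⟨a, h, h' ▸ h⟩

theorem const (b : B) : DFun M fun _ : A => b := by
  have : RawDef fun v : Fin 2 → M => (∃ a : A, v 0 = code a) ∧ v 1 = code b :=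
    (RawDef.subst₁ (S := fun x => ∃ a : A, x = code a) Coded.raw _).and (RawDef.eqConst _ _)
  refine this.congr fun v => ?_
  constructor
  · rintro ⟨a, h, h'⟩
    exact ⟨⟨a, h⟩, h'⟩
  · rintro ⟨⟨a, h⟩, h'⟩
    exact ⟨a, h, h'⟩

theorem fst_aux : DFun M (Prod.fst : A × B → A) := by
  have : RawDef fun v : Fin 2 → M => (∃ p : A × B, v 0 = code p) ∧ ∃ y, v 0 = mpair (v 1) y :=
    (RawDef.subst₁ (S := fun x => ∃ a : A × B, x = code a) Coded.raw _).and
      (RawDef.ex (RawDef.isPair _ _ _))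
  refine this.congr fun v => ?_
  constructor
  · rintro ⟨a, h, h'⟩
    exact ⟨⟨a, h⟩, code a.2, by rw [h, h']; rfl⟩
  · rintro ⟨⟨p, h⟩, y, h'⟩
    refine ⟨p, h, ?_⟩
    rw [h] at h'
    exact (mpair_inj.1 h').1.symm

theorem snd_aux : DFun M (Prod.snd : A × B → B) := by
  have : RawDef fun v : Fin 2 → M => (∃ p : A × B, v 0 = code p) ∧ ∃ y, v 0 = mpair y (v 1) :=
    (RawDef.subst₁ (S := fun x => ∃ a : A × B, x = code a) Coded.raw _).and
      (RawDef.ex (RawDef.isPair _ _ _))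
  refine this.congr fun v => ?_
  constructor
  · rintro ⟨a, h, h'⟩
    exact ⟨⟨a, h⟩, code a.1, by rw [h, h']; rfl⟩
  · rintro ⟨⟨p, h⟩, y, h'⟩
    refine ⟨p, h, ?_⟩
    rw [h] at h'
    exact (mpair_inj.1 h').2.symm

theorem fst {f : C → A × B} (hf : DFun M f) : DFun M fun c => (f c).1 := comp fst_aux hf

theorem snd {f : C → A × B} (hf : DFun M f) : DFun M fun c => (f c).2 := comp snd_aux hf

theorem prodMk {f : A → B} {g : A → C} (hf : DFun M f) (hg : DFun M g) :
    DFun M fun a => (f a, g a) := by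
  have : RawDef fun v : Fin 2 → M => ∃ y z, (∃ a, v 0 = code a ∧ y = code (f a)) ∧
      (∃ a, v 0 = code a ∧ z = code (g a)) ∧ v 1 = mpair y z :=
    RawDef.ex (RawDef.ex ((hf.raw _ _).and ((hg.raw _ _).and (RawDef.isPair _ _ _))))
  refine this.congr fun v => ?_
  constructor
  · rintro ⟨a, ha, h⟩
    exact ⟨_, _, ⟨a, ha, rfl⟩, ⟨a, ha, rfl⟩, h⟩
  · rintro ⟨_, _, ⟨a, ha, rfl⟩, ⟨b, hb, rfl⟩, h⟩
    rw [ha, code_inj] at hb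
    subst hb
    exact ⟨a, ha, h⟩

theorem graph {f : A → B} (hf : DFun M f) : DSet M fun p : A × B => p.2 = f p.1 := by
  have : RawDef fun v : Fin 1 → M => ∃ x y, (∃ a, x = code a ∧ y = code (f a)) ∧
      v 0 = mpair x y :=
    RawDef.ex (RawDef.ex ((hf.raw _ _).and (RawDef.isPair _ _ _)))
  refine this.congr fun v => ?_
  constructor
  · rintro ⟨⟨a, b⟩, ha, h⟩
    exact ⟨_, _, ⟨a, rfl, rfl⟩, by rw [ha]; simp only at h; rw [h]; rfl⟩
  · rintro ⟨_, _, ⟨a, rfl, rfl⟩, h⟩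
    exact ⟨(a, f a), h, rfl⟩

theorem of_graph {f : A → B} (hf : DSet M fun p : A × B => p.2 = f p.1) : DFun M f := by
  have : RawDef fun v : Fin 2 → M => ∃ z, (∃ p : A × B, z = code p ∧ p.2 = f p.1) ∧
      z = mpair (v 0) (v 1) :=
    RawDef.ex ((hf.raw _).and (RawDef.isPair _ _ _))
  refine this.congr fun v => ?_
  constructor
  · rintro ⟨a, ha, h⟩
    exact ⟨code (a, f a), ⟨_, rfl, rfl⟩, by rw [ha, h]; rfl⟩
  · rintro ⟨_, ⟨⟨a, b⟩, rfl, hb⟩, h⟩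
    simp only at hb
    subst hb
    rw [code_prod, mpair_inj] at h
    exact ⟨a, h.1.symm, h.2.symm⟩

end DFun

namespace DSet

theorem eq {f g : A → B} (hf : DFun M f) (hg : DFun M g) : DSet M fun a => f a = g a :=
  DFun.comp_set (P := fun p : A × B => p.2 = f p.1) hf.graph (DFun.prodMk DFun.id hg) |>.congr
    fun v => by simp only [eq_comm]

theorem congr {P Q : A → Prop} (h : DSet M P) (hPQ : ∀ a, Q a ↔ P a) : DSet M Q := by
  have : Q = P := funext fun v => propext (hPQ v)
  rw [this]; exact h

variable {P Q : A → Prop}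

theorem or (hP : DSet M P) (hQ : DSet M Q) : DSet M fun a => P a ∨ Q a :=
  (hP.not.and hQ.not).not.congr fun _ => by tauto

theorem imp (hP : DSet M P) (hQ : DSet M Q) : DSet M fun a => P a → Q a :=
  (hP.not.or hQ).congr fun _ => by tauto

theorem iff (hP : DSet M P) (hQ : DSet M Q) : DSet M fun a => (P a ↔ Q a) :=
  ((hP.imp hQ).and (hQ.imp hP)).congr fun _ => iff_def

theorem all {R : A → B → Prop} (h : DSet M fun p : A × B => R p.1 p.2) :
    DSet M fun a => ∀ b, R a b :=
  (DSet.ex (R := fun a b => ¬ R a b) h.not).not.congr fun a => by simp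

theorem mem {f g : A → M} (hf : DFun M f) (hg : DFun M g) :
    DSet M fun a => (f a : ZFSet.{u}) ∈ (g a : ZFSet.{u}) := by
  have : RawDef fun v : Fin 1 → M => ∃ y z, (∃ a, v 0 = code a ∧ y = code (f a)) ∧
      (∃ a, v 0 = code a ∧ z = code (g a)) ∧ y.1 ∈ z.1 :=
    RawDef.ex (RawDef.ex ((hf.raw _ _).and ((hg.raw _ _).and (RawDef.mem _ _))))
  refine RawDef.congr this fun v => ?_
  constructor
  · rintro ⟨a, ha, h⟩
    exact ⟨_, _, ⟨a, ha, rfl⟩, ⟨a, ha, rfl⟩, h⟩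
  · rintro ⟨_, _, ⟨a, ha, rfl⟩, ⟨b, hb, rfl⟩, h⟩
    rw [ha, code_inj] at hb
    subst hb
    exact ⟨a, ha, h⟩

end DSet

/-- The code of an element is a definable function. -/
theorem DFun.code {f : C → A} (hf : DFun M f) : DFun M fun c => (Coded.code (f c) : M) := by
  refine DFun.comp (g := fun a : A => (Coded.code a : M)) ?_ hf
  have : RawDef fun v : Fin 2 → M => (∃ a : A, v 0 = Coded.code a) ∧ v 0 = v 1 :=
    (RawDef.subst₁ (S := fun x => ∃ a : A, x = Coded.code a) Coded.raw _).and (RawDef.eq _ _)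
  refine this.congr fun v => ?_
  constructor
  · rintro ⟨a, h, h'⟩
    exact ⟨⟨a, h⟩, h.trans h'.symm⟩
  · rintro ⟨⟨a, h⟩, h'⟩
    exact ⟨a, h, h' ▸ h⟩

theorem DFun.mpair {f g : A → M} (hf : DFun M f) (hg : DFun M g) :
    DFun M fun a => mpair (f a) (g a) :=
  DFun.code (DFun.prodMk hf hg)

attribute [fun_prop] DSet DFun
attribute [fun_prop] DFun.id DFun.const DFun.comp DFun.fst DFun.snd DFun.prodMk DFun.code DFun.mpair
attribute [fun_prop] DSet.and DSet.or DSet.not DSet.ex DSet.eq DSet.mem DSet.iff DSet.all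
  DSet.imp

end Coded

open Coded

/-! ### Separation, replacement, power sets and choice for small coded types -/

section Small

variable {M : Set ZFSet.{u}} [hM : Fact (IsTransitiveModelZFC M)]
  {A : Type v} {B : Type w} {C : Type w'} [Coded M A] [Coded M B] [Coded M C]

theorem exists_sep {P : M → Prop} (h : DSet M P) (x : M) :
    ∃ z : M, ∀ t : M, t.1 ∈ z.1 ↔ t.1 ∈ x.1 ∧ P t := by
  refine hM.out.separation {t | P t} ?_ x
  refine RawDef.congr (Q := fun v : Fin 1 → M => P (v 0)) h fun v => ?_
  exact ⟨fun h => ⟨v 0, rfl, h⟩, fun ⟨a, h, h'⟩ => by rw [h]; exact h'⟩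

theorem DSet.code_image {P : A → Prop} (h : DSet M P) :
    DSet M fun x : M => ∃ a : A, x = code a ∧ P a := by
  refine DSet.ex (DSet.and (by fun_prop) ?_)
  exact DFun.comp_set (f := fun p : M × A => p.2) h (by fun_prop)

theorem exists_sep_small [hA : IsSmall M A] {P : A → Prop} (h : DSet M P) :
    ∃ z : M, ∀ t : M, t.1 ∈ z.1 ↔ ∃ a, t = code a ∧ P a := by
  obtain ⟨x, hx⟩ := hA.out
  obtain ⟨z, hz⟩ := exists_sep h.code_image x
  refine ⟨z, fun t => ?_⟩
  rw [hz, hx]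
  exact ⟨fun h => h.2, fun ⟨a, h, h'⟩ => ⟨⟨a, h⟩, a, h, h'⟩⟩

/-- Replacement along a partial function on a small type. -/
theorem exists_replacement [IsSmall M A] {R : A → M → Prop}
    (h : DSet M fun p : A × M => R p.1 p.2) (hR : ∀ a x y, R a x → R a y → x = y) :
    ∃ z : M, ∀ t : M, t.1 ∈ z.1 ↔ ∃ a, R a t := by
  -- The axiom asks for a value at every element of the domain, so the domain is first cut down to
  -- the arguments that have one.
  obtain ⟨d, hd⟩ := exists_sep_small (M := M) (A := A) (P := fun a => ∃ x, R a x) (DSet.ex h)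
  have key : RawDef fun v : Fin 2 → M => ∃ z, (∃ p : A × M, z = code p ∧ R p.1 p.2) ∧
      z = mpair (v 0) (v 1) := RawDef.ex ((h.raw _).and (RawDef.isPair _ _ _))
  have hiff : ∀ x y : M, (∃ z, (∃ p : A × M, z = code p ∧ R p.1 p.2) ∧ z = mpair x y) ↔
      ∃ a, x = code a ∧ R a y := by
    intro x y
    constructor
    · rintro ⟨_, ⟨⟨a, b⟩, rfl, hab⟩, hz⟩
      rw [code_prod, mpair_inj] at hz
      obtain ⟨rfl, rfl⟩ := hz
      exact ⟨a, rfl, hab⟩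
    · rintro ⟨a, rfl, ha⟩
      exact ⟨code (a, y), ⟨_, rfl, ha⟩, rfl⟩
  simp only [hiff] at key
  obtain ⟨z, hz⟩ := hM.out.replacement {p | ∃ a, p.1 = code a ∧ R a p.2} key d (by
    intro x hx
    obtain ⟨a, rfl, y, hy⟩ := (hd x).1 hx
    refine ⟨y, ⟨a, rfl, hy⟩, ?_⟩
    rintro y' ⟨a', ha', hy'⟩
    simp only [code_inj] at ha'
    subst ha'
    exact hR _ _ _ hy' hy)
  refine ⟨z, fun t => ?_⟩
  rw [hz]
  constructor
  · rintro ⟨_, _, a, _, ha⟩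
    exact ⟨a, ha⟩
  · rintro ⟨a, ha⟩
    exact ⟨code a, (hd _).2 ⟨a, rfl, t, ha⟩, a, rfl, ha⟩

theorem exists_sUnion (x : M) : ∃ z : M, ∀ t : M, t.1 ∈ z.1 ↔ ∃ y : M, y.1 ∈ x.1 ∧ t.1 ∈ y.1 := by
  obtain ⟨z, hz, h⟩ := hM.out.union x.1 x.2
  refine ⟨⟨z, hz⟩, fun t => ?_⟩
  rw [h t.1 t.2]
  exact ⟨fun ⟨y, hy, h⟩ => ⟨⟨y, hy⟩, h⟩, fun ⟨y, h⟩ => ⟨y.1, y.2, h⟩⟩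

/-- Each row of the product is obtained by replacement, the set of rows by a second replacement, and
the product is the union of the rows. -/
instance instIsSmallProd [IsSmall M A] [IsSmall M B] : IsSmall M (A × B) where
  out := by
    have row : ∀ b : B, ∃ z : M, ∀ t : M, t.1 ∈ z.1 ↔ ∃ a : A, t = mpair (code a) (code b) := by
      intro b
      refine exists_replacement (R := fun (a : A) t => t = mpair (code a) (code b))
        (by fun_prop) ?_
      rintro a x y rfl rfl
      rfl
    obtain ⟨w, hw⟩ := exists_replacement (M := M)
      (R := fun (b : B) z => ∀ t : M, t.1 ∈ z.1 ↔ ∃ a : A, t = mpair (code a) (code b))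
      (by fun_prop) (fun b x y hx hy => ext_M fun t => by rw [hx, hy])
    obtain ⟨z, hz⟩ := exists_sUnion w
    refine ⟨z, fun t => ?_⟩
    rw [hz]
    constructor
    · rintro ⟨y, hy, ht⟩
      obtain ⟨b, hb⟩ := (hw y).1 hy
      obtain ⟨a, ha⟩ := (hb t).1 ht
      exact ⟨(a, b), ha⟩
    · rintro ⟨⟨a, b⟩, rfl⟩
      obtain ⟨y, hy⟩ := row b
      exact ⟨y, (hw y).2 ⟨b, hy⟩, (hy _).2 ⟨a, rfl⟩⟩

/-- The subsets of `A` which belong to `M`. -/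
def MSub (M : Set ZFSet.{u}) (A : Type v) [Coded M A] : Type v :=
  {S : Set A // ∃ z : M, ∀ t : M, t.1 ∈ z.1 ↔ ∃ a, t = code a ∧ a ∈ S}

instance : Membership A (MSub M A) where
  mem S a := a ∈ S.1

theorem MSub.ext {S T : MSub M A} (h : ∀ a, a ∈ S ↔ a ∈ T) : S = T :=
  Subtype.ext (Set.ext h)

/-- Comprehension for definable predicates on a small type. -/
def MSub.mk [IsSmall M A] (P : A → Prop) (h : DSet M P) : MSub M A :=
  ⟨{a | P a}, exists_sep_small h⟩

@[simp]
theorem MSub.mem_mk [IsSmall M A] {P : A → Prop} (h : DSet M P) {a : A} :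
    a ∈ MSub.mk P h ↔ P a := Iff.rfl

/-- Translates between the form in which the statement says that a set belongs to `M` and the form
used by `MSub`. -/
theorem image_inModel_iff {S : Set A} : InModel M ((fun a => (code a : M).1) '' S) ↔
    ∃ z : M, ∀ t : M, t.1 ∈ z.1 ↔ ∃ a, t = code a ∧ a ∈ S := by
  rw [inModel_iff]
  refine exists_congr fun z => ?_
  constructor
  · intro h t
    rw [h]
    constructor
    · rintro ⟨a, ha, h⟩
      exact ⟨a, Subtype.ext h.symm, ha⟩
    · rintro ⟨a, rfl, h⟩
      exact ⟨a, h, rfl⟩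
  · intro h t
    constructor
    · intro ht
      obtain ⟨a, h, h'⟩ := (h ⟨t, mem_of_mem z.2 ht⟩).1 ht
      exact ⟨a, h', (congrArg Subtype.val h).symm⟩
    · rintro ⟨a, ha, rfl⟩
      exact (h _).2 ⟨a, rfl, ha⟩

/-- The chosen code is unique by extensionality. The class of codes is definable because an element
of `M` codes a subset as soon as all its elements are codes. -/
noncomputable instance instCodedMSub [IsSmall M A] : Coded M (MSub M A) where
  code S := S.2.choose
  inj := by
    intro S T h
    apply MSub.ext
    intro a
    have hS := S.2.choose_spec (code a)
    have hT := T.2.choose_spec (code a)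
    simp only at h
    rw [h] at hS
    have e : ∀ S : MSub M A, (∃ b, (code a : M) = code b ∧ b ∈ S.1) ↔ a ∈ S := by
      intro S
      constructor
      · rintro ⟨b, hb, h⟩
        rw [code_inj] at hb
        rw [hb]
        exact h
      · intro h
        exact ⟨a, rfl, h⟩
    rw [← e S, ← e T, ← hS, hT]
  raw := by
    have : DSet M fun x : M => ∀ t : M, t.1 ∈ x.1 → ∃ a : A, t = code a := by fun_prop
    refine RawDef.congr this fun v => ?_
    constructor
    · rintro ⟨S, hS⟩
      refine ⟨v 0, rfl, fun t ht => ?_⟩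
      rw [hS] at ht
      obtain ⟨a, h, _⟩ := (S.2.choose_spec t).1 ht
      exact ⟨a, h⟩
    · rintro ⟨x, hx, h⟩
      rw [hx]
      have h2 : ∀ t : M, t.1 ∈ x.1 ↔ ∃ a : A, t = code a ∧ a ∈ {a : A | (code a : M).1 ∈ x.1} := by
        intro t
        constructor
        · intro ht
          obtain ⟨a, rfl⟩ := h t ht
          exact ⟨a, rfl, ht⟩
        · rintro ⟨a, rfl, h⟩
          exact h
      let S : MSub M A := ⟨{a : A | (code a : M).1 ∈ x.1}, x, h2⟩
      refine ⟨S, ?_⟩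
      apply ext_M
      intro t
      rw [S.2.choose_spec t]
      exact h2 t

theorem mem_code_iff [IsSmall M A] (S : MSub M A) (t : M) :
    t.1 ∈ (code S : M).1 ↔ ∃ a, t = code a ∧ a ∈ S := S.2.choose_spec t

theorem code_mem_code_iff [IsSmall M A] (S : MSub M A) (a : A) :
    (code a : M).1 ∈ (code S : M).1 ↔ a ∈ S := by
  rw [mem_code_iff]
  constructor
  · rintro ⟨b, hb, h⟩
    rw [code_inj] at hb
    rwa [hb]
  · intro h
    exact ⟨a, rfl, h⟩

theorem coe_code_eq_image [IsSmall M A] (S : MSub M A) :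
    ((code S : M).1 : Set ZFSet.{u}) = (fun a => (code a : M).1) '' S.1 := by
  ext t
  constructor
  · intro ht
    obtain ⟨a, h, h'⟩ := (mem_code_iff S ⟨t, mem_of_mem (code S : M).2 ht⟩).1 ht
    exact ⟨a, h', (congrArg Subtype.val h).symm⟩
  · rintro ⟨a, ha, rfl⟩
    exact (code_mem_code_iff S a).2 ha

/-- An element of `M` all of whose elements are codes is the code of a set. -/
theorem exists_code_eq [IsSmall M A] (x : M) (h : ∀ t : M, t.1 ∈ x.1 → ∃ a : A, t = code a) :
    ∃ S : MSub M A, x = code S := by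
  have h2 : ∀ t : M, t.1 ∈ x.1 ↔ ∃ a : A, t = code a ∧ a ∈ {a : A | (code a : M).1 ∈ x.1} := by
    intro t
    constructor
    · intro ht
      obtain ⟨a, rfl⟩ := h t ht
      exact ⟨a, rfl, ht⟩
    · rintro ⟨a, rfl, h⟩
      exact h
  let S : MSub M A := ⟨{a : A | (code a : M).1 ∈ x.1}, x, h2⟩
  exact ⟨S, ext_M fun t => (h2 t).trans (mem_code_iff S t).symm⟩

@[fun_prop]
theorem DSet.mem_sub [IsSmall M A] {f : C → A} {g : C → MSub M A} (hf : DFun M f)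
    (hg : DFun M g) : DSet M fun c => f c ∈ g c :=
  (DSet.mem (DFun.code hf) (DFun.code hg)).congr fun _ => (code_mem_code_iff _ _).symm

/-- Equality of subsets unfolds to a quantifier over their elements, so a definable membership
relation is enough. -/
theorem DFun.msub [IsSmall M A] {F : C → MSub M A}
    (h : DSet M fun p : C × A => p.2 ∈ F p.1) : DFun M F := by
  apply DFun.of_graph
  have : DSet M fun p : C × MSub M A => ∀ a : A, a ∈ p.2 ↔ a ∈ F p.1 := by
    refine DSet.all (DSet.iff (by fun_prop) ?_)
    exact DFun.comp_set (f := fun p : (C × MSub M A) × A => (p.1.1, p.2)) h (by fun_prop)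
  refine this.congr fun p => ?_
  exact ⟨fun h => by simp [h], MSub.ext⟩

instance instIsSmallMSub [hA : IsSmall M A] : IsSmall M (MSub M A) where
  out := by
    obtain ⟨x, hx⟩ := hA.out
    obtain ⟨z, hz, h⟩ := hM.out.powerset x.1 x.2
    refine ⟨⟨z, hz⟩, fun t => ?_⟩
    rw [h t.1 t.2]
    constructor
    · intro ht
      exact exists_code_eq t fun s hs => (hx s).1 (ht s.1 s.2 hs)
    · rintro ⟨S, rfl⟩ y hy hyS
      obtain ⟨a, ha, _⟩ := (mem_code_iff S ⟨y, hy⟩).1 hyS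
      exact (hx ⟨y, hy⟩).2 ⟨a, ha⟩

/-- The axiom of choice in `M`. -/
theorem exists_choice [IsSmall M A] [IsSmall M B] {R : A → B → Prop}
    (h : DSet M fun p : A × B => R p.1 p.2) (hR : ∀ a, ∃ b, R a b) :
    ∃ g : A → B, DFun M g ∧ ∀ a, R a (g a) := by
  have hF : ∀ a, DSet M fun p : A × B => p.1 = a ∧ R p.1 p.2 := fun a => by fun_prop
  -- The axiom of choice is stated for disjoint families; tagging the elements of each fibre with
  -- its index makes the fibres disjoint.
  let F : A → MSub M (A × B) := fun a => MSub.mk (fun p => p.1 = a ∧ R p.1 p.2) (hF a)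
  have hFd : DFun M F := by
    refine DFun.msub ?_
    simp only [F, MSub.mem_mk]
    refine DSet.and (by fun_prop) ?_
    exact DFun.comp_set (f := fun p : A × (A × B) => p.2) h (by fun_prop)
  obtain ⟨x, hx⟩ := exists_sep_small (M := M) (A := MSub M (A × B)) (P := fun S => ∃ a, S = F a)
    (by fun_prop)
  obtain ⟨c, hcM, hc⟩ := hM.out.choice x.1 x.2 (by
      intro y hy hyx
      obtain ⟨_, hS, a, rfl⟩ := (hx ⟨y, hy⟩).1 hyx
      obtain ⟨b, hb⟩ := hR a
      refine ⟨(code (a, b) : M).1, (code (a, b) : M).2, ?_⟩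
      have := (code_mem_code_iff (F a) (a, b)).2 ⟨rfl, hb⟩
      rwa [← hS] at this)
    (by
      rintro y hy hyx z hz hzx ⟨t, htM, hty, htz⟩
      obtain ⟨_, hS, a, rfl⟩ := (hx ⟨y, hy⟩).1 hyx
      obtain ⟨_, hS', a', rfl⟩ := (hx ⟨z, hz⟩).1 hzx
      have h1 : t ∈ (code (F a) : M).1 := by rw [← hS]; exact hty
      have h2 : t ∈ (code (F a') : M).1 := by rw [← hS']; exact htz
      obtain ⟨p, hp, hpa⟩ := (mem_code_iff _ ⟨t, htM⟩).1 h1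
      obtain ⟨p', hp', hpa'⟩ := (mem_code_iff _ ⟨t, htM⟩).1 h2
      rw [hp, code_inj] at hp'
      subst hp'
      have : a = a' := hpa.1.symm.trans hpa'.1
      subst this
      exact congrArg Subtype.val (hS.trans hS'.symm))
  have key : ∀ a, ∃! b, R a b ∧ (code (a, b) : M).1 ∈ c := by
    intro a
    obtain ⟨t, ⟨htM, hta, htc⟩, huniq⟩ := hc (code (F a) : M).1 (code (F a) : M).2
      ((hx _).2 ⟨_, rfl, a, rfl⟩)
    obtain ⟨⟨a', b⟩, hp, ha, hb⟩ := (mem_code_iff _ ⟨t, htM⟩).1 hta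
    simp only at ha hb
    subst ha
    have hp' : t = (code (a', b) : M).1 := congrArg Subtype.val hp
    refine ⟨b, ⟨hb, hp' ▸ htc⟩, ?_⟩
    rintro b' ⟨hb', hbc'⟩
    have := huniq (code (a', b') : M).1 ⟨(code (a', b') : M).2,
      (code_mem_code_iff (F a') (a', b')).2 ⟨rfl, hb'⟩, hbc'⟩
    rw [hp'] at this
    have := code_inj.1 (Subtype.ext this)
    exact (Prod.ext_iff.1 this).2
  choose g hg hg' using key
  refine ⟨g, ?_, fun a => (hg a).1⟩
  apply DFun.of_graph
  have : DSet M fun p : A × B => R p.1 p.2 ∧ (code p : M).1 ∈ (⟨c, hcM⟩ : M).1 :=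
    h.and (by fun_prop)
  refine this.congr fun p => ?_
  constructor
  · intro hp
    have := hg p.1
    rw [← hp] at this
    exact this
  · exact hg' p.1 p.2

/-- A type is coded by an injection with definable range into a coded type. -/
@[reducible]
def Coded.ofInjective {D : Type*} (f : D → A) (hf : Function.Injective f)
    (h : DSet M fun a => ∃ d, a = f d) : Coded M D where
  code d := code (f d)
  inj := Coded.inj.comp hf
  raw := by
    refine RawDef.congr h fun v => ?_
    constructor
    · rintro ⟨d, hd⟩
      exact ⟨f d, hd, d, rfl⟩
    · rintro ⟨_, ha, d, rfl⟩
      exact ⟨d, ha⟩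

end Small

/-! ### Natural numbers, recursion, dependent choice and well-foundedness in `M` -/

section Naturals

variable {M : Set ZFSet.{u}} [hM : Fact (IsTransitiveModelZFC M)]
  {A : Type v} {B : Type w} {C : Type w'} [Coded M A] [Coded M B] [Coded M C]

theorem natCode_mem_natCode {m n : ℕ} (h : m < n) : natCode.{u} m ∈ natCode.{u} n := by
  induction n with
  | zero => omega
  | succ n ih =>
    rw [natCode, ZFSet.mem_insert_iff]
    rcases Nat.lt_succ_iff_lt_or_eq.1 h with h | rfl
    · exact Or.inr (ih h)
    · exact Or.inl rfl

theorem natCode_injective : Function.Injective natCode.{u} := by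
  intro m n h
  rcases lt_trichotomy m n with h' | h' | h'
  · exact absurd (h ▸ natCode_mem_natCode h') (ZFSet.mem_irrefl _)
  · exact h'
  · exact absurd (h ▸ natCode_mem_natCode h') (ZFSet.mem_irrefl _)

/-- `w` is an inductive set in `M`. -/
def IsInductiveSet (w : M) : Prop :=
  (∃ e : M, (∀ t : M, t.1 ∉ e.1) ∧ e.1 ∈ w.1) ∧
    ∀ n : M, n.1 ∈ w.1 → ∃ s : M, s.1 ∈ w.1 ∧ ∀ t : M, t.1 ∈ s.1 ↔ t.1 ∈ n.1 ∨ t = n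

theorem DSet.isInductiveSet : DSet M fun w : M => IsInductiveSet w := by
  unfold IsInductiveSet; fun_prop

theorem eq_empty_of_M {e : M} (h : ∀ t : M, t.1 ∉ e.1) : e.1 = ∅ := by
  rw [ZFSet.eq_empty]
  intro t ht
  exact h ⟨t, mem_of_mem e.2 ht⟩ ht

theorem eq_insert_of_M {s n : M} (h : ∀ t : M, t.1 ∈ s.1 ↔ t.1 ∈ n.1 ∨ t = n) :
    s.1 = insert n.1 n.1 := by
  ext t
  rw [ZFSet.mem_insert_iff]
  constructor
  · intro ht
    rcases (h ⟨t, mem_of_mem s.2 ht⟩).1 ht with h' | h'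
    · exact Or.inr h'
    · exact Or.inl (congrArg Subtype.val h')
  · rintro (rfl | ht)
    · exact (h n).2 (Or.inr rfl)
    · exact (h ⟨t, mem_of_mem n.2 ht⟩).2 (Or.inl ht)

theorem IsInductiveSet.natCode_mem {w : M} (hw : IsInductiveSet w) (n : ℕ) :
    natCode.{u} n ∈ w.1 := by
  induction n with
  | zero =>
    obtain ⟨e, he, hew⟩ := hw.1
    rw [natCode, ← eq_empty_of_M he]
    exact hew
  | succ n ih =>
    obtain ⟨s, hs, h⟩ := hw.2 ⟨natCode n, mem_of_mem w.2 ih⟩ ih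
    rw [natCode, ← eq_insert_of_M h]
    exact hs

theorem exists_isInductiveSet : ∃ w : M, IsInductiveSet w := by
  obtain ⟨z, hz, ⟨e, he, h, h'⟩, h2⟩ := hM.out.infinity
  refine ⟨⟨z, hz⟩, ⟨⟨e, he⟩, fun t => h t.1 t.2, h'⟩, fun n hn => ?_⟩
  obtain ⟨s, hs, hsz, h⟩ := h2 n.1 n.2 hn
  exact ⟨⟨s, hs⟩, hsz, fun t => by rw [Subtype.ext_iff]; exact h t.1 t.2⟩

theorem natCode_mem_M (n : ℕ) : natCode.{u} n ∈ M := by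
  obtain ⟨w, hw⟩ := exists_isInductiveSet (M := M)
  exact mem_of_mem w.2 (hw.natCode_mem n)

/-- The natural numbers are absolute. Let I be the intersection of all inductive sets of `M`, and J
the part of I consisting of the empty set and of successors of elements of I. Then J is inductive,
so every element of I has this form, and an ∈-induction in `V` shows that it is a standard natural
number. -/
theorem isNat_iff (x : M) :
    (∀ w : M, IsInductiveSet w → x.1 ∈ w.1) ↔ ∃ n : ℕ, x.1 = natCode.{u} n := by
  constructor
  · intro hx
    obtain ⟨z, hz⟩ := exists_isInductiveSet (M := M)
    have hd : DSet M fun x : M => ∀ w : M, IsInductiveSet w → x.1 ∈ w.1 :=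
      DSet.all (DSet.imp (DFun.comp_set (f := fun p : M × M => p.2) DSet.isInductiveSet
        (by fun_prop)) (by fun_prop))
    obtain ⟨I, hI⟩ := exists_sep hd z
    have hI' : ∀ t : M, t.1 ∈ I.1 ↔ ∀ w : M, IsInductiveSet w → t.1 ∈ w.1 := fun t =>
      ⟨fun h => ((hI t).1 h).2, fun h => (hI t).2 ⟨h z hz, h⟩⟩
    obtain ⟨J, hJ⟩ := exists_sep (M := M) (P := fun x => (∀ t : M, t.1 ∉ x.1) ∨
      ∃ n : M, n.1 ∈ I.1 ∧ ∀ t : M, t.1 ∈ x.1 ↔ t.1 ∈ n.1 ∨ t = n) (by fun_prop) I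
    have hJi : IsInductiveSet J := by
      refine ⟨?_, ?_⟩
      · obtain ⟨e, he, _⟩ := hz.1
        refine ⟨e, he, (hJ e).2 ⟨(hI' e).2 fun w hw => ?_, Or.inl he⟩⟩
        have := hw.natCode_mem 0
        rwa [natCode, ← eq_empty_of_M he] at this
      · intro n hn
        have hnI := ((hJ n).1 hn).1
        obtain ⟨s, hs, h⟩ := hz.2 n ((hI n).1 hnI).1
        refine ⟨s, (hJ s).2 ⟨(hI' s).2 fun w hw => ?_, Or.inr ⟨n, hnI, h⟩⟩, h⟩
        obtain ⟨s', hs', h'⟩ := hw.2 n ((hI' n).1 hnI w hw)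
        have : s = s' := ext_M fun t => by rw [h, h']
        rwa [this]
    have main : ∀ x : ZFSet.{u}, x ∈ I.1 → ∃ n : ℕ, x = natCode.{u} n := by
      intro x
      induction x using ZFSet.inductionOn with
      | _ x ih =>
        intro hxI
        have hxJ := (hI' ⟨x, mem_of_mem I.2 hxI⟩).1 hxI J hJi
        rcases ((hJ ⟨x, mem_of_mem I.2 hxI⟩).1 hxJ).2 with h | ⟨n, hn, h⟩
        · exact ⟨0, eq_empty_of_M h⟩
        · have hx' := eq_insert_of_M h
          simp only at hx'
          obtain ⟨k, hk⟩ := ih n.1 (by rw [hx']; exact ZFSet.mem_insert _ _) hn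
          exact ⟨k + 1, by rw [hx', hk]; rfl⟩
    exact main x.1 ((hI' x).2 hx)
  · rintro ⟨n, hn⟩ w hw
    rw [hn]
    exact hw.natCode_mem n

instance instCodedNat : Coded M ℕ where
  code n := ⟨natCode n, natCode_mem_M n⟩
  inj := fun m n h => natCode_injective (congrArg Subtype.val h)
  raw := by
    have hd : DSet M fun x : M => ∀ w : M, IsInductiveSet w → x.1 ∈ w.1 :=
      DSet.all (DSet.imp (DFun.comp_set (f := fun p : M × M => p.2) DSet.isInductiveSet
        (by fun_prop)) (by fun_prop))
    refine RawDef.congr hd fun v => ?_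
    simp only [isNat_iff]
    constructor
    · rintro ⟨n, hn⟩
      exact ⟨v 0, rfl, n, congrArg Subtype.val hn⟩
    · rintro ⟨x, hx, n, hn⟩
      exact ⟨n, hx.trans (Subtype.ext hn)⟩

instance instIsSmallNat : IsSmall M ℕ where
  out := by
    obtain ⟨z, hz⟩ := exists_isInductiveSet (M := M)
    obtain ⟨I, hI⟩ := exists_sep (M := M) (P := fun x => ∃ n : ℕ, x = code n) (by fun_prop) z
    refine ⟨I, fun t => ?_⟩
    rw [hI]
    refine ⟨fun h => h.2, ?_⟩
    rintro ⟨n, rfl⟩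
    exact ⟨hz.natCode_mem n, n, rfl⟩

@[fun_prop]
theorem DFun.natSucc {f : C → ℕ} (hf : DFun M f) : DFun M fun c => f c + 1 := by
  refine DFun.comp (g := fun n : ℕ => n + 1) (DFun.of_graph ?_) hf
  have : DSet M fun p : ℕ × ℕ => ∀ t : M, t.1 ∈ (Coded.code p.2 : M).1 ↔
      t.1 ∈ (Coded.code p.1 : M).1 ∨ t = Coded.code p.1 := by fun_prop
  refine this.congr fun p => ?_
  constructor
  · rintro h t
    rw [h]
    show t.1 ∈ natCode (p.1 + 1) ↔ _
    rw [natCode, ZFSet.mem_insert_iff, or_comm, Subtype.ext_iff]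
    rfl
  · intro h
    exact natCode_injective (eq_insert_of_M h)

/-- The recursion theorem in `M`. The orbit of a is the intersection `I` of all sets of `M` that
contain (0, a) and are closed under the step. If `I` had a wrong value, deleting that pair would
leave a set with the same closure properties. -/
theorem DFun.iterate [IsSmall M A] {g : A → A} (hg : DFun M g) :
    DFun M fun p : ℕ × A => g^[p.1] p.2 := by
  let I : A → ℕ → A → Prop := fun a n b => ∀ G : MSub M (ℕ × A), (0, a) ∈ G →
    (∀ m c, (m, c) ∈ G → (m + 1, g c) ∈ G) → (n, b) ∈ G
  have hI : DSet M fun p : (A × ℕ) × A => I p.1.1 p.1.2 p.2 := by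
    simp only [I]
    fun_prop
  have h0 : ∀ a, I a 0 a := fun a G h _ => h
  have hs : ∀ a n b, I a n b → I a (n + 1) (g b) := fun a n b h G hG hG' => hG' _ _ (h G hG hG')
  have key : ∀ a n b, I a n b ↔ b = g^[n] a := by
    intro a n
    induction n with
    | zero =>
      intro b
      refine ⟨fun h => ?_, fun h => h ▸ h0 a⟩
      by_contra hne
      have hd : DSet M fun q : ℕ × A => I a q.1 q.2 ∧ ¬ (q.1 = 0 ∧ q.2 = b) :=
        (DFun.comp_set (f := fun q : ℕ × A => ((a, q.1), q.2)) hI (by fun_prop)).and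
          (by fun_prop)
      have := h (MSub.mk _ hd) ⟨h0 a, fun h => hne h.2.symm⟩
        (fun m c hc => ⟨hs _ _ _ hc.1, fun h => by simp at h⟩)
      exact this.2 ⟨rfl, rfl⟩
    | succ n ih =>
      intro b
      rw [Function.iterate_succ_apply']
      refine ⟨fun h => ?_, fun h => h ▸ hs _ _ _ ((ih _).2 rfl)⟩
      by_contra hne
      have hd : DSet M fun q : ℕ × A => I a q.1 q.2 ∧ ¬ (q.1 = n + 1 ∧ q.2 = b) :=
        (DFun.comp_set (f := fun q : ℕ × A => ((a, q.1), q.2)) hI (by fun_prop)).and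
          (by fun_prop)
      have := h (MSub.mk _ hd) ⟨h0 a, fun h => by simp at h⟩
        (fun m c hc => ⟨hs _ _ _ hc.1, fun h => by
          obtain ⟨h1, h2⟩ := h
          simp only [Nat.add_right_cancel_iff] at h1
          subst h1
          exact hne (by rw [← h2, (ih c).1 hc.1])⟩)
      exact this.2 ⟨rfl, rfl⟩
  apply DFun.of_graph
  refine (DFun.comp_set (f := fun q : (ℕ × A) × A => ((q.1.2, q.1.1), q.2)) hI
    (by fun_prop)).congr fun q => ?_
  exact (key _ _ _).symm

@[fun_prop]
theorem DFun.natAdd {f g : C → ℕ} (hf : DFun M f) (hg : DFun M g) :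
    DFun M fun c => f c + g c := by
  have h := DFun.iterate (M := M) (g := fun n : ℕ => n + 1) (by fun_prop)
  have := DFun.comp h (hg.prodMk hf)
  refine RawDef.congr this fun v => ?_
  simp

@[fun_prop]
theorem DFun.natMul {f g : C → ℕ} (hf : DFun M f) (hg : DFun M g) :
    DFun M fun c => f c * g c := by
  have h := DFun.iterate (M := M) (g := fun p : ℕ × ℕ => (p.1, p.2 + p.1)) (by fun_prop)
  have e : ∀ m n : ℕ, (fun p : ℕ × ℕ => (p.1, p.2 + p.1))^[n] (m, 0) = (m, m * n) := by
    intro m n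
    induction n with
    | zero => rfl
    | succ n ih => rw [Function.iterate_succ_apply', ih]; rfl
  have := DFun.snd (DFun.comp h (hg.prodMk (hf.prodMk (DFun.const 0))))
  simpa only [e] using this

@[fun_prop]
theorem DSet.natLe {f g : C → ℕ} (hf : DFun M f) (hg : DFun M g) :
    DSet M fun c => f c ≤ g c := by
  have : DSet M fun c => ∃ k, g c = f c + k := by fun_prop
  exact this.congr fun c => le_iff_exists_add

@[fun_prop]
theorem DSet.natLt {f g : C → ℕ} (hf : DFun M f) (hg : DFun M g) :
    DSet M fun c => f c < g c := by
  have : DSet M fun c => f c + 1 ≤ g c := by fun_prop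
  exact this.congr fun c => Iff.rfl

/-- Dependent choice in `M`. -/
theorem exists_sequence [IsSmall M A] {P : A → Prop} {R : A → A → Prop} (hP : DSet M P)
    (hR : DSet M fun p : A × A => R p.1 p.2) (a₀ : A) (h₀ : P a₀)
    (h : ∀ a, P a → ∃ b, P b ∧ R a b) :
    ∃ s : ℕ → A, DFun M s ∧ s 0 = a₀ ∧ ∀ n, P (s n) ∧ R (s n) (s (n + 1)) := by
  have hPP : DSet M fun p : A × A => P p.1 → P p.2 ∧ R p.1 p.2 :=
    (DFun.comp_set hP DFun.fst_aux).imp ((DFun.comp_set hP DFun.snd_aux).and hR)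
  -- Nothing is demanded outside `P`, so that the relation becomes total and choice applies.
  obtain ⟨g, hg, hgR⟩ := exists_choice (R := fun a b => P a → P b ∧ R a b) hPP fun a => by
    by_cases ha : P a
    · obtain ⟨b, hb⟩ := h a ha
      exact ⟨b, fun _ => hb⟩
    · exact ⟨a, fun h => absurd h ha⟩
  refine ⟨fun n => g^[n] a₀, ?_, rfl, ?_⟩
  · exact DFun.comp (DFun.iterate hg) (DFun.id.prodMk (DFun.const a₀))
  · have : ∀ n, P (g^[n] a₀) := by
      intro n
      induction n with
      | zero => exact h₀
      | succ n ih => rw [Function.iterate_succ_apply']; exact (hgR _ ih).1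
    intro n
    refine ⟨this n, ?_⟩
    simp only [Function.iterate_succ_apply']
    exact (hgR _ (this n)).2

/-- Absoluteness of well-foundedness: a relation in `M` is well-founded if it has minimal elements
for all nonempty sets in `M`. -/
theorem wellFounded_of_minimal [IsSmall M A] (R : MSub M (A × A))
    (h : ∀ P : A → Prop, DSet M P → (∃ a, P a) → ∃ a, P a ∧ ∀ b, (b, a) ∈ R → ¬ P b) :
    WellFounded fun b a => (b, a) ∈ R := by
  -- Approximations to the Mostowski collapse of `R`: the domain is closed under predecessors, and
  -- each value is the set of the values at the predecessors.
  let Att : M → Prop := fun f => ∀ (a : A) (x : M), (mpair (code a) x).1 ∈ f.1 →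
    (∀ b : A, (b, a) ∈ R → ∃ y : M, (mpair (code b) y).1 ∈ f.1) ∧
      ∀ y : M, y.1 ∈ x.1 ↔ ∃ b : A, (b, a) ∈ R ∧ (mpair (code b) y).1 ∈ f.1
  let Φ : A → M → Prop := fun a x => ∃ f : M, Att f ∧ (mpair (code a) x).1 ∈ f.1
  have hΦ : DSet M fun p : A × M => Φ p.1 p.2 := by
    simp only [Φ, Att]
    fun_prop
  have hΦ' : ∀ a, DSet M fun x : M => Φ a x := fun a =>
    DFun.comp_set (f := fun x : M => (a, x)) hΦ (by fun_prop)
  have uniq : ∀ a x x', Φ a x → Φ a x' → x = x' := by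
    by_contra! hcon
    have hd : DSet M fun a : A => ∃ x x', Φ a x ∧ Φ a x' ∧ x ≠ x' := by
      simp only [Φ, Att, ne_eq]
      fun_prop
    obtain ⟨a, ⟨x, x', ⟨f, hf, hx⟩, ⟨f', hf', hx'⟩, hne⟩, hmin⟩ := h _ hd hcon
    apply hne
    have hb : ∀ b, (b, a) ∈ R → ∀ y y', Φ b y → Φ b y' → y = y' := by
      intro b hb y y' hy hy'
      by_contra hyy
      exact hmin b hb ⟨y, y', hy, hy', hyy⟩
    have half : ∀ (f f' x x' : M), Att f → Att f' → (mpair (code a) x).1 ∈ f.1 →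
        (mpair (code a) x').1 ∈ f'.1 → ∀ t : M, t.1 ∈ x.1 → t.1 ∈ x'.1 := by
      intro f f' x x' hf hf' hx hx' t ht
      obtain ⟨b, hbR, hbt⟩ := ((hf a x hx).2 t).1 ht
      obtain ⟨y, hy⟩ := (hf' a x' hx').1 b hbR
      have : t = y := hb b hbR _ _ ⟨f, hf, hbt⟩ ⟨f', hf', hy⟩
      subst this
      exact ((hf' a x' hx').2 t).2 ⟨b, hbR, hy⟩
    exact ext_M fun t => ⟨half f f' x x' hf hf' hx hx' t, half f' f x' x hf' hf hx' hx t⟩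
  have total : ∀ a, ∃ x, Φ a x := by
    by_contra! hcon
    have hd : DSet M fun a : A => ¬ ∃ x, Φ a x := (DSet.ex hΦ).not
    obtain ⟨a, ha, hmin⟩ := h (fun a => ¬ ∃ x, Φ a x) hd (by
      obtain ⟨a, ha⟩ := hcon
      exact ⟨a, fun ⟨x, hx⟩ => ha x hx⟩)
    simp only [not_not] at hmin
    -- At a minimal point without a value, the values at its predecessors form a set of `M`. This
    -- set is the missing value, and adding it to all existing values gives an approximation defined
    -- at a.
    obtain ⟨x, hx⟩ := exists_replacement (M := M) (A := A) (R := fun b y => (b, a) ∈ R ∧ Φ b y)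
      (by refine DSet.and (by fun_prop) hΦ) (fun b y y' hy hy' => uniq b y y' hy.2 hy'.2)
    have hG : DSet M fun p : A × M => ∃ y, (Φ p.1 y ∨ (p.1 = a ∧ y = x)) ∧
        p.2 = mpair (code p.1) y := by
      refine DSet.ex (DSet.and (DSet.or ?_ (by fun_prop)) (by fun_prop))
      exact DFun.comp_set (f := fun q : (A × M) × M => (q.1.1, q.2)) hΦ (by fun_prop)
    obtain ⟨f, hf⟩ := exists_replacement (M := M) (A := A)
      (R := fun b t => ∃ y, (Φ b y ∨ (b = a ∧ y = x)) ∧ t = mpair (code b) y) hG (by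
        rintro b _ _ ⟨y, hy, rfl⟩ ⟨y', hy', rfl⟩
        rcases hy with hy | ⟨rfl, rfl⟩
        · rcases hy' with hy' | ⟨rfl, rfl⟩
          · rw [uniq b y y' hy hy']
          · exact absurd ⟨y, hy⟩ ha
        · rcases hy' with hy' | ⟨_, rfl⟩
          · exact absurd ⟨y', hy'⟩ ha
          · rfl)
    have hf' : ∀ b y, (mpair (code b) y).1 ∈ f.1 ↔ Φ b y ∨ (b = a ∧ y = x) := by
      intro b y
      rw [hf]
      constructor
      · rintro ⟨b', y', h', he⟩
        rw [mpair_inj, code_inj] at he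
        obtain ⟨rfl, rfl⟩ := he
        exact h'
      · intro h'
        exact ⟨b, y, h', rfl⟩
    refine ha ⟨x, f, ?_, (hf' a x).2 (Or.inr ⟨rfl, rfl⟩)⟩
    intro b y hby
    simp only [hf']
    rcases (hf' b y).1 hby with ⟨g, hg, hgb⟩ | ⟨rfl, rfl⟩
    · obtain ⟨h1, h2⟩ := hg b y hgb
      refine ⟨fun c hc => ?_, fun z => ?_⟩
      · obtain ⟨z, hz⟩ := h1 c hc
        exact ⟨z, Or.inl ⟨g, hg, hz⟩⟩
      · rw [h2]
        constructor
        · rintro ⟨c, hc, hz⟩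
          exact ⟨c, hc, Or.inl ⟨g, hg, hz⟩⟩
        · rintro ⟨c, hc, hz⟩
          obtain ⟨z', hz'⟩ := h1 c hc
          rcases hz with hz | ⟨rfl, rfl⟩
          · rw [uniq c z z' hz ⟨g, hg, hz'⟩]
            exact ⟨c, hc, hz'⟩
          · exact absurd ⟨z', g, hg, hz'⟩ ha
    · refine ⟨fun c hc => ?_, fun z => ?_⟩
      · obtain ⟨z, hz⟩ := hmin c hc
        exact ⟨z, Or.inl hz⟩
      · rw [hx]
        constructor
        · rintro ⟨c, hc, hz⟩
          exact ⟨c, hc, Or.inl hz⟩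
        · rintro ⟨c, hc, hz | ⟨rfl, rfl⟩⟩
          · exact ⟨c, hc, hz⟩
          · exact absurd (hmin c hc) ha
  choose ρ hρ using total
  have mono : ∀ b a, (b, a) ∈ R → (ρ b).1 ∈ (ρ a).1 := by
    intro b a hba
    obtain ⟨f, hf, hfa⟩ := hρ a
    obtain ⟨h1, h2⟩ := hf a _ hfa
    obtain ⟨y, hy⟩ := h1 b hba
    rw [uniq b (ρ b) y (hρ b) ⟨f, hf, hy⟩]
    exact (h2 y).2 ⟨b, hba, hy⟩
  -- The collapse sends `R` into the membership relation of `V`, which is well-founded there.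
  exact Subrelation.wf (fun {b a} hba => mono b a hba)
    (InvImage.wf (fun a => (ρ a).1) ZFSet.mem_wf)

end Naturals

open Filter Topology

/-! ### The real numbers of `M` as Dedekind cuts -/

section Reals

/-- Codes for rational numbers. -/
abbrev QCode : Type := ℕ × ℕ × ℕ

/-- The rational number with code `q`, as a real number. -/
noncomputable def qv (q : QCode) : ℝ := ((q.1 : ℝ) - q.2.1) / (q.2.2 + 1)

/-- Addition of codes. -/
def qadd (p q : QCode) : QCode :=
  (p.1 * (q.2.2 + 1) + q.1 * (p.2.2 + 1), p.2.1 * (q.2.2 + 1) + q.2.1 * (p.2.2 + 1),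
    p.2.2 * q.2.2 + p.2.2 + q.2.2)

/-- Multiplication of codes. -/
def qmul (p q : QCode) : QCode :=
  (p.1 * q.1 + p.2.1 * q.2.1, p.1 * q.2.1 + p.2.1 * q.1, p.2.2 * q.2.2 + p.2.2 + q.2.2)

theorem qv_qadd (p q : QCode) : qv (qadd p q) = qv p + qv q := by
  have h1 : (p.2.2 : ℝ) + 1 ≠ 0 := by positivity
  have h2 : (q.2.2 : ℝ) + 1 ≠ 0 := by positivity
  have h3 : (p.2.2 : ℝ) * q.2.2 + p.2.2 + q.2.2 + 1 = (p.2.2 + 1) * (q.2.2 + 1) := by ring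
  simp only [qv, qadd]
  push_cast
  rw [h3]
  field_simp
  ring

theorem qv_qmul (p q : QCode) : qv (qmul p q) = qv p * qv q := by
  have h1 : (p.2.2 : ℝ) + 1 ≠ 0 := by positivity
  have h2 : (q.2.2 : ℝ) + 1 ≠ 0 := by positivity
  have h3 : (p.2.2 : ℝ) * q.2.2 + p.2.2 + q.2.2 + 1 = (p.2.2 + 1) * (q.2.2 + 1) := by ring
  simp only [qv, qmul]
  push_cast
  rw [h3]
  field_simp
  ring

theorem qv_neg_inv (k : ℕ) : qv (0, 1, k) = -(1 / ((k : ℝ) + 1)) := by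
  simp [qv]; ring

theorem qv_inv (k : ℕ) : qv (1, 0, k) = 1 / ((k : ℝ) + 1) := by simp [qv]

theorem qv_one : qv (1, 0, 0) = 1 := by simp [qv]

/-- Cross-multiplication with the subtracted terms moved to the other side: the order of the
rationals becomes a statement about sums and products of natural numbers, hence definable. -/
theorem qv_lt_iff (p q : QCode) : qv p < qv q ↔
    p.1 * (q.2.2 + 1) + q.2.1 * (p.2.2 + 1) < q.1 * (p.2.2 + 1) + p.2.1 * (q.2.2 + 1) := by
  have h1 : (0 : ℝ) < (p.2.2 : ℝ) + 1 := by positivity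
  have h2 : (0 : ℝ) < (q.2.2 : ℝ) + 1 := by positivity
  rw [← Nat.cast_lt (α := ℝ)]
  simp only [qv]
  rw [div_lt_div_iff₀ h1 h2]
  push_cast
  constructor <;> intro h <;> linarith

theorem exists_qv_eq (x : ℚ) : ∃ q, qv q = x := by
  refine ⟨(x.num.toNat, (-x.num).toNat, x.den - 1), ?_⟩
  have hd : 0 < x.den := x.den_pos
  have h1 : ((x.den - 1 : ℕ) : ℝ) + 1 = x.den := by
    rw [Nat.cast_sub (by omega)]; simp
  have h2 : ((x.num.toNat : ℝ) - ((-x.num).toNat : ℝ)) = x.num := by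
    have : ((x.num.toNat : ℤ) - ((-x.num).toNat : ℤ)) = x.num := Int.toNat_sub_toNat_neg x.num
    exact_mod_cast this
  simp only [qv]
  rw [h1, h2]
  exact (Rat.cast_def x).symm

theorem exists_qv_btwn {a b : ℝ} (h : a < b) : ∃ q, a < qv q ∧ qv q < b := by
  obtain ⟨x, h1, h2⟩ := exists_rat_btwn h
  obtain ⟨q, hq⟩ := exists_qv_eq x
  exact ⟨q, by rwa [hq], by rwa [hq]⟩

theorem le_of_forall_qv_lt {a b : ℝ} (h : ∀ q, qv q < a → qv q < b) : a ≤ b := by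
  by_contra! hlt
  obtain ⟨q, h1, h2⟩ := exists_qv_btwn hlt
  exact absurd (h q h2) (not_lt.2 h1.le)

variable {M : Set ZFSet.{u}} [hM : Fact (IsTransitiveModelZFC M)]
  {A : Type v} {B : Type w} {C : Type w'} [Coded M A] [Coded M B] [Coded M C]

@[fun_prop]
theorem DFun.qadd {f g : C → QCode} (hf : DFun M f) (hg : DFun M g) :
    DFun M fun c => qadd (f c) (g c) := by
  unfold ModelInterpretation.qadd; fun_prop

@[fun_prop]
theorem DFun.qmul {f g : C → QCode} (hf : DFun M f) (hg : DFun M g) :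
    DFun M fun c => qmul (f c) (g c) := by
  unfold ModelInterpretation.qmul; fun_prop

theorem DSet.qv_lt_qv {f g : C → QCode} (hf : DFun M f) (hg : DFun M g) :
    DSet M fun c => qv (f c) < qv (g c) := by
  simp only [qv_lt_iff]; fun_prop

theorem mem_realCode_iff (r : ℝ) (t : ZFSet.{u}) :
    t ∈ realCode.{u} r ↔ ∃ q : QCode, qv q < r ∧ t = (code q : M).1 := by
  rw [realCode, ZFSet.mem_range]
  constructor
  · rintro ⟨⟨q, hq⟩, rfl⟩
    exact ⟨q, hq, rfl⟩
  · rintro ⟨q, hq, rfl⟩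
    exact ⟨⟨q, hq⟩, rfl⟩

/-- The Dedekind cut of a real number of `M`. -/
def cut (r : MReal M) : MSub M QCode :=
  ⟨{q | qv q < r.val}, ⟨realCode r.val, r.2⟩, fun t => by
    rw [mem_realCode_iff (M := M)]
    exact ⟨fun ⟨q, h, h'⟩ => ⟨q, Subtype.ext h', h⟩,
      fun ⟨q, h, h'⟩ => ⟨q, h', congrArg Subtype.val h⟩⟩⟩

theorem mem_cut {r : MReal M} {q : QCode} : q ∈ cut r ↔ qv q < r.val := Iff.rfl

theorem MReal_ext {r s : MReal M} (h : r.val = s.val) : r = s := Subtype.ext h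

theorem cut_injective : Function.Injective (cut (M := M)) := by
  intro r s h
  apply MReal_ext
  apply le_antisymm
  · exact le_of_forall_qv_lt fun q hq => mem_cut.1 (h ▸ mem_cut.2 hq)
  · exact le_of_forall_qv_lt fun q hq => mem_cut.1 (h ▸ mem_cut.2 hq)

/-- A set of codes is the cut of a real number in `M`. -/
theorem exists_eq_cut_iff (S : MSub M QCode) : (∃ r, S = cut r) ↔
    (∃ q, q ∈ S) ∧ (∃ q, q ∉ S) ∧ (∀ p q, q ∈ S → ¬ qv q < qv p → p ∈ S) ∧
      ∀ p, p ∈ S → ∃ q, q ∈ S ∧ qv p < qv q := by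
  constructor
  · rintro ⟨r, rfl⟩
    simp only [mem_cut]
    obtain ⟨q, _, hq⟩ := exists_qv_btwn (sub_one_lt r.val)
    obtain ⟨q', hq', _⟩ := exists_qv_btwn (lt_add_one r.val)
    refine ⟨⟨q, hq⟩, ⟨q', not_lt.2 hq'.le⟩, fun p q h h' => (not_lt.1 h').trans_lt h,
      fun p hp => ?_⟩
    obtain ⟨q, h1, h2⟩ := exists_qv_btwn hp
    exact ⟨q, h2, h1⟩
  · rintro ⟨⟨q₀, h₀⟩, ⟨q₁, h₁⟩, h2, h3⟩
    have hb : ∀ q ∈ S, qv q ≤ qv q₁ := fun q hq => by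
      by_contra h
      exact h₁ (h2 _ _ hq (by linarith))
    have hbdd : BddAbove (qv '' S.1) := ⟨qv q₁, by rintro _ ⟨q, hq, rfl⟩; exact hb q hq⟩
    have hS : ∀ q, q ∈ S ↔ qv q < sSup (qv '' S.1) := by
      intro q
      constructor
      · intro hq
        obtain ⟨q', hq', h⟩ := h3 q hq
        exact h.trans_le (le_csSup hbdd ⟨q', hq', rfl⟩)
      · intro hq
        obtain ⟨_, ⟨q', hq', rfl⟩, h⟩ := exists_lt_of_lt_csSup
          (⟨_, q₀, h₀, rfl⟩ : (qv '' S.1).Nonempty) hq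
        exact h2 q q' hq' (not_lt.2 h.le)
    have hc : realCode (sSup (qv '' S.1)) ∈ M := by
      have : realCode (sSup (qv '' S.1)) = (code S : M).1 := by
        ext t
        rw [mem_realCode_iff (M := M)]
        simp only [← hS]
        rw [← SetLike.mem_coe, coe_code_eq_image]
        exact ⟨fun ⟨q, h, h'⟩ => ⟨q, h, h'.symm⟩, fun ⟨q, h, h'⟩ => ⟨q, h, h'.symm⟩⟩
      rw [this]
      exact (code S : M).2
    exact ⟨⟨_, hc⟩, MSub.ext hS⟩

/-- The axioms for Dedekind cuts quantify only over rationals, so the reals of `M` form a definable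
class of subsets of `QCode`. This makes them a small coded type. -/
theorem DSet.exists_eq_cut : DSet M fun S : MSub M QCode => ∃ r, S = cut r := by
  simp only [exists_eq_cut_iff]
  refine DSet.and (by fun_prop) (DSet.and (by fun_prop) (DSet.and ?_ ?_))
  · refine DSet.all (DSet.all (DSet.imp (by fun_prop) (DSet.imp (DSet.not ?_) (by fun_prop))))
    exact DSet.qv_lt_qv (by fun_prop) (by fun_prop)
  · refine DSet.all (DSet.imp (by fun_prop) (DSet.ex (DSet.and (by fun_prop) ?_)))
    exact DSet.qv_lt_qv (by fun_prop) (by fun_prop)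

noncomputable instance instCodedMReal : Coded M (MReal M) :=
  Coded.ofInjective cut cut_injective DSet.exists_eq_cut

theorem code_MReal (r : MReal M) : (code r : M).1 = realCode r.val := by
  ext t
  rw [mem_realCode_iff (M := M)]
  have : ((code r : M).1 : Set ZFSet.{u}) = (fun a => (code a : M).1) '' (cut r).1 :=
    coe_code_eq_image (cut r)
  rw [← SetLike.mem_coe, this]
  exact ⟨fun ⟨q, h, h'⟩ => ⟨q, h, h'.symm⟩, fun ⟨q, h, h'⟩ => ⟨q, h, h'.symm⟩⟩

theorem DFun.cut {f : C → MReal M} (hf : DFun M f) : DFun M fun c => cut (f c) := hf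

theorem DFun.of_cut {f : C → MReal M}
    (hf : DFun M fun c => ModelInterpretation.cut (f c)) : DFun M f := hf

theorem IsSmall.ofInjective {D : Type*} [IsSmall M A] (f : D → A) (hf : Function.Injective f)
    (h : DSet M fun a => ∃ d, a = f d) : @IsSmall M D (Coded.ofInjective f hf h) := by
  let _ := Coded.ofInjective f hf h
  obtain ⟨z, hz⟩ := exists_sep_small h
  refine ⟨z, fun t => ?_⟩
  rw [hz]
  constructor
  · rintro ⟨_, ht, d, rfl⟩
    exact ⟨d, ht⟩
  · rintro ⟨d, ht⟩
    exact ⟨f d, ht, d, rfl⟩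

instance instIsSmallMReal : IsSmall M (MReal M) :=
  IsSmall.ofInjective cut cut_injective DSet.exists_eq_cut

theorem DSet.qv_lt {f : C → QCode} {g : C → MReal M} (hf : DFun M f) (hg : DFun M g) :
    DSet M fun c => qv (f c) < (g c).val :=
  DSet.mem_sub hf hg.cut

attribute [fun_prop] DSet.qv_lt_qv DSet.qv_lt

theorem DFun.mreal {f : C → MReal M} (h : DSet M fun p : C × QCode => qv p.2 < (f p.1).val) :
    DFun M f := DFun.of_cut (DFun.msub h)

/-- A real number with a definable cut belongs to `M`. -/
theorem exists_MReal {r : ℝ} (h : DSet M fun q : QCode => qv q < r) :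
    ∃ s : MReal M, s.val = r := by
  obtain ⟨s, hs⟩ := (exists_eq_cut_iff (MSub.mk _ h)).2 (by
    simp only [MSub.mem_mk]
    obtain ⟨q, _, hq⟩ := exists_qv_btwn (sub_one_lt r)
    obtain ⟨q', hq', _⟩ := exists_qv_btwn (lt_add_one r)
    refine ⟨⟨q, hq⟩, ⟨q', not_lt.2 hq'.le⟩, fun p q h h' => (not_lt.1 h').trans_lt h,
      fun p hp => ?_⟩
    obtain ⟨q, h1, h2⟩ := exists_qv_btwn hp
    exact ⟨q, h2, h1⟩)
  have h' : ∀ q, qv q < s.val ↔ qv q < r := fun q => by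
    rw [← mem_cut, ← hs, MSub.mem_mk]
  exact ⟨s, le_antisymm (le_of_forall_qv_lt fun q hq => (h' q).1 hq)
    (le_of_forall_qv_lt fun q hq => (h' q).2 hq)⟩

@[fun_prop]
theorem DSet.mreal_lt {f g : C → MReal M} (hf : DFun M f) (hg : DFun M g) :
    DSet M fun c => (f c).val < (g c).val := by
  have : DSet M fun c => ∃ q, ¬ qv q < (f c).val ∧ qv q < (g c).val := by fun_prop
  refine this.congr fun c => ⟨fun h => ?_, fun ⟨q, h1, h2⟩ => (not_lt.1 h1).trans_lt h2⟩
  obtain ⟨q, h1, h2⟩ := exists_qv_btwn h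
  exact ⟨q, not_lt.2 h1.le, h2⟩

@[fun_prop]
theorem DSet.mreal_le_inv {f : C → MReal M} {k : C → ℕ} (hf : DFun M f) (hk : DFun M k) :
    DSet M fun c => (f c).val ≤ 1 / ((k c : ℝ) + 1) := by
  have : DSet M fun c => ¬ qv (1, 0, k c) < (f c).val := by fun_prop
  exact this.congr fun c => by rw [qv_inv, not_lt]

/-- Two reals are this close when each cut, shifted down by 1/(k + 1), falls into the other. The
shift is addition of the code `(0, 1, k)`, so no subtraction of reals of `M` is needed. -/
theorem DSet.mreal_dist_le {f g : C → MReal M} {k : C → ℕ} (hf : DFun M f) (hg : DFun M g)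
    (hk : DFun M k) : DSet M fun c => dist (f c).val (g c).val ≤ 1 / ((k c : ℝ) + 1) := by
  have : DSet M fun c => ∀ q, (qv q < (f c).val → qv (qadd q (0, 1, k c)) < (g c).val) ∧
      (qv q < (g c).val → qv (qadd q (0, 1, k c)) < (f c).val) := by fun_prop
  refine this.congr fun c => ?_
  simp only [qv_qadd, qv_neg_inv]
  set e := 1 / ((k c : ℝ) + 1)
  rw [Real.dist_eq, abs_le]
  constructor
  · intro h q
    constructor <;> intro h' <;> linarith
  · intro h
    constructor
    · by_contra! h'
      obtain ⟨q, h1, h2⟩ := exists_qv_btwn (show (f c).val + e < (g c).val by linarith)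
      have := (h q).2 h2
      linarith
    · by_contra! h'
      obtain ⟨q, h1, h2⟩ := exists_qv_btwn (show (g c).val + e < (f c).val by linarith)
      have := (h q).1 h2
      linarith

theorem exists_radd (r s : MReal M) : ∃ t : MReal M, t.val = r.val + s.val := by
  apply exists_MReal
  have : DSet M fun q : QCode => ∃ a b, qv a < r.val ∧ qv b < s.val ∧
      ¬ qv (qadd a b) < qv q := by fun_prop
  refine this.congr fun q => ?_
  simp only [qv_qadd]
  constructor
  · intro h
    obtain ⟨a, h1, h2⟩ := exists_qv_btwn (show qv q - s.val < r.val by linarith)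
    obtain ⟨b, h3, h4⟩ := exists_qv_btwn (show qv q - qv a < s.val by linarith)
    exact ⟨a, b, h2, h4, by linarith⟩
  · rintro ⟨a, b, h1, h2, h3⟩
    linarith

/-- Addition of real numbers of `M`. -/
noncomputable def radd (r s : MReal M) : MReal M := (exists_radd r s).choose

@[simp]
theorem radd_val (r s : MReal M) : (radd r s).val = r.val + s.val := (exists_radd r s).choose_spec

@[fun_prop]
theorem DFun.radd {f g : C → MReal M} (hf : DFun M f) (hg : DFun M g) :
    DFun M fun c => radd (f c) (g c) := by
  refine DFun.mreal ?_
  have : DSet M fun p : C × QCode => ∃ a b, qv a < (f p.1).val ∧ qv b < (g p.1).val ∧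
      ¬ qv (ModelInterpretation.qadd a b) < qv p.2 := by fun_prop
  refine this.congr fun p => ?_
  simp only [qv_qadd, radd_val]
  constructor
  · intro h
    obtain ⟨a, h1, h2⟩ := exists_qv_btwn (show qv p.2 - (g p.1).val < (f p.1).val by linarith)
    obtain ⟨b, h3, h4⟩ := exists_qv_btwn (show qv p.2 - qv a < (g p.1).val by linarith)
    exact ⟨a, b, h2, h4, by linarith⟩
  · rintro ⟨a, b, h1, h2, h3⟩
    linarith

/-- A rational q is below the reciprocal exactly when q * a < 1 for some rational a ≥ r, which gives
a definable cut. The reciprocal serves to normalise vectors inside `M`. -/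
theorem exists_rinv (r : MReal M) (hr : 0 < r.val) : ∃ t : MReal M, t.val = r.val⁻¹ := by
  apply exists_MReal
  have : DSet M fun q : QCode => ∃ a, ¬ qv a < r.val ∧ qv (qmul q a) < qv (1, 0, 0) := by
    fun_prop
  refine this.congr fun q => ?_
  simp only [qv_qmul, qv_one]
  have hi : 0 < r.val⁻¹ := inv_pos.2 hr
  constructor
  · intro h
    rcases le_or_gt (qv q) 0 with hq | hq
    · obtain ⟨a, h1, h2⟩ := exists_qv_btwn (lt_add_one r.val)
      exact ⟨a, by linarith, by nlinarith⟩
    · have h' : r.val < (qv q)⁻¹ := (lt_inv_comm₀ hq hr).1 h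
      obtain ⟨a, h1, h2⟩ := exists_qv_btwn h'
      refine ⟨a, by linarith, ?_⟩
      calc qv q * qv a < qv q * (qv q)⁻¹ := by gcongr
        _ = 1 := mul_inv_cancel₀ hq.ne'
  · rintro ⟨a, h1, h2⟩
    rcases le_or_gt (qv q) 0 with hq | hq
    · linarith
    · rw [lt_inv_comm₀ hq hr]
      have ha : 0 < qv a := by linarith
      have : qv a < (qv q)⁻¹ := by
        rw [lt_inv_comm₀ ha hq, ← one_div, lt_div_iff₀ ha]
        exact h2
      linarith

theorem exists_rat_val (x : ℚ) : ∃ t : MReal M, t.val = x := by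
  obtain ⟨q, hq⟩ := exists_qv_eq x
  rw [← hq]
  apply exists_MReal
  fun_prop

theorem denseRange_val : DenseRange (MReal.val (M := M)) := by
  refine Rat.denseRange_cast.mono ?_
  rintro _ ⟨x, rfl⟩
  obtain ⟨t, ht⟩ := exists_rat_val (M := M) x
  exact ⟨t, ht⟩

/-- A rational is below the limit when some larger rational is eventually below the sequence. The
criterion is uniform in the parameter, so it also applies to pointwise limits of functions. -/
theorem DSet.qv_lt_lim {F : C × ℕ → MReal M} (hF : DFun M F) {L : C → ℝ}
    (h : ∀ c, Tendsto (fun n => (F (c, n)).val) atTop (𝓝 (L c))) :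
    DSet M fun p : C × QCode => qv p.2 < L p.1 := by
  have : DSet M fun p : C × QCode => ∃ q, qv p.2 < qv q ∧ ∃ N, ∀ n, N ≤ n →
      qv q < (F (p.1, n)).val := by fun_prop
  refine this.congr fun p => ?_
  constructor
  · intro hp
    obtain ⟨q, h1, h2⟩ := exists_qv_btwn hp
    obtain ⟨N, hN⟩ := eventually_atTop.1 ((h p.1).eventually (lt_mem_nhds h2))
    exact ⟨q, h1, N, hN⟩
  · rintro ⟨q, h1, N, h2⟩
    refine h1.trans_le (ge_of_tendsto (h p.1) ?_)
    filter_upwards [eventually_ge_atTop N] with n hn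
    exact (h2 n hn).le

theorem MReal_complete {s : ℕ → MReal M} (hs : DFun M s)
    (hc : CauchySeq fun n => (s n).val) :
    ∃ r : MReal M, Tendsto (fun n => (s n).val) atTop (𝓝 r.val) := by
  obtain ⟨L, hL⟩ := cauchySeq_tendsto_of_complete hc
  have h := DSet.qv_lt_lim (M := M) (C := ℕ) (F := fun p : ℕ × ℕ => s p.2) (by fun_prop)
    (L := fun _ => L) (fun _ => hL)
  obtain ⟨r, hr⟩ := exists_MReal (M := M) (r := L)
    (DFun.comp_set (f := fun q : QCode => (0, q)) h (by fun_prop))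
  exact ⟨r, hr ▸ hL⟩

end Reals

/-! ### Metric spaces of `M` are interpreted by their completions -/

section Metric

variable {M : Set ZFSet.{u}} [hM : Fact (IsTransitiveModelZFC M)]

/-- The collection of sets in `M` which are open for the metric induced by `j`. -/
def metricOpens (M : Set ZFSet.{u}) {P : Type v} [Coded M P] {Z : Type w} [PseudoMetricSpace Z]
    (j : P → Z) : Set (Set P) :=
  {O | InModel M ((fun x => (code x : M).1) '' O) ∧
    ∀ x ∈ O, ∃ ε > 0, ∀ y, dist (j y) (j x) < ε → y ∈ O}

/-- The metric space in `M` whose metric is induced by `j`. -/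
abbrev metricMSpace (M : Set ZFSet.{u}) {P : Type v} [Coded M P] {Z : Type w} [PseudoMetricSpace Z]
    (j : P → Z) : MSpace.{u, v} where
  Pt := P
  code x := (code x : M).1
  opens := metricOpens M j

/-- The metric induced on `P` by the map `j` with dense range in a complete space belongs to `M`,
and it is complete in `M`. -/
structure IsMetricIn (M : Set ZFSet.{u}) [Fact (IsTransitiveModelZFC M)]
    {P : Type v} [Coded M P] {Z : Type w} [PseudoMetricSpace Z] (j : P → Z) : Prop where
  dense : DenseRange j
  dist_le : DSet M fun p : (P × P) × ℕ => dist (j p.1.1) (j p.1.2) ≤ 1 / ((p.2 : ℝ) + 1)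
  complete : ∀ s : ℕ → P, DFun M s → CauchySeq (fun n => j (s n)) →
    ∃ x, Tendsto (fun n => j (s n)) atTop (𝓝 (j x))

variable {P : Type v} [Coded M P] {Z : Type w} [MetricSpace Z] {j : P → Z}

theorem mem_metricOpens_iff [IsSmall M P] {O : Set P} : O ∈ metricOpens M j ↔
    (∃ S : MSub M P, O = S.1) ∧ ∀ x ∈ O, ∃ ε > 0, ∀ y, dist (j y) (j x) < ε → y ∈ O := by
  unfold metricOpens
  simp only [Set.mem_ofPred_eq, image_inModel_iff]
  refine and_congr_left fun _ => ?_
  exact ⟨fun h => ⟨⟨O, h⟩, rfl⟩, fun ⟨S, hS⟩ => hS ▸ S.2⟩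

theorem exists_inv_lt {ε : ℝ} (h : 0 < ε) : ∃ k : ℕ, 1 / ((k : ℝ) + 1) < ε :=
  exists_nat_one_div_lt h

namespace IsMetricIn

variable [IsSmall M P] (hj : IsMetricIn M j)
include hj

theorem dsetDist {C : Type*} [Coded M C] {f g : C → P} {k : C → ℕ} (hf : DFun M f)
    (hg : DFun M g) (hk : DFun M k) :
    DSet M fun c => dist (j (f c)) (j (g c)) ≤ 1 / ((k c : ℝ) + 1) :=
  DFun.comp_set (f := fun c => ((f c, g c), k c)) hj.dist_le (by fun_prop)

/-- The closed ball of radius `1 / (k + 1)`, as a predicate. -/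
theorem dset_interior {C : Type*} [Coded M C] {f g : C → P} {k : C → ℕ} (hf : DFun M f)
    (hg : DFun M g) (hk : DFun M k) :
    DSet M fun c => ∃ l : ℕ, ∀ y : P, dist (j (g c)) (j y) ≤ 1 / ((l : ℝ) + 1) →
      dist (j (f c)) (j y) ≤ 1 / ((k c : ℝ) + 1) := by
  refine DSet.ex (DSet.all (DSet.imp ?_ ?_)) <;>
    exact hj.dsetDist (by fun_prop) (by fun_prop) (by fun_prop)

/-- The interior of the closed ball with center `x` and radius `1 / (k + 1)`. -/
def iball (x : P) (k : ℕ) : MSub M P :=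
  MSub.mk (fun y => ∃ l : ℕ, ∀ z : P, dist (j y) (j z) ≤ 1 / ((l : ℝ) + 1) →
    dist (j x) (j z) ≤ 1 / ((k : ℝ) + 1))
    (hj.dset_interior (DFun.const x) DFun.id (DFun.const k))

theorem iball_subset {x y : P} {k : ℕ} (h : y ∈ hj.iball x k) :
    dist (j x) (j y) ≤ 1 / ((k : ℝ) + 1) := by
  obtain ⟨l, hl⟩ := h
  exact hl y (by rw [dist_self]; positivity)

theorem mem_iball {x y : P} {k : ℕ} (h : dist (j x) (j y) < 1 / ((k : ℝ) + 1)) :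
    y ∈ hj.iball x k := by
  obtain ⟨l, hl⟩ := exists_inv_lt (sub_pos.2 h)
  refine ⟨l, fun z hz => ?_⟩
  have := dist_triangle (j x) (j y) (j z)
  linarith

theorem self_mem_iball (x : P) (k : ℕ) : x ∈ hj.iball x k :=
  hj.mem_iball (by rw [dist_self]; positivity)

/-- Only the closed balls of radius 1/(k + 1) are assumed definable; taking interiors provides open
balls that belong to `M`. -/
theorem iball_open (x : P) (k : ℕ) : (hj.iball x k).1 ∈ metricOpens M j := by
  rw [mem_metricOpens_iff]
  refine ⟨⟨_, rfl⟩, ?_⟩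
  rintro y ⟨l, hl⟩
  refine ⟨1 / ((l : ℝ) + 1), by positivity, fun z hz => ?_⟩
  obtain ⟨m, hm⟩ := exists_inv_lt (sub_pos.2 hz)
  refine ⟨m, fun t ht => hl t ?_⟩
  have := dist_triangle (j y) (j z) (j t)
  rw [dist_comm (j y) (j z)] at this
  linarith

theorem dfun_iball {C : Type*} [Coded M C] {f : C → P} {k : C → ℕ} (hf : DFun M f)
    (hk : DFun M k) : DFun M fun c => hj.iball (f c) (k c) :=
  DFun.msub (hj.dset_interior (by fun_prop) (by fun_prop) (by fun_prop))

/-- The open set of the completion determined by an open set in `M`. -/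
def op (_ : IsMetricIn M j) (O : Set P) : Set Z :=
  {z | ∃ ε > 0, ∀ y, dist (j y) z < ε → y ∈ O}

theorem exists_dist_lt (z : Z) {ε : ℝ} (hε : 0 < ε) : ∃ x, dist (j x) z < ε := by
  obtain ⟨x, hx⟩ := hj.dense.exists_dist_lt z hε
  exact ⟨x, by rwa [dist_comm]⟩

/-- A definable predicate on families: `F` is a family of open sets in `M`. -/
theorem familyIn_iff {F : Set (Set P)} : (metricMSpace M j).FamilyIn M F ↔
    F ⊆ metricOpens M j ∧ ∃ G : MSub M (MSub M P), F = Subtype.val '' G.1 := by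
  have key : ∀ F : Set (Set P), F ⊆ metricOpens M j → ∀ z : ZFSet.{u},
      (∃ O ∈ F, (z : Set ZFSet.{u}) = (fun x => (code x : M).1) '' O) ↔
        ∃ S : MSub M P, S.1 ∈ F ∧ (code S : M).1 = z := by
    intro F hF z
    constructor
    · rintro ⟨O, hO, hz⟩
      obtain ⟨⟨S, rfl⟩, _⟩ := mem_metricOpens_iff.1 (hF hO)
      refine ⟨S, hO, ?_⟩
      rw [← coe_code_eq_image] at hz
      exact SetLike.coe_injective hz.symm
    · rintro ⟨S, hS, rfl⟩
      exact ⟨S.1, hS, coe_code_eq_image S⟩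
  have key2 : ∀ F : Set (Set P), F ⊆ metricOpens M j →
      {z : ZFSet.{u} | ∃ O ∈ F, (z : Set ZFSet.{u}) = (fun x => (code x : M).1) '' O} =
        (fun S : MSub M P => (code S : M).1) '' {S | S.1 ∈ F} := by
    intro F hF
    ext z
    exact key F hF z
  unfold MSpace.FamilyIn
  refine and_congr_right fun hF => ?_
  have hF' : F ⊆ metricOpens M j := hF
  change InModel M {z : ZFSet.{u} | ∃ O ∈ F, (z : Set ZFSet.{u}) =
    (fun x => (code x : M).1) '' O} ↔ _
  rw [key2 F hF', image_inModel_iff]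
  constructor
  · intro h
    refine ⟨⟨_, h⟩, ?_⟩
    ext O
    constructor
    · intro hO
      obtain ⟨⟨S, rfl⟩, _⟩ := mem_metricOpens_iff.1 (hF hO)
      exact ⟨S, hO, rfl⟩
    · rintro ⟨S, hS, rfl⟩
      exact hS
  · rintro ⟨G, rfl⟩
    have : {S : MSub M P | S.1 ∈ Subtype.val '' G.1} = G.1 := by
      ext S
      constructor
      · rintro ⟨T, hT, h⟩
        rwa [← Subtype.ext h]
      · intro h
        exact ⟨S, h, rfl⟩
    rw [this]
    exact G.2

/-- A family of open sets in `M` which covers a ball covers the points of the completion in this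
ball. -/
theorem exists_op_of_cover [CompleteSpace Z] (G : MSub M (MSub M P))
    (hG : ∀ S ∈ G, S.1 ∈ metricOpens M j) {z : Z} {ε : ℝ} (hε : 0 < ε)
    (hz : ∀ y, dist (j y) z < ε → ∃ S ∈ G, y ∈ S) : ∃ S ∈ G, z ∈ hj.op S.1 := by
  by_contra! hcon
  -- A ball is bad when the family covers it but no single member contains it.
  let bad : P × ℕ → Prop := fun a =>
    (¬ ∃ S, S ∈ G ∧ ∀ y : P, dist (j a.1) (j y) ≤ 1 / ((a.2 : ℝ) + 1) → y ∈ S) ∧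
      ∀ y : P, dist (j a.1) (j y) ≤ 1 / ((a.2 : ℝ) + 1) → ∃ S, S ∈ G ∧ y ∈ S
  have hbad : DSet M bad := by
    refine DSet.and (DSet.not (DSet.ex (DSet.and (by fun_prop) (DSet.all (DSet.imp ?_
      (by fun_prop)))))) (DSet.all (DSet.imp ?_ (by fun_prop))) <;>
    exact hj.dsetDist (by fun_prop) (by fun_prop) (by fun_prop)
  let nest : (P × ℕ) → (P × ℕ) → Prop := fun b a => a.2 < b.2 ∧
    ∀ y : P, dist (j b.1) (j y) ≤ 1 / ((b.2 : ℝ) + 1) → dist (j a.1) (j y) ≤ 1 / ((a.2 : ℝ) + 1)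
  have hnest : DSet M fun p : (P × ℕ) × (P × ℕ) => nest p.1 p.2 := by
    refine DSet.and (by fun_prop) (DSet.all (DSet.imp ?_ ?_)) <;>
    exact hj.dsetDist (by fun_prop) (by fun_prop) (by fun_prop)
  have hR : DSet M fun p : (P × ℕ) × (P × ℕ) => bad p.1 ∧ bad p.2 ∧ nest p.1 p.2 :=
    (DFun.comp_set hbad DFun.fst_aux).and ((DFun.comp_set hbad DFun.snd_aux).and hnest)
  -- A definable set of bad balls without minimal element would yield, by dependent choice in `M`, a
  -- nested sequence in `M` with radii tending to 0. Its centres converge to a point x of every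
  -- ball, and a member around x contains one of the balls.
  have wf := wellFounded_of_minimal (MSub.mk _ hR) (by
    intro Q hQ ⟨a₀, ha₀⟩
    by_contra! hno
    simp only [MSub.mem_mk] at hno
    obtain ⟨s, hs, _, hs'⟩ := exists_sequence (R := fun a b => bad b ∧ bad a ∧ nest b a)
      hQ (DFun.comp_set (f := fun p : (P × ℕ) × (P × ℕ) => (p.2, p.1)) hR (by fun_prop)) a₀ ha₀
      (fun a ha => by obtain ⟨b, hb, hQb⟩ := hno a ha; exact ⟨b, hQb, hb⟩)
    have hk : ∀ n, n ≤ (s n).2 := by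
      intro n
      induction n with
      | zero => exact Nat.zero_le _
      | succ n ih => exact Nat.succ_le_of_lt (ih.trans_lt (hs' n).2.2.2.1)
    have hsub : ∀ n m, n ≤ m → ∀ y : P, dist (j (s m).1) (j y) ≤ 1 / (((s m).2 : ℝ) + 1) →
        dist (j (s n).1) (j y) ≤ 1 / (((s n).2 : ℝ) + 1) := by
      intro n m hnm
      induction m, hnm using Nat.le_induction with
      | base => exact fun y h => h
      | succ m _ ih => exact fun y h => ih y ((hs' m).2.2.2.2 y h)
    have hd : ∀ n m, n ≤ m → dist (j (s n).1) (j (s m).1) ≤ 1 / (((s n).2 : ℝ) + 1) :=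
      fun n m hnm => hsub n m hnm _ (by rw [dist_self]; positivity)
    have hd' : ∀ n, 1 / (((s n).2 : ℝ) + 1) ≤ 1 / ((n : ℝ) + 1) := fun n =>
      Nat.one_div_le_one_div (hk n)
    have hcau : CauchySeq fun n => j (s n).1 := by
      refine cauchySeq_of_le_tendsto_0 (fun n : ℕ => 2 * (1 / ((n : ℝ) + 1))) ?_ ?_
      · intro n m N hn hm
        have h1 := (hd N n hn).trans (hd' N)
        have h2 := (hd N m hm).trans (hd' N)
        have := dist_triangle_left (j (s n).1) (j (s m).1) (j (s N).1)
        linarith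
      · simpa using tendsto_one_div_add_atTop_nhds_zero_nat.const_mul (2 : ℝ)
    obtain ⟨x, hx⟩ := hj.complete (fun n => (s n).1) (by fun_prop) hcau
    have hdx : ∀ n, dist (j (s n).1) (j x) ≤ 1 / (((s n).2 : ℝ) + 1) := by
      intro n
      refine le_of_tendsto (tendsto_const_nhds.dist hx) ?_
      filter_upwards [eventually_ge_atTop n] with m hm
      exact hd n m hm
    obtain ⟨S, hS, hxS⟩ := (hs' 0).2.2.1.2 x (hdx 0)
    obtain ⟨δ, hδ, hδS⟩ := (mem_metricOpens_iff.1 (hG S hS)).2 x hxS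
    obtain ⟨n, hn⟩ := exists_inv_lt (half_pos hδ)
    refine (hs' n).2.2.1.1 ⟨S, hS, fun y hy => hδS y ?_⟩
    have h1 := hdx n
    have h2 := hd' n
    have := dist_triangle_left (j y) (j x) (j (s n).1)
    linarith)
  have hbadz : ∀ a : P × ℕ, dist (j a.1) z < 1 / ((a.2 : ℝ) + 1) →
      2 * (1 / ((a.2 : ℝ) + 1)) < ε → bad a := by
    intro a ha hε'
    refine ⟨?_, fun y hy => hz y ?_⟩
    · rintro ⟨S, hS, h⟩
      refine hcon S hS ⟨1 / ((a.2 : ℝ) + 1) - dist (j a.1) z, sub_pos.2 ha, fun y hy => h y ?_⟩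
      have := dist_triangle_right (j a.1) (j y) z
      linarith
    · have := dist_triangle_left (j y) z (j a.1)
      linarith
  -- Well-founded induction in `V`: the balls around z excluded here are bad by `hbadz`, and each
  -- would contain a smaller one of the same kind.
  have hno : ∀ a : P × ℕ, ¬ (dist (j a.1) z < 1 / ((a.2 : ℝ) + 1) ∧
      2 * (1 / ((a.2 : ℝ) + 1)) < ε) := by
    intro a
    induction a using wf.induction with
    | _ a ih =>
      rintro ⟨h1, h2⟩
      -- Half of the gap between z and the boundary: a ball of this radius that contains z has
      -- diameter less than the gap. The index a.2 + 1 in the next line forces the strict increase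
      -- and keeps the new radius below the old one.
      obtain ⟨k, hk⟩ := exists_inv_lt (half_pos (sub_pos.2 h1))
      let k' := max k (a.2 + 1)
      have hk1 : 1 / ((k' : ℝ) + 1) ≤ 1 / ((k : ℝ) + 1) :=
        Nat.one_div_le_one_div (le_max_left _ _)
      have hk2 : 1 / ((k' : ℝ) + 1) ≤ 1 / ((a.2 : ℝ) + 1) :=
        Nat.one_div_le_one_div ((Nat.le_succ _).trans (le_max_right _ _))
      obtain ⟨x, hx⟩ := hj.exists_dist_lt z (show (0 : ℝ) < 1 / ((k' : ℝ) + 1) by positivity)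
      have hb2 : 2 * (1 / ((k' : ℝ) + 1)) < ε := by linarith
      refine ih (x, k') ⟨hbadz (x, k') hx hb2, hbadz a h1 h2, ?_, fun y hy => ?_⟩ ⟨hx, hb2⟩
      · exact (Nat.lt_succ_self _).trans_le (le_max_right _ _)
      · simp only at hy ⊢
        have t1 := dist_triangle (j a.1) z (j y)
        have t2 := dist_triangle_left z (j y) (j x)
        linarith
  obtain ⟨k, hk⟩ := exists_inv_lt (half_pos hε)
  obtain ⟨x, hx⟩ := hj.exists_dist_lt z (show (0 : ℝ) < 1 / ((k : ℝ) + 1) by positivity)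
  exact hno (x, k) ⟨hx, by simp only; linarith⟩

/-- Most of the conditions are formal; unions of families in `M` use `exists_op_of_cover`, and the
interiors of small balls give the basis. -/
theorem isPreinterpretation [CompleteSpace Z] :
    IsPreinterpretation M (metricMSpace M j) inferInstance j hj.op where
  t0 := inferInstance
  isOpen O _ := by
    rw [Metric.isOpen_iff]
    rintro z ⟨ε, hε, h⟩
    refine ⟨ε / 2, half_pos hε, fun z' hz' => ⟨ε / 2, half_pos hε, fun y hy => h y ?_⟩⟩
    rw [Metric.mem_ball] at hz'
    have := dist_triangle (j y) z' z
    linarith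
  mem_iff x O hO := by
    refine ⟨fun h => (mem_metricOpens_iff.1 hO).2 x h, ?_⟩
    rintro ⟨ε, hε, h⟩
    exact h x (by rw [dist_self]; exact hε)
  inter O _ Q _ := by
    ext z
    constructor
    · rintro ⟨ε, hε, h⟩
      exact ⟨⟨ε, hε, fun y hy => (h y hy).1⟩, ⟨ε, hε, fun y hy => (h y hy).2⟩⟩
    · rintro ⟨⟨ε, hε, h⟩, ⟨ε', hε', h'⟩⟩
      exact ⟨min ε ε', lt_min hε hε', fun y hy =>
        ⟨h y (hy.trans_le (min_le_left _ _)), h' y (hy.trans_le (min_le_right _ _))⟩⟩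
  sUnion F hF := by
    obtain ⟨hF, G, rfl⟩ := hj.familyIn_iff.1 hF
    ext z
    simp only [Set.mem_iUnion]
    constructor
    · rintro ⟨ε, hε, h⟩
      obtain ⟨S, hS, hz⟩ := hj.exists_op_of_cover G (fun S hS => hF ⟨S, hS, rfl⟩) hε
        (fun y hy => by
          obtain ⟨_, ⟨S, hS, rfl⟩, hyS⟩ := h y hy
          exact ⟨S, hS, hyS⟩)
      exact ⟨S.1, ⟨S, hS, rfl⟩, hz⟩
    · rintro ⟨O, hO, ε, hε, h⟩
      exact ⟨ε, hε, fun y hy => ⟨O, hO, h y hy⟩⟩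
  empty := by
    ext z
    simp only [Set.mem_empty_iff_false, iff_false]
    rintro ⟨ε, hε, h⟩
    obtain ⟨x, hx⟩ := hj.exists_dist_lt z hε
    exact h x hx
  univ := by
    ext z
    simp only [Set.mem_univ, iff_true]
    exact ⟨1, one_pos, fun y _ => trivial⟩
  basis := by
    refine TopologicalSpace.isTopologicalBasis_of_isOpen_of_nhds ?_ ?_
    · rintro _ ⟨O, _, rfl⟩
      rw [Metric.isOpen_iff]
      rintro z ⟨ε, hε, h⟩
      refine ⟨ε / 2, half_pos hε, fun z' hz' => ⟨ε / 2, half_pos hε, fun y hy => h y ?_⟩⟩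
      rw [Metric.mem_ball] at hz'
      have := dist_triangle (j y) z' z
      linarith
    · intro z U hz hU
      obtain ⟨ε, hε, h⟩ := Metric.isOpen_iff.1 hU z hz
      obtain ⟨k, hk⟩ := exists_inv_lt (show 0 < ε / 4 by linarith)
      obtain ⟨x, hx⟩ := hj.exists_dist_lt z (show (0 : ℝ) < 1 / ((k : ℝ) + 1) / 2 by positivity)
      refine ⟨_, ⟨_, hj.iball_open x k, rfl⟩, ?_, ?_⟩
      · refine ⟨1 / ((k : ℝ) + 1) / 2, by positivity, fun y hy => hj.mem_iball ?_⟩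
        have := dist_triangle_right (j x) (j y) z
        linarith
      · rintro z' ⟨δ, hδ, h'⟩
        obtain ⟨y, hy⟩ := hj.exists_dist_lt z' (lt_min hδ (show 0 < ε / 4 by linarith))
        have h1 := hj.iball_subset (h' y (hy.trans_le (min_le_left _ _)))
        have h2 := hy.trans_le (min_le_right _ _)
        apply h
        rw [Metric.mem_ball]
        have t1 := dist_triangle_left z' z (j y)
        have t2 := dist_triangle_left (j y) z (j x)
        linarith

/-- In a preinterpretation, sets with a common point in their images meet already in `P`, since the
empty set is sent to the empty set. Hence the balls whose images contain y have centres that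
converge as the index grows, and the limit is the value of the reduction at y. -/
theorem isInterpretation [CompleteSpace Z] :
    IsInterpretation M (metricMSpace M j) inferInstance j hj.op := by
  refine ⟨hj.isPreinterpretation, fun Y top' (pt' : P → Y) (op' : Set P → Set Y) h' => ?_⟩
  have hinter : ∀ O ∈ metricOpens M j, ∀ Q ∈ metricOpens M j, op' (O ∩ Q) = op' O ∩ op' Q :=
    h'.inter
  have hempty : op' ∅ = ∅ := h'.empty
  have huniv : op' Set.univ = Set.univ := h'.univ
  have hunion : ∀ G : MSub M (MSub M P), (∀ S ∈ G, S.1 ∈ metricOpens M j) →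
      op' {x | ∃ S ∈ G, x ∈ S} = {y | ∃ S ∈ G, y ∈ op' S.1} := by
    intro G hG
    have h1 : (metricMSpace M j).FamilyIn M (Subtype.val '' G.1) := hj.familyIn_iff.2
      ⟨by rintro _ ⟨S, hS, rfl⟩; exact hG S hS, G, rfl⟩
    have h2 : op' (⋃₀ (Subtype.val '' G.1)) = ⋃ O ∈ Subtype.val '' G.1, op' O := h'.sUnion _ h1
    have h3 : (⋃₀ (Subtype.val '' G.1) : Set P) = {x | ∃ S ∈ G, x ∈ S} := by
      ext x
      exact ⟨fun ⟨_, ⟨S, hS, h⟩, hx⟩ => ⟨S, hS, by rw [← h] at hx; exact hx⟩,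
        fun ⟨S, hS, hx⟩ => ⟨S.1, ⟨S, hS, rfl⟩, hx⟩⟩
    rw [← h3, h2]
    ext y
    simp only [Set.mem_iUnion, Set.mem_ofPred_eq]
    exact ⟨fun ⟨_, ⟨S, hS, h⟩, hx⟩ => ⟨S, hS, by rw [← h] at hx; exact hx⟩,
        fun ⟨S, hS, hx⟩ => ⟨S.1, ⟨S, hS, rfl⟩, hx⟩⟩
  have mono : ∀ O ∈ metricOpens M j, ∀ Q ∈ metricOpens M j, O ⊆ Q → op' O ⊆ op' Q := by
    intro O hO Q hQ hOQ
    have := hinter O hO Q hQ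
    rw [Set.inter_eq_left.2 hOQ] at this
    rw [this]
    exact Set.inter_subset_right
  -- The balls of index k form a family in `M` whose union is the whole space, so their images cover
  -- `Y`.
  have cover : ∀ y k, ∃ x, y ∈ op' (hj.iball x k).1 := by
    intro y k
    have hd : DSet M fun S : MSub M P => ∃ x, S = hj.iball x k :=
      DSet.ex (DSet.eq (by fun_prop) (hj.dfun_iball (by fun_prop) (by fun_prop)))
    have hU : {x | ∃ S ∈ MSub.mk _ hd, x ∈ S} = Set.univ := Set.eq_univ_of_forall fun x =>
      ⟨hj.iball x k, ⟨x, rfl⟩, hj.self_mem_iball x k⟩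
    have h1 := hunion (MSub.mk _ hd) (by rintro _ ⟨x, rfl⟩; exact hj.iball_open x k)
    rw [hU, huniv] at h1
    obtain ⟨_, ⟨x, rfl⟩, hy⟩ : y ∈ {y | ∃ S ∈ MSub.mk _ hd, y ∈ op' S.1} := h1 ▸ Set.mem_univ y
    exact ⟨x, hy⟩
  have meet : ∀ y, ∀ O ∈ metricOpens M j, ∀ Q ∈ metricOpens M j, y ∈ op' O → y ∈ op' Q →
      ∃ x, x ∈ O ∧ x ∈ Q := by
    intro y O hO Q hQ hyO hyQ
    by_contra! hne
    have : (O ∩ Q : Set P) = ∅ := by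
      ext x
      simp only [Set.mem_inter_iff, Set.mem_empty_iff_false, iff_false, not_and]
      exact hne x
    have h1 := hinter O hO Q hQ
    rw [this, hempty] at h1
    have h3 : y ∈ op' O ∩ op' Q := ⟨hyO, hyQ⟩
    rw [← h1] at h3
    exact h3
  choose c hc using cover
  have hcd : ∀ y k l, dist (j (c y k)) (j (c y l)) ≤ 1 / ((k : ℝ) + 1) + 1 / ((l : ℝ) + 1) := by
    intro y k l
    obtain ⟨x, h1, h2⟩ := meet y _ (hj.iball_open _ _) _ (hj.iball_open _ _) (hc y k) (hc y l)
    have h1 := hj.iball_subset h1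
    have h2 := hj.iball_subset h2
    have := dist_triangle_right (j (c y k)) (j (c y l)) (j x)
    linarith
  have hcau : ∀ y, CauchySeq fun k => j (c y k) := by
    intro y
    refine cauchySeq_of_le_tendsto_0 (fun n : ℕ => 2 * (1 / ((n : ℝ) + 1))) ?_ ?_
    · intro n m N hn hm
      have h1 := hcd y n m
      have h2 : 1 / ((n : ℝ) + 1) ≤ 1 / ((N : ℝ) + 1) := Nat.one_div_le_one_div hn
      have h3 : 1 / ((m : ℝ) + 1) ≤ 1 / ((N : ℝ) + 1) := Nat.one_div_le_one_div hm
      linarith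
    · simpa using tendsto_one_div_add_atTop_nhds_zero_nat.const_mul (2 : ℝ)
  choose h hh using fun y => cauchySeq_tendsto_of_complete (hcau y)
  have hhd : ∀ y k, dist (j (c y k)) (h y) ≤ 1 / ((k : ℝ) + 1) := by
    intro y k
    have h1 : Tendsto (fun l => dist (j (c y k)) (j (c y l))) atTop (𝓝 (dist (j (c y k)) (h y))) :=
      tendsto_const_nhds.dist (hh y)
    have h2 : Tendsto (fun l : ℕ => 1 / ((k : ℝ) + 1) + 1 / ((l : ℝ) + 1)) atTop
        (𝓝 (1 / ((k : ℝ) + 1) + 0)) :=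
      tendsto_const_nhds.add tendsto_one_div_add_atTop_nhds_zero_nat
    rw [add_zero] at h2
    exact le_of_tendsto_of_tendsto' h1 h2 fun l => hcd y k l
  refine ⟨h, ?_, fun O hO => ?_⟩
  · funext x
    symm
    refine tendsto_nhds_unique (hh (pt' x)) ?_
    rw [tendsto_iff_dist_tendsto_zero]
    refine squeeze_zero (fun _ => dist_nonneg) (fun k => ?_)
      tendsto_one_div_add_atTop_nhds_zero_nat
    have : x ∈ (hj.iball (c (pt' x) k) k).1 :=
      (h'.mem_iff x _ (hj.iball_open _ _)).2 (hc (pt' x) k)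
    exact hj.iball_subset this
  -- If the limit lies in the interpreted O, then a small ball selected by y is contained in O, and
  -- `op'` is monotone. Conversely, O is the union of the family of balls that keep a uniform
  -- distance 1/(l + 1) from leaving O; y lies in the image of one of them, and this margin survives
  -- the passage to the limit.
  · have hO' : O ∈ metricOpens M j := hO
    ext y
    constructor
    · rintro ⟨ε, hε, hy⟩
      obtain ⟨k, hk⟩ := exists_inv_lt (half_pos hε)
      refine mono _ (hj.iball_open (c y k) k) O hO' ?_ (hc y k)
      intro x hx
      have h1 := hj.iball_subset hx
      have h2 := hhd y k
      refine hy x ?_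
      have := dist_triangle_left (j x) (h y) (j (c y k))
      linarith
    · intro hy
      obtain ⟨⟨T, rfl⟩, hT⟩ := mem_metricOpens_iff.1 hO'
      have hd : DSet M fun S : MSub M P => ∃ x k, S = hj.iball x k ∧ ∃ l : ℕ, ∀ y y' : P,
          dist (j x) (j y) ≤ 1 / ((k : ℝ) + 1) → dist (j y) (j y') ≤ 1 / ((l : ℝ) + 1) →
            y' ∈ T := by
        refine DSet.ex (DSet.ex (DSet.and (DSet.eq (by fun_prop) ?_) (DSet.ex (DSet.all (DSet.all
          (DSet.imp ?_ (DSet.imp ?_ (by fun_prop))))))))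
        · exact hj.dfun_iball (by fun_prop) (by fun_prop)
        · exact hj.dsetDist (by fun_prop) (by fun_prop) (by fun_prop)
        · exact hj.dsetDist (by fun_prop) (by fun_prop) (by fun_prop)
      have hU : {x | ∃ S ∈ MSub.mk _ hd, x ∈ S} = T.1 := by
        ext x
        constructor
        · rintro ⟨_, ⟨x', k, rfl, l, hl⟩, hx⟩
          exact hl x x (hj.iball_subset hx) (by rw [dist_self]; positivity)
        · intro hx
          obtain ⟨ε, hε, hxε⟩ := hT x hx
          obtain ⟨k, hk⟩ := exists_inv_lt (half_pos hε)
          refine ⟨hj.iball x k, ⟨x, k, rfl, k, fun y y' h1 h2 => hxε y' ?_⟩,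
            hj.self_mem_iball x k⟩
          have := dist_triangle (j x) (j y) (j y')
          rw [dist_comm]
          linarith
      have h1 := hunion (MSub.mk _ hd) (by rintro _ ⟨x, k, rfl, _⟩; exact hj.iball_open x k)
      rw [hU] at h1
      rw [h1] at hy
      obtain ⟨_, ⟨x, k, rfl, l, hl⟩, hy⟩ := hy
      have hl0 : (0 : ℝ) < 1 / ((l : ℝ) + 1) := by positivity
      refine ⟨1 / ((l : ℝ) + 1) / 2, by positivity, fun y' hy' => ?_⟩
      -- The common point t is within 2/(n + 1) of the limit, less than half of the margin; the
      -- other half bounds the distance from the limit to y'.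
      obtain ⟨n, hn⟩ := exists_inv_lt (show (0 : ℝ) < 1 / ((l : ℝ) + 1) / 4 by positivity)
      obtain ⟨t, ht1, ht2⟩ := meet y _ (hj.iball_open x k) _ (hj.iball_open _ _) hy (hc y n)
      refine hl t y' (hj.iball_subset ht1) ?_
      have h2 := hj.iball_subset ht2
      have h3 := hhd y n
      have t1 := dist_triangle_right (j t) (j y') (h y)
      have t2 := dist_triangle_left (j t) (h y) (j (c y n))
      linarith

theorem interprets [CompleteSpace Z] : Interprets M (metricMSpace M j) inferInstance j :=
  ⟨hj.op, hj.isInterpretation⟩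

end IsMetricIn

end Metric

/-! ### Products, uniqueness of interpretations, and graphs in `M` -/

section Product

variable {M : Set ZFSet.{u}} [hM : Fact (IsTransitiveModelZFC M)]

theorem interprets_congr {P : Type v} {c c' : P → ZFSet.{u}} {o o' : Set (Set P)} {Z : Type w}
    {top : TopologicalSpace Z} {j : P → Z} (hc : c' = c) (ho : o' = o)
    (h : Interprets M ⟨P, c, o⟩ top j) : Interprets M ⟨P, c', o'⟩ top j := by
  subst hc ho
  exact h

variable {P : Type v} [Coded M P] [IsSmall M P] {Z : Type w} [MetricSpace Z] {j : P → Z}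
  {P' : Type v'} [Coded M P'] [IsSmall M P'] {Z' : Type w'} [MetricSpace Z'] {j' : P' → Z'}

theorem IsMetricIn.prod (hj : IsMetricIn M j) (hj' : IsMetricIn M j') :
    IsMetricIn M (Prod.map j j') where
  dense := hj.dense.prodMap hj'.dense
  dist_le := by
    have : DSet M fun p : ((P × P') × (P × P')) × ℕ =>
        dist (j p.1.1.1) (j p.1.2.1) ≤ 1 / ((p.2 : ℝ) + 1) ∧
        dist (j' p.1.1.2) (j' p.1.2.2) ≤ 1 / ((p.2 : ℝ) + 1) :=
      (hj.dsetDist (by fun_prop) (by fun_prop) (by fun_prop)).and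
        (hj'.dsetDist (by fun_prop) (by fun_prop) (by fun_prop))
    exact this.congr fun p => by rw [Prod.dist_eq, max_le_iff]; rfl
  complete s hs hc := by
    obtain ⟨x, hx⟩ := hj.complete (fun n => (s n).1) (by fun_prop)
      (uniformContinuous_fst.comp_cauchySeq hc)
    obtain ⟨y, hy⟩ := hj'.complete (fun n => (s n).2) (by fun_prop)
      (uniformContinuous_snd.comp_cauchySeq hc)
    exact ⟨(x, y), hx.prodMk_nhds hy⟩

theorem prod_opens_eq (hj : IsMetricIn M j) (hj' : IsMetricIn M j') :
    ((metricMSpace M j).prod M (metricMSpace M j')).opens = metricOpens M (Prod.map j j') := by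
  ext O
  refine and_congr_right fun _ => ?_
  constructor
  · rintro h p hp
    obtain ⟨U, hU, W, hW, h1, h2, h3⟩ := h p hp
    obtain ⟨ε, hε, h4⟩ := hU.2 _ h1
    obtain ⟨ε', hε', h5⟩ := hW.2 _ h2
    refine ⟨min ε ε', lt_min hε hε', fun q hq => h3 ⟨h4 _ ?_, h5 _ ?_⟩⟩
    · exact (le_max_left _ _).trans_lt (hq.trans_le (min_le_left _ _))
    · exact (le_max_right _ _).trans_lt (hq.trans_le (min_le_right _ _))
  · rintro h p hp
    obtain ⟨ε, hε, h1⟩ := h p hp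
    obtain ⟨k, hk⟩ := exists_inv_lt hε
    refine ⟨_, hj.iball_open p.1 k, _, hj'.iball_open p.2 k, hj.self_mem_iball _ _,
      hj'.self_mem_iball _ _, ?_⟩
    rintro q ⟨hq1, hq2⟩
    refine h1 q ?_
    have h1 := hj.iball_subset hq1
    have h2 := hj'.iball_subset hq2
    rw [dist_comm, Prod.dist_eq]
    exact (max_le h1 h2).trans_lt hk

theorem interprets_prod [CompleteSpace Z] [CompleteSpace Z'] (hj : IsMetricIn M j)
    (hj' : IsMetricIn M j') {c : P → ZFSet.{u}} {o : Set (Set P)} {c' : P' → ZFSet.{u}}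
    {o' : Set (Set P')} (hc : c = fun x => (code x : M).1) (ho : o = metricOpens M j)
    (hc' : c' = fun x => (code x : M).1) (ho' : o' = metricOpens M j') :
    Interprets M ((⟨P, c, o⟩ : MSpace.{u, v}).prod M ⟨P', c', o'⟩) inferInstance
      (Prod.map j j') := by
  subst hc ho hc' ho'
  exact interprets_congr rfl (prod_opens_eq hj hj') (hj.prod hj').interprets

/-- Interpretations are unique up to homeomorphism. -/
theorem exists_homeomorph_of_interprets {S : MSpace.{u, v}} {Y Y' : Type u}
    {top : TopologicalSpace Y} {top' : TopologicalSpace Y'} {pt : S.Pt → Y} {pt' : S.Pt → Y'}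
    (h : Interprets M S top pt) (h' : Interprets M S top' pt') :
    ∃ e : Y ≃ₜ Y', ∀ x, e (pt x) = pt' x := by
  obtain ⟨op, hp, hr⟩ := h
  obtain ⟨op', hp', hr'⟩ := h'
  obtain ⟨f, hf, hfo⟩ := hr' Y top pt op hp
  obtain ⟨g, hg, hgo⟩ := hr Y' top' pt' op' hp'
  have t0 := hp.t0
  have t0' := hp'.t0
  have cf : Continuous f := by
    rw [hp'.basis.continuous_iff]
    rintro _ ⟨O, hO, rfl⟩
    rw [hfo O hO]
    exact hp.isOpen O hO
  have cg : Continuous g := by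
    rw [hp.basis.continuous_iff]
    rintro _ ⟨O, hO, rfl⟩
    rw [hgo O hO]
    exact hp'.isOpen O hO
  -- Reductions preserve membership in basic open sets, and in a T₀ space these determine the point.
  have gf : ∀ y, g (f y) = y := by
    intro y
    apply (hp.basis.inseparable_iff.2 _).eq
    rintro _ ⟨O, hO, rfl⟩
    change f y ∈ g ⁻¹' op O ↔ _
    rw [hgo O hO]
    change y ∈ f ⁻¹' op' O ↔ _
    rw [hfo O hO]
  have fg : ∀ y, f (g y) = y := by
    intro y
    apply (hp'.basis.inseparable_iff.2 _).eq
    rintro _ ⟨O, hO, rfl⟩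
    change g y ∈ f ⁻¹' op' O ↔ _
    rw [hfo O hO]
    change y ∈ g ⁻¹' op O ↔ _
    rw [hgo O hO]
  exact ⟨⟨⟨f, g, gf, fg⟩, cf, cg⟩, fun x => (congrFun hf x).symm⟩

/-- Turns the hypotheses on the operations of a `BanachIn`, which speak of graphs in `M`, into
definability; the converse below is needed to invoke completeness in `M`. -/
theorem dfun_of_inModel_graph {f : P → P'}
    (h : InModel M {z | ∃ a, z = (mpair (code a) (code (f a)) : M).1}) : DFun M f := by
  obtain ⟨z, hz⟩ := inModel_iff.1 h
  apply DFun.of_graph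
  have : DSet M fun p : P × P' => (mpair (code p.1) (code p.2) : M).1 ∈ z.1 := by fun_prop
  refine this.congr fun p => ?_
  rw [hz]
  constructor
  · intro hp
    exact ⟨p.1, by rw [hp]⟩
  · rintro ⟨a, ha⟩
    have := mpair_inj.1 (Subtype.ext ha)
    rw [code_inj, code_inj] at this
    rw [this.2, this.1]

theorem inModel_graph_of_dfun {f : P → P'} (hf : DFun M f) :
    InModel M {z | ∃ a, z = (mpair (code a) (code (f a)) : M).1} := by
  have := image_inModel_iff.2 (MSub.mk _ hf.graph).2
  convert this using 1
  ext z
  constructor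
  · rintro ⟨a, rfl⟩
    exact ⟨(a, f a), rfl, rfl⟩
  · rintro ⟨⟨a, b⟩, hb, rfl⟩
    have hb' : b = f a := hb
    exact ⟨a, by rw [← hb']; rfl⟩

end Product

/-! ### The interpretation of the real line -/

section RealLine

variable {M : Set ZFSet.{u}} [hM : Fact (IsTransitiveModelZFC M)]

theorem isMetricIn_val : IsMetricIn M (MReal.val (M := M)) where
  dense := denseRange_val
  dist_le := DSet.mreal_dist_le (by fun_prop) (by fun_prop) (by fun_prop)
  complete _ hs hc := MReal_complete hs hc

theorem realSpace_code : (fun r : MReal M => realCode.{u} r.val) =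
    fun r : MReal M => (code r : M).1 := funext fun r => (code_MReal r).symm

theorem realSpace_opens : (realSpace M).opens = metricOpens M (MReal.val (M := M)) := by
  unfold metricOpens
  rw [← realSpace_code]
  rfl

theorem interprets_realSpace : Interprets M (realSpace M) inferInstance MReal.val :=
  interprets_congr realSpace_code realSpace_opens isMetricIn_val.interprets

end RealLine

/-! ### Definability of the vector space operations and of the norm -/

section Banach

variable {M : Set ZFSet.{u}} [hM : Fact (IsTransitiveModelZFC M)] (X : BanachIn M)

instance instCodedCarrier : Coded M X.carrier where
  code x := ⟨x.1, mem_of_mem X.carrier_mem x.2⟩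
  inj := fun x y h => Subtype.ext (congrArg (Subtype.val : M → ZFSet.{u}) h)
  raw := by
    have : DSet M fun x : M => x.1 ∈ (⟨X.carrier, X.carrier_mem⟩ : M).1 := by fun_prop
    refine RawDef.congr this fun v => ?_
    constructor
    · rintro ⟨x, hx⟩
      exact ⟨v 0, rfl, by rw [hx]; exact x.2⟩
    · rintro ⟨x, hx, h⟩
      exact ⟨⟨x.1, h⟩, hx⟩

instance instIsSmallCarrier : IsSmall M X.carrier where
  out := ⟨⟨X.carrier, X.carrier_mem⟩, fun t =>
    ⟨fun h => ⟨⟨t.1, h⟩, rfl⟩, fun ⟨a, ha⟩ => by rw [ha]; exact a.2⟩⟩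

variable {X} {C : Type*} [Coded M C]

@[fun_prop]
theorem DFun.vadd {f g : C → X.carrier} (hf : DFun M f) (hg : DFun M g) :
    DFun M fun c => f c + g c := by
  refine DFun.comp (g := fun p : X.carrier × X.carrier => p.1 + p.2) (dfun_of_inModel_graph ?_)
    (hf.prodMk hg)
  convert X.add_mem using 1
  ext z
  exact ⟨fun ⟨p, hp⟩ => ⟨p.1, p.2, hp⟩, fun ⟨x, y, h⟩ => ⟨(x, y), h⟩⟩

@[fun_prop]
theorem DFun.vneg {f : C → X.carrier} (hf : DFun M f) : DFun M fun c => - f c := by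
  apply DFun.of_graph
  have : DSet M fun p : C × X.carrier => p.2 + f p.1 = 0 := by fun_prop
  exact this.congr fun p => eq_neg_iff_add_eq_zero

@[fun_prop]
theorem DFun.vsub {f g : C → X.carrier} (hf : DFun M f) (hg : DFun M g) :
    DFun M fun c => f c - g c := by
  simp only [sub_eq_add_neg]
  fun_prop

@[fun_prop]
theorem DFun.vsmul {f : C → MReal M} {g : C → X.carrier} (hf : DFun M f) (hg : DFun M g) :
    DFun M fun c => X.smul (f c) (g c) := by
  refine DFun.comp (g := fun p : MReal M × X.carrier => X.smul p.1 p.2) (dfun_of_inModel_graph ?_)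
    (hf.prodMk hg)
  convert X.smul_mem using 1
  ext z
  constructor
  · rintro ⟨⟨r, x⟩, rfl⟩
    refine ⟨r, x, ?_⟩
    rw [← code_MReal]
    rfl
  · rintro ⟨r, x, rfl⟩
    refine ⟨(r, x), ?_⟩
    rw [← code_MReal]
    rfl

@[fun_prop]
theorem DFun.vnorm {f : C → X.carrier} (hf : DFun M f) : DFun M fun c => X.norm (f c) := by
  refine DFun.comp (g := X.norm) (dfun_of_inModel_graph ?_) hf
  convert X.norm_mem using 1
  ext z
  constructor
  · rintro ⟨x, rfl⟩
    refine ⟨x, ?_⟩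
    rw [← code_MReal]
    rfl
  · rintro ⟨x, rfl⟩
    refine ⟨x, ?_⟩
    rw [← code_MReal]
    rfl

-- Recursion on the multiplier, with the vector carried along as a parameter. Integer multiples with
-- denominators cleared replace rational scalars in the Hahn–Banach argument.
@[fun_prop]
theorem DFun.vnsmul {n : C → ℕ} {f : C → X.carrier} (hn : DFun M n) (hf : DFun M f) :
    DFun M fun c => n c • f c := by
  have h := DFun.iterate (M := M) (g := fun p : X.carrier × X.carrier => (p.1, p.2 + p.1))
    (by fun_prop)
  have e : ∀ (x : X.carrier) (n : ℕ),
      (fun p : X.carrier × X.carrier => (p.1, p.2 + p.1))^[n] (x, 0) = (x, n • x) := by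
    intro x n
    induction n with
    | zero => simp
    | succ n ih => rw [Function.iterate_succ_apply', ih, succ_nsmul]
  have := DFun.snd (DFun.comp h (hn.prodMk (hf.prodMk (DFun.const 0))))
  simpa only [e] using this

end Banach

/-! ### The Banach completion of X in `V` -/

section Completion

variable {M : Set ZFSet.{u}} [hM : Fact (IsTransitiveModelZFC M)] {X : BanachIn M}

/-- `j` embeds `X` isometrically onto a dense subspace of the real normed space `Z`. -/
structure IsBanachCompletion (X : BanachIn M) {Z : Type w} [NormedAddCommGroup Z]
    [NormedSpace ℝ Z] (j : X.carrier → Z) : Prop where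
  map_add : ∀ x y, j (x + y) = j x + j y
  map_smul : ∀ r x, j (X.smul r x) = r.val • j x
  norm_map : ∀ x, ‖j x‖ = (X.norm x).val
  dense : DenseRange j

theorem smul_of_val_eq_zero {r : MReal M} (hr : r.val = 0) (x : X.carrier) : X.smul r x = 0 := by
  apply X.eq_zero_of_norm
  rw [X.norm_smul, hr, abs_zero, zero_mul]

theorem norm_val_zero : (X.norm 0).val = 0 := by
  obtain ⟨r, hr⟩ := exists_rat_val (M := M) 0
  rw [← smul_of_val_eq_zero (X := X) (r := r) (by simpa using hr) 0, X.norm_smul, hr]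
  simp

theorem smul_of_val_eq_neg {r s : MReal M} (h : r.val = - s.val) (x : X.carrier) :
    X.smul r x = - X.smul s x := by
  obtain ⟨z, hz⟩ := exists_rat_val (M := M) 0
  rw [eq_neg_iff_add_eq_zero, ← X.add_smul r s z x (by rw [hz, h]; simp)]
  exact smul_of_val_eq_zero (by simpa using hz) x

theorem norm_val_neg (x : X.carrier) : (X.norm (-x)).val = (X.norm x).val := by
  obtain ⟨r, hr⟩ := exists_rat_val (M := M) (-1)
  obtain ⟨s, hs⟩ := exists_rat_val (M := M) 1
  have h1 : X.smul s x = x := X.one_smul s x (by simpa using hs)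
  have h2 := smul_of_val_eq_neg (X := X) (r := r) (s := s) (by rw [hr, hs]; simp) x
  rw [h1] at h2
  rw [← h2, X.norm_smul, hr]
  simp

variable (X) in
/-- The norm of `X`, as a norm in `V`. -/
noncomputable def addGroupNorm : AddGroupNorm X.carrier where
  toFun x := (X.norm x).val
  map_zero' := norm_val_zero
  add_le' := X.norm_add_le
  neg' := norm_val_neg
  eq_zero_of_map_eq_zero' x h := X.eq_zero_of_norm x h

variable (X) in
/-- `X` as a normed group in `V`. -/
@[reducible]
noncomputable def normedGroup : NormedAddCommGroup X.carrier :=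
  (addGroupNorm X).toNormedAddCommGroup

variable (M) in
/-- A rational number as a real number of `M`. -/
noncomputable def ratReal (q : ℚ) : MReal M := (exists_rat_val q).choose

theorem ratReal_val (q : ℚ) : (ratReal M q).val = q := (exists_rat_val q).choose_spec

/-- The scalar multiplication by rational numbers, as a biadditive map. -/
noncomputable def ratSmulHom {G : Type*} [AddCommGroup G] (i : X.carrier →+ G) :
    ℚ →+ X.carrier →+ G where
  toFun q :=
    { toFun := fun x => i (X.smul (ratReal M q) x)
      map_zero' := by
        have : X.smul (ratReal M q) 0 = 0 := by
          have := X.smul_add (ratReal M q) 0 0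
          simpa using this
        rw [this, map_zero]
      map_add' := fun x y => by rw [X.smul_add, map_add] }
  map_zero' := by
    ext x
    simp [smul_of_val_eq_zero (X := X) (r := ratReal M 0) (by rw [ratReal_val]; simp)]
  map_add' p q := by
    ext x
    simp [X.add_smul (ratReal M p) (ratReal M q) (ratReal M (p + q)) x
      (by simp [ratReal_val])]

/-- A filter is determined by its family of sets, so there are only `u`-many Cauchy filters.
Smallness is needed because the preinterpretations tested in `IsInterpretation` live in `Type u`. -/
theorem small_completion (α : Type*) [UniformSpace α] [Small.{u} α] :
    Small.{u} (UniformSpace.Completion α) := by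
  have h1 : Small.{u} (Filter α) :=
    small_of_injective (f := fun f : Filter α => f.sets) fun f g h => Filter.filter_eq h
  have h2 : Small.{u} (CauchyFilter α) := inferInstanceAs (Small.{u} {f : Filter α // Cauchy f})
  exact small_of_surjective (f := fun x : CauchyFilter α =>
    (SeparationQuotient.mk x : SeparationQuotient (CauchyFilter α)))
    SeparationQuotient.surjective_mk

variable (X) in
-- The metric completion is a normed group, but its scalars must grow from the reals of `M` to those
-- of `V`. Multiplication by rationals is biadditive and continuous, so it extends to the real
-- scalars.
theorem exists_isBanachCompletion : ∃ (Z : Type (u + 1)) (_ : NormedAddCommGroup Z)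
    (_ : NormedSpace ℝ Z) (j : X.carrier → Z), CompleteSpace Z ∧ Small.{u} Z ∧
      IsBanachCompletion X j := by
  let _ := normedGroup X
  have hnorm : ∀ x : X.carrier, ‖x‖ = (X.norm x).val := fun x => rfl
  let Z := UniformSpace.Completion X.carrier
  let i : X.carrier →+ Z := UniformSpace.Completion.toCompl
  have hin : ∀ x, ‖i x‖ = (X.norm x).val := fun x => UniformSpace.Completion.norm_coe x
  have di : IsDenseInducing i := UniformSpace.Completion.isDenseInducing_toCompl X.carrier
  let e : ℚ →+ ℝ := (Rat.castHom ℝ).toAddMonoidHom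
  have de : IsDenseInducing e := Rat.isDenseEmbedding_coe_real.isDenseInducing
  let φ := ratSmulHom (X := X) i
  have hφ : ∀ q x, φ q x = i (X.smul (ratReal M q) x) := fun q x => rfl
  have hφn : ∀ q x, ‖φ q x‖ = |(q : ℝ)| * ‖x‖ := fun q x => by
    rw [hφ, hin, X.norm_smul, ratReal_val, hnorm]
  have cφ : Continuous fun p : ℚ × X.carrier => φ p.1 p.2 := by
    rw [continuous_iff_continuousAt]
    rintro ⟨q, x⟩
    rw [ContinuousAt, tendsto_iff_norm_sub_tendsto_zero]
    have hb : ∀ p : ℚ × X.carrier, ‖φ p.1 p.2 - φ q x‖ ≤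
        |((p.1 : ℝ) - q)| * ‖p.2‖ + |(q : ℝ)| * ‖p.2 - x‖ := by
      intro p
      have : φ p.1 p.2 - φ q x = φ (p.1 - q) p.2 + φ q (p.2 - x) := by
        rw [map_sub φ, map_sub (φ q), AddMonoidHom.sub_apply]; abel
      rw [this]
      refine (norm_add_le _ _).trans ?_
      rw [hφn, hφn]
      push_cast
      rfl
    refine squeeze_zero (fun _ => norm_nonneg _) hb ?_
    have c1 : Continuous fun p : ℚ × X.carrier => |((p.1 : ℝ) - q)| * ‖p.2‖ +
        |(q : ℝ)| * ‖p.2 - x‖ := by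
      have : Continuous fun p : ℚ × X.carrier => (p.1 : ℝ) :=
        Rat.continuous_coe_real.comp continuous_fst
      fun_prop
    have := c1.tendsto (q, x)
    simpa using this
  -- The module laws and the norm identity for this extension hold for rationals and vectors of X,
  -- and pass to the limit.
  let sm : ℝ × Z → Z := (de.prodMap di).extend fun p : ℚ × X.carrier => φ p.1 p.2
  have csm : Continuous sm := de.extend_Z_bilin di cφ
  have hsm : ∀ (q : ℚ) x, sm (q, i x) = i (X.smul (ratReal M q) x) := fun q x =>
    (de.prodMap di).extend_eq cφ (q, x)
  have ind1 : ∀ (p : Z → Prop), IsClosed {z | p z} → (∀ x, p (i x)) → ∀ z, p z :=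
    fun p hp h z => di.dense.induction_on z hp h
  have ind2 : ∀ (p : ℝ × Z → Prop), IsClosed {z | p z} → (∀ (q : ℚ) x, p (q, i x)) →
      ∀ z, p z := fun p hp h z =>
    (de.prodMap di).dense.induction_on z hp fun y => h y.1 y.2
  have one_sm : ∀ z, sm (1, z) = z := by
    refine ind1 _ (isClosed_eq (by fun_prop) (by fun_prop)) fun x => ?_
    have := hsm 1 x
    rw [Rat.cast_one] at this
    rw [this, X.one_smul _ x (by rw [ratReal_val]; simp)]
  have sm_add : ∀ r z z', sm (r, z + z') = sm (r, z) + sm (r, z') := by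
    have : ∀ p : ℝ × Z, ∀ z', sm (p.1, p.2 + z') = sm (p.1, p.2) + sm (p.1, z') := by
      intro p z'
      refine ind1 (fun z' => sm (p.1, p.2 + z') = sm (p.1, p.2) + sm (p.1, z'))
        (isClosed_eq (by fun_prop) (by fun_prop)) (fun y => ?_) z'
      refine ind2 (fun p => sm (p.1, p.2 + i y) = sm (p.1, p.2) + sm (p.1, i y))
        (isClosed_eq (by fun_prop) (by fun_prop)) (fun q x => ?_) p
      simp only
      rw [← map_add, hsm, hsm, hsm, X.smul_add, map_add]
    exact fun r z z' => this (r, z) z'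
  have add_sm : ∀ r s z, sm (r + s, z) = sm (r, z) + sm (s, z) := by
    intro r s z
    refine ind2 (fun p => sm (p.1 + s, p.2) = sm (p.1, p.2) + sm (s, p.2))
      (isClosed_eq (by fun_prop) (by fun_prop)) (fun q x => ?_) (r, z)
    refine de.dense.induction_on (p := fun s : ℝ => sm (q + s, i x) = sm (q, i x) + sm (s, i x)) s
      (isClosed_eq (by fun_prop) (by fun_prop)) fun q' => ?_
    have h := hsm (q + q') x
    rw [Rat.cast_add] at h
    change sm ((q : ℝ) + (q' : ℝ), i x) = sm (q, i x) + sm ((q' : ℝ), i x)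
    rw [h, hsm, hsm, ← map_add,
      X.add_smul (ratReal M q) (ratReal M q') (ratReal M (q + q')) x (by simp [ratReal_val])]
  have mul_sm : ∀ r s z, sm (r * s, z) = sm (r, sm (s, z)) := by
    intro r s z
    refine ind2 (fun p => sm (r * p.1, p.2) = sm (r, sm (p.1, p.2)))
      (isClosed_eq (by fun_prop) (by fun_prop)) (fun q x => ?_) (s, z)
    refine de.dense.induction_on (p := fun r : ℝ => sm (r * q, i x) = sm (r, sm (q, i x))) r
      (isClosed_eq (by fun_prop) (by fun_prop)) fun q' => ?_
    have h := hsm (q' * q) x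
    rw [Rat.cast_mul] at h
    change sm ((q' : ℝ) * (q : ℝ), i x) = sm ((q' : ℝ), sm (q, i x))
    rw [h, hsm, hsm,
      X.mul_smul (ratReal M q') (ratReal M q) (ratReal M (q' * q)) x (by simp [ratReal_val])]
  have sm_zero : ∀ r, sm (r, 0) = 0 := fun r => by
    have := sm_add r 0 0
    simpa using this
  have zero_sm : ∀ z, sm (0, z) = 0 := fun z => by
    have := add_sm 0 0 z
    simpa using this
  have norm_sm : ∀ r z, ‖sm (r, z)‖ = ‖r‖ * ‖z‖ := by
    intro r z
    refine ind2 (fun p => ‖sm (p.1, p.2)‖ = ‖p.1‖ * ‖p.2‖)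
      (isClosed_eq (by fun_prop) (by fun_prop)) (fun q x => ?_) (r, z)
    simp only
    rw [hsm, hin, hin, X.norm_smul, ratReal_val, Real.norm_eq_abs]
  let iM : Module ℝ Z :=
    { smul := fun r z => sm (r, z)
      one_smul := one_sm
      mul_smul := mul_sm
      smul_zero := sm_zero
      smul_add := sm_add
      add_smul := add_sm
      zero_smul := zero_sm }
  let iN : NormedSpace ℝ Z := { iM with norm_smul_le := fun r z => (norm_sm r z).le }
  refine ⟨Z, inferInstance, iN, i, inferInstance, small_completion _, ?_⟩
  refine ⟨map_add i, fun r x => ?_, hin, di.dense⟩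
  -- The extension must also agree with the multiplication of X at an irrational r of `M`: the
  -- identity holds at rational t, hence at all real t, in particular at t = r.
  have key : ∀ t : ℝ, ‖i (X.smul r x) - sm (t, i x)‖ = |r.val - t| * (X.norm x).val := by
    intro t
    refine de.dense.induction_on
      (p := fun t : ℝ => ‖i (X.smul r x) - sm (t, i x)‖ = |r.val - t| * (X.norm x).val) t
      (isClosed_eq (by fun_prop) (by fun_prop)) fun q => ?_
    change ‖i (X.smul r x) - sm ((q : ℝ), i x)‖ = |r.val - (q : ℝ)| * (X.norm x).val
    rw [hsm, ← map_sub, hin]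
    have h1 : X.smul r x - X.smul (ratReal M q) x =
        X.smul (radd r (ratReal M (-q))) x := by
      rw [X.add_smul r (ratReal M (-q)) _ x (radd_val _ _),
        smul_of_val_eq_neg (r := ratReal M (-q)) (s := ratReal M q) (by simp [ratReal_val]),
        sub_eq_add_neg]
    rw [h1, X.norm_smul, radd_val, ratReal_val]
    push_cast
    rw [sub_eq_add_neg]
  have := key r.val
  rw [sub_self, abs_zero, zero_mul, norm_eq_zero, sub_eq_zero] at this
  exact this

end Completion

/-! ### The Banach completion interprets X -/

section IsBanachCompletion

variable {M : Set ZFSet.{u}} [hM : Fact (IsTransitiveModelZFC M)] {X : BanachIn M}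
  {Z : Type w} [NormedAddCommGroup Z] [NormedSpace ℝ Z] {j : X.carrier → Z}

namespace IsBanachCompletion

variable (hj : IsBanachCompletion X j)
include hj

theorem map_zero : j 0 = 0 := by
  have := hj.map_add 0 0
  simpa using this

theorem map_neg (x : X.carrier) : j (-x) = - j x := by
  rw [eq_neg_iff_add_eq_zero, ← hj.map_add, neg_add_cancel, hj.map_zero]

theorem map_sub (x y : X.carrier) : j (x - y) = j x - j y := by
  rw [sub_eq_add_neg, hj.map_add, hj.map_neg, sub_eq_add_neg]

theorem map_nsmul (n : ℕ) (x : X.carrier) : j (n • x) = n • j x := by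
  induction n with
  | zero => simp [hj.map_zero]
  | succ n ih => rw [succ_nsmul, hj.map_add, ih, succ_nsmul]

theorem dist_eq (x y : X.carrier) : dist (j x) (j y) = (X.norm (x - y)).val := by
  rw [dist_eq_norm, ← hj.map_sub, hj.norm_map]

theorem injective : Function.Injective j := by
  intro x y h
  have := hj.dist_eq x y
  rw [h, dist_self] at this
  exact sub_eq_zero.1 (X.eq_zero_of_norm _ this.symm)

theorem isMetricIn : IsMetricIn M j where
  dense := hj.dense
  dist_le := by
    simp only [hj.dist_eq]
    fun_prop
  complete s hs hc := by
    obtain ⟨x, hx⟩ := X.complete s (inModel_graph_of_dfun hs) (fun ε hε => by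
      obtain ⟨N, hN⟩ := Metric.cauchySeq_iff.1 hc ε hε
      exact ⟨N, fun m hm n hn => by rw [← hj.dist_eq]; exact hN m hm n hn⟩)
    refine ⟨x, Metric.tendsto_atTop.2 fun ε hε => ?_⟩
    obtain ⟨N, hN⟩ := hx ε hε
    exact ⟨N, fun n hn => by rw [hj.dist_eq]; exact hN n hn⟩

theorem space_opens : X.space.opens = metricOpens M j := by
  ext O
  refine and_congr_right fun _ => ?_
  simp only [hj.dist_eq]

theorem interprets [CompleteSpace Z] : Interprets M X.space inferInstance j :=
  interprets_congr rfl hj.space_opens hj.isMetricIn.interprets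

end IsBanachCompletion

end IsBanachCompletion

/-! ### The dual of X as a small coded type -/

section Dual

variable {M : Set ZFSet.{u}} [hM : Fact (IsTransitiveModelZFC M)] {X : BanachIn M}

theorem mem_graph_iff (f : X.Dual) (x : X.carrier) (r : MReal M) :
    (code (x, r) : M).1 ∈ f.graph ↔ r = f.toFun x := by
  rw [← SetLike.mem_coe, f.coe_graph]
  constructor
  · rintro ⟨y, hy⟩
    rw [← code_MReal] at hy
    have : (code (x, r) : M) = code (y, f.toFun y) := Subtype.ext hy
    rw [code_inj, Prod.mk.injEq] at this
    rw [this.2, this.1]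
  · rintro rfl
    refine ⟨x, ?_⟩
    rw [← code_MReal]
    rfl

theorem Dual_ext {f g : X.Dual} (h : f.graph = g.graph) : f = g := by
  have h1 : f.toFun = g.toFun := by
    funext x
    have := (mem_graph_iff f x _).2 rfl
    rw [h] at this
    exact (mem_graph_iff g x _).1 this
  cases f
  cases g
  simp only at h h1
  subst h h1
  rfl

/-- Boundedness on one ball makes an additive map continuous at 0, hence uniformly continuous. Its
extension to Z is additive and continuous, and such a map between real vector spaces is
automatically linear. -/
theorem additive_extension {Z : Type w} [NormedAddCommGroup Z] [NormedSpace ℝ Z]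
    {j : X.carrier → Z} (hj : IsBanachCompletion X j) (g : X.carrier → ℝ)
    (hadd : ∀ x y, g (x + y) = g x + g y)
    (hb : ∃ k : ℕ, ∀ x, (X.norm x).val ≤ 1 / ((k : ℝ) + 1) → |g x| ≤ 1) :
    ∃ F : StrongDual ℝ Z, ∀ x, F (j x) = g x := by
  let _ := normedGroup X
  have hnorm : ∀ x : X.carrier, ‖x‖ = ‖j x‖ := fun x => (hj.norm_map x).symm
  have hiso : Isometry j := Isometry.of_dist_eq fun x y => by
    rw [dist_eq_norm, dist_eq_norm, ← hj.map_sub, hnorm]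
  have ui := hiso.isUniformInducing
  let G : X.carrier →+ ℝ := AddMonoidHom.mk' g hadd
  have cont : Continuous G := by
    apply continuous_of_continuousAt_zero
    rw [ContinuousAt, map_zero, Metric.tendsto_nhds_nhds]
    intro ε hε
    obtain ⟨k, hk⟩ := hb
    obtain ⟨n, hn⟩ := exists_inv_lt hε
    -- For such x the multiple (n + 1) • x is still in the ball of the hypothesis, so |g x| ≤ 1/(n +
    -- 1).
    refine ⟨1 / ((k : ℝ) + 1) / ((n : ℝ) + 1), by positivity, fun x hx => ?_⟩
    rw [dist_zero_right] at hx ⊢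
    have h1 : |g ((n + 1) • x)| ≤ 1 := by
      apply hk
      rw [← hj.norm_map, hj.map_nsmul]
      refine norm_nsmul_le.trans ?_
      rw [hnorm, lt_div_iff₀ (by positivity)] at hx
      push_cast
      linarith
    have h2 : g ((n + 1) • x) = ((n : ℝ) + 1) * g x := by
      have := map_nsmul G (n + 1) x
      change g ((n + 1) • x) = (n + 1) • g x at this
      rw [this, nsmul_eq_mul]
      push_cast
      rfl
    rw [h2, abs_mul, abs_of_pos (by positivity : (0 : ℝ) < (n : ℝ) + 1)] at h1
    change |g x| < ε
    refine lt_of_le_of_lt ?_ hn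
    rw [le_div_iff₀ (by positivity)]
    linarith
  have uc : UniformContinuous G := uniformContinuous_addMonoidHom_of_continuous cont
  have di := ui.isDenseInducing hj.dense
  have he : ∀ x, di.extend G (j x) = G x := fun x => di.extend_eq cont x
  have ce : Continuous (di.extend G) :=
    (uniformContinuous_uniformly_extend ui hj.dense uc).continuous
  have hadd' : ∀ z z', di.extend G (z + z') = di.extend G z + di.extend G z' := by
    intro z z'
    refine hj.dense.induction_on₂ (p := fun z z' => di.extend G (z + z') =
      di.extend G z + di.extend G z') ?_ (fun x y => ?_) z z'
    · exact isClosed_eq (by fun_prop) (by fun_prop)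
    · rw [← hj.map_add, he, he, he, map_add]
  exact ⟨(AddMonoidHom.mk' (di.extend G) hadd').toRealLinearMap ce, he⟩

/-- Constructor for elements of the dual. -/
theorem exists_dual (φ : X.carrier → MReal M) (hφ : DFun M φ)
    (hadd : ∀ x y, (φ (x + y)).val = (φ x).val + (φ y).val)
    (hb : ∃ k : ℕ, ∀ x, (X.norm x).val ≤ 1 / ((k : ℝ) + 1) → |(φ x).val| ≤ 1) :
    ∃ f : X.Dual, f.toFun = φ := by
  obtain ⟨Z, _, _, j, _, _, hj⟩ := exists_isBanachCompletion X
  obtain ⟨F, hF⟩ := additive_extension hj (fun x => (φ x).val) hadd hb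
  obtain ⟨z, hz, h⟩ := inModel_graph_of_dfun hφ
  refine ⟨⟨φ, z, hz, ?_, hadd, fun r x => ?_, ‖F‖, fun x => ?_⟩, rfl⟩
  · rw [h]
    ext t
    refine exists_congr fun x => ?_
    rw [← code_MReal]
    rfl
  -- Homogeneity over the reals of `M` is inherited from the linear extension.
  · rw [← hF, ← hF, hj.map_smul, map_smul, smul_eq_mul]
  · rw [← hF, ← hj.norm_map, ← Real.norm_eq_abs]
    exact F.le_opNorm _

theorem dual_locally_bounded (f : X.Dual) :
    ∃ k : ℕ, ∀ x, (X.norm x).val ≤ 1 / ((k : ℝ) + 1) → |(f.toFun x).val| ≤ 1 := by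
  obtain ⟨C, hC⟩ := f.bounded
  obtain ⟨Z, _, _, j, _, _, hj⟩ := exists_isBanachCompletion X
  obtain ⟨k, hk⟩ := exists_nat_gt |C|
  refine ⟨k, fun x hx => (hC x).trans ?_⟩
  have h0 : 0 ≤ (X.norm x).val := by rw [← hj.norm_map]; exact norm_nonneg _
  rw [le_div_iff₀ (by positivity)] at hx
  have := le_abs_self C
  nlinarith

/-- By `exists_dual`, functionality, additivity and boundedness on one ball characterise the graphs
of functionals, without scalars. The bound |r| ≤ 1 is written as a distance to 0 with k = 0, the
form in which `DSet.mreal_dist_le` gives definability. -/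
theorem exists_eq_dual_graph_iff (z : M) : (∃ f : X.Dual, z.1 = f.graph) ↔
    ∃ S : MSub M (X.carrier × MReal M), z = code S ∧ (∀ x, ∃ r, (x, r) ∈ S) ∧
      (∀ x r s, (x, r) ∈ S → (x, s) ∈ S → r = s) ∧
      (∀ x y r s, (x, r) ∈ S → (y, s) ∈ S → (x + y, radd r s) ∈ S) ∧
      ∃ k : ℕ, ∀ x r, (x, r) ∈ S → (X.norm x).val ≤ 1 / ((k : ℝ) + 1) →
        dist r.val (ratReal M 0).val ≤ 1 / (((0 : ℕ) : ℝ) + 1) := by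
  have h0 : (ratReal M 0).val = 0 := by rw [ratReal_val]; simp
  simp only [h0, Real.dist_0_eq_abs, Nat.cast_zero, zero_add, div_one]
  constructor
  · rintro ⟨f, hf⟩
    obtain ⟨S, hS⟩ := exists_code_eq (M := M) (A := X.carrier × MReal M) z (by
      intro t ht
      rw [hf, ← SetLike.mem_coe, f.coe_graph] at ht
      obtain ⟨x, hx⟩ := ht
      refine ⟨(x, f.toFun x), Subtype.ext ?_⟩
      rw [hx, ← code_MReal]
      rfl)
    have hS' : ∀ x r, (x, r) ∈ S ↔ r = f.toFun x := fun x r => by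
      rw [← mem_graph_iff f, ← hf, hS, code_mem_code_iff]
    refine ⟨S, hS, ?_⟩
    simp only [hS']
    refine ⟨fun x => ⟨_, rfl⟩, fun x r s hr hs => hr.trans hs.symm, ?_, ?_⟩
    · rintro x y _ _ rfl rfl
      exact MReal_ext (by rw [radd_val, f.map_add])
    · obtain ⟨k, hk⟩ := dual_locally_bounded f
      exact ⟨k, by rintro x _ rfl h; exact hk x h⟩
  · rintro ⟨S, rfl, h1, h2, h3, k, hk⟩
    choose φ hφ using h1
    have hS : ∀ x r, (x, r) ∈ S ↔ r = φ x := fun x r =>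
      ⟨fun h => h2 x _ _ h (hφ x), fun h => h ▸ hφ x⟩
    have hφd : DFun M φ := by
      apply DFun.of_graph
      have : DSet M fun p : X.carrier × MReal M => p ∈ S := by fun_prop
      exact this.congr fun p => (hS p.1 p.2).symm
    obtain ⟨f, hf⟩ := exists_dual φ hφd
      (fun x y => by rw [← radd_val, ← (hS _ _).1 (h3 x y _ _ (hφ x) (hφ y))])
      ⟨k, fun x hx => hk x _ (hφ x) hx⟩
    refine ⟨f, ?_⟩
    apply SetLike.coe_injective
    rw [coe_code_eq_image, f.coe_graph]
    ext t
    constructor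
    · rintro ⟨⟨x, r⟩, hxr, rfl⟩
      refine ⟨x, ?_⟩
      rw [hf, ← (hS x r).1 hxr, ← code_MReal]
      rfl
    · rintro ⟨x, rfl⟩
      refine ⟨(x, φ x), hφ x, ?_⟩
      rw [hf, ← code_MReal]
      rfl

theorem dset_dual_graph : DSet M fun z : M => ∃ f : X.Dual, z.1 = f.graph := by
  simp only [exists_eq_dual_graph_iff]
  refine DSet.ex (DSet.and (by fun_prop) (DSet.and (by fun_prop) (DSet.and (by fun_prop)
    (DSet.and (by fun_prop) (DSet.ex (DSet.all (DSet.all (DSet.imp (by fun_prop)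
      (DSet.imp (by fun_prop) ?_)))))))))
  exact DSet.mreal_dist_le (by fun_prop) (by fun_prop) (by fun_prop)

instance instCodedDual : Coded M X.Dual where
  code f := ⟨f.graph, f.graph_mem⟩
  inj := fun f g h => Dual_ext (congrArg (Subtype.val : M → ZFSet.{u}) h)
  raw := by
    refine RawDef.congr (dset_dual_graph (X := X)) fun v => ?_
    constructor
    · rintro ⟨f, hf⟩
      exact ⟨v 0, rfl, f, congrArg Subtype.val hf⟩
    · rintro ⟨z, hz, f, hf⟩
      exact ⟨f, hz.trans (Subtype.ext hf)⟩

instance instIsSmallDual : IsSmall M X.Dual where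
  out := by
    obtain ⟨z, hz⟩ := exists_sep_small (M := M) (A := MSub M (X.carrier × MReal M))
      (P := fun S => ∃ f : X.Dual, code S = (code f : M)) (by fun_prop)
    refine ⟨z, fun t => ?_⟩
    rw [hz]
    constructor
    · rintro ⟨S, rfl, f, hf⟩
      exact ⟨f, hf⟩
    · rintro ⟨f, rfl⟩
      obtain ⟨S, hS, _⟩ := (exists_eq_dual_graph_iff (code f : M)).1 ⟨f, rfl⟩
      exact ⟨S, hS, f, hS.symm⟩

@[fun_prop]
theorem DFun.dualEval {C : Type*} [Coded M C] {f : C → X.Dual} {g : C → X.carrier}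
    (hf : DFun M f) (hg : DFun M g) : DFun M fun c => (f c).toFun (g c) := by
  apply DFun.of_graph
  have : DSet M fun p : C × MReal M => (Coded.code (g p.1, p.2) : M).1 ∈
    (Coded.code (f p.1) : M).1 := by fun_prop
  exact this.congr fun p => (mem_graph_iff _ _ _).symm

end Dual

/-! ### The closure of the dual of X interprets it -/

section DualCompletion

variable {M : Set ZFSet.{u}} [hM : Fact (IsTransitiveModelZFC M)] {X : BanachIn M}
  {Z : Type w} [NormedAddCommGroup Z] [NormedSpace ℝ Z] {j : X.carrier → Z}

namespace IsBanachCompletion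

variable (hj : IsBanachCompletion X j)
include hj

theorem exists_dualExt (f : X.Dual) : ∃ F : StrongDual ℝ Z, ∀ x, F (j x) = (f.toFun x).val :=
  additive_extension hj (fun x => (f.toFun x).val) f.map_add (dual_locally_bounded f)

/-- The continuous extension of a functional in `M`. -/
noncomputable def dualExt (f : X.Dual) : StrongDual ℝ Z := (hj.exists_dualExt f).choose

theorem dualExt_apply (f : X.Dual) (x : X.carrier) : hj.dualExt f (j x) = (f.toFun x).val :=
  (hj.exists_dualExt f).choose_spec x

theorem dual_ext {F G : StrongDual ℝ Z} (h : ∀ x, F (j x) = G (j x)) : F = G := by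
  apply DFunLike.coe_injective
  exact hj.dense.equalizer F.continuous G.continuous (funext h)

/-- The vectors of X are dense, and each nonzero one can be normalised by a scalar of `M`; so the
unit ball of X suffices to compute the norm. -/
theorem norm_le_iff {F : StrongDual ℝ Z} {c : ℝ} (hc : 0 ≤ c) :
    ‖F‖ ≤ c ↔ ∀ x, (X.norm x).val ≤ 1 → |F (j x)| ≤ c := by
  constructor
  · intro h x hx
    rw [← hj.norm_map] at hx
    rw [← Real.norm_eq_abs]
    calc ‖F (j x)‖ ≤ ‖F‖ * ‖j x‖ := F.le_opNorm _
      _ ≤ c * 1 := by gcongr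
      _ = c := mul_one c
  · intro h
    refine F.opNorm_le_bound hc fun z => ?_
    refine hj.dense.induction_on (p := fun z => ‖F z‖ ≤ c * ‖z‖) z
      (isClosed_le (by fun_prop) (by fun_prop)) fun x => ?_
    rcases (norm_nonneg (j x)).eq_or_lt with h0 | h0
    · rw [eq_comm, norm_eq_zero] at h0
      simp [h0]
    · have h0' := h0
      rw [hj.norm_map] at h0'
      obtain ⟨t, ht⟩ := exists_rinv _ h0'
      have h1 := h (X.smul t x) (by
        rw [X.norm_smul, ht, abs_of_pos (inv_pos.2 h0'), inv_mul_cancel₀ h0'.ne'])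
      rw [hj.map_smul, _root_.map_smul, ht, smul_eq_mul, abs_mul, abs_of_pos (inv_pos.2 h0'),
        ← hj.norm_map, ← Real.norm_eq_abs, inv_mul_le_iff₀ h0] at h1
      linarith

theorem supNorm_eq (F : StrongDual ℝ Z) : X.supNorm (fun x => F (j x)) = ‖F‖ := by
  unfold BanachIn.supNorm
  have hb : ∀ t ∈ {t | ∃ x, (X.norm x).val ≤ 1 ∧ t = |F (j x)|}, t ≤ ‖F‖ := by
    rintro _ ⟨x, hx, rfl⟩
    exact (hj.norm_le_iff (norm_nonneg F)).1 le_rfl x hx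
  have h0 : (0 : ℝ) ∈ {t | ∃ x, (X.norm x).val ≤ 1 ∧ t = |F (j x)|} :=
    ⟨0, by rw [norm_val_zero]; exact zero_le_one, by simp [hj.map_zero]⟩
  apply le_antisymm
  · exact csSup_le ⟨0, h0⟩ hb
  · rw [hj.norm_le_iff (le_csSup ⟨_, hb⟩ h0)]
    intro x hx
    exact le_csSup ⟨_, hb⟩ ⟨x, hx, rfl⟩

/-- Recognises the functionals that come from `M`: their restriction to X is definable with values
in the reals of `M`. Additivity and boundedness are inherited from F. -/
theorem exists_dualExt_eq (F : StrongDual ℝ Z) (φ : X.carrier → MReal M) (hφ : DFun M φ)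
    (h : ∀ x, (φ x).val = F (j x)) : ∃ f : X.Dual, hj.dualExt f = F := by
  obtain ⟨k, hk⟩ := exists_nat_gt ‖F‖
  obtain ⟨f, hf⟩ := exists_dual φ hφ (fun x y => by simp only [h, hj.map_add, _root_.map_add]) (by
    refine ⟨k, fun x hx => ?_⟩
    rw [h, ← Real.norm_eq_abs]
    refine (F.le_opNorm _).trans ?_
    rw [hj.norm_map]
    rw [← hj.norm_map] at *
    rw [le_div_iff₀ (by positivity)] at hx
    have := norm_nonneg (j x)
    nlinarith)
  exact ⟨f, hj.dual_ext fun x => by rw [hj.dualExt_apply, hf, h]⟩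

/-- The closure of the dual of `X` in the dual of the completion. -/
noncomputable def dualClosure : Submodule ℝ (StrongDual ℝ Z) where
  carrier := closure (Set.range hj.dualExt)
  zero_mem' := by
    obtain ⟨f, hf⟩ := hj.exists_dualExt_eq 0 (fun _ => ratReal M 0) (by fun_prop)
      (fun x => by simp [ratReal_val])
    exact subset_closure ⟨f, hf⟩
  add_mem' := by
    intro F G hF hG
    refine map_mem_closure₂ continuous_add hF hG ?_
    rintro _ ⟨f, rfl⟩ _ ⟨g, rfl⟩
    obtain ⟨h, hh⟩ := hj.exists_dualExt_eq (hj.dualExt f + hj.dualExt g)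
      (fun x => radd (f.toFun x) (g.toFun x)) (by fun_prop)
      (fun x => by simp [hj.dualExt_apply])
    exact ⟨h, hh⟩
  smul_mem' := by
    intro c F hF
    -- The extensions are closed under multiplication by scalars of `M` only; their closure admits
    -- all real scalars because the reals of `M` are dense.
    have hc : c ∈ closure (Set.range (MReal.val (M := M))) := denseRange_val c
    refine map_mem_closure₂ continuous_smul hc hF ?_
    rintro _ ⟨r, rfl⟩ _ ⟨f, rfl⟩
    -- The scalar is moved into the argument of f, which avoids a product of reals of `M`.
    obtain ⟨h, hh⟩ := hj.exists_dualExt_eq (r.val • hj.dualExt f)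
      (fun x => f.toFun (X.smul r x)) (by fun_prop)
      (fun x => by simp [hj.dualExt_apply, f.map_smul])
    exact ⟨h, hh⟩

theorem dualClosure_closed : IsClosed (hj.dualClosure : Set (StrongDual ℝ Z)) := isClosed_closure

/-- The embedding of the dual of `X` in its interpretation. -/
noncomputable def dualEmb (f : X.Dual) : hj.dualClosure := ⟨hj.dualExt f, subset_closure ⟨f, rfl⟩⟩

theorem dist_dualEmb (f g : X.Dual) : dist (hj.dualEmb f) (hj.dualEmb g) =
    ‖hj.dualExt f - hj.dualExt g‖ := by
  rw [Subtype.dist_eq, dist_eq_norm]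
  rfl

/-- The dual distance quantifies over the unit ball of X, hence is definable. For completeness, the
limit exists in the dual of Z; its values at vectors of X have cuts that are uniformly definable
from the sequence, so the limit comes from a functional of `M`. -/
theorem isMetricIn_dualEmb : IsMetricIn M hj.dualEmb where
  dense := by
    intro F
    rw [closure_subtype]
    have : (Subtype.val '' Set.range hj.dualEmb) = Set.range hj.dualExt := by
      rw [← Set.range_comp]
      rfl
    rw [this]
    exact F.2
  dist_le := by
    have : DSet M fun p : (X.Dual × X.Dual) × ℕ => ∀ x : X.carrier,
        (X.norm x).val ≤ 1 / (((0 : ℕ) : ℝ) + 1) →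
        dist (p.1.1.toFun x).val (p.1.2.toFun x).val ≤ 1 / ((p.2 : ℝ) + 1) :=
      DSet.all (DSet.imp (DSet.mreal_le_inv (by fun_prop) (by fun_prop))
        (DSet.mreal_dist_le (by fun_prop) (by fun_prop) (by fun_prop)))
    refine this.congr fun p => ?_
    rw [hj.dist_dualEmb, hj.norm_le_iff (by positivity)]
    simp [hj.dualExt_apply, Real.dist_eq]
  complete s hs hc := by
    have hc' : CauchySeq fun n => hj.dualExt (s n) :=
      uniformContinuous_subtype_val.comp_cauchySeq hc
    obtain ⟨L, hL⟩ := cauchySeq_tendsto_of_complete hc'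
    have hLx : ∀ x, Tendsto (fun n => ((s n).toFun x).val) atTop (𝓝 (L (j x))) := by
      intro x
      have h : Tendsto (fun n => hj.dualExt (s n) (j x)) atTop (𝓝 (L (j x))) :=
        ((ContinuousLinearMap.apply ℝ ℝ (j x)).continuous.tendsto L).comp hL
      simpa only [hj.dualExt_apply] using h
    have hd := DSet.qv_lt_lim (M := M) (F := fun p : X.carrier × ℕ => (s p.2).toFun p.1)
      (by fun_prop) (L := fun x => L (j x)) hLx
    have hex : ∀ x, ∃ r : MReal M, r.val = L (j x) := fun x => exists_MReal
      (DFun.comp_set (f := fun q : QCode => (x, q)) hd (by fun_prop))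
    choose φ hφ using hex
    obtain ⟨f, hf⟩ := hj.exists_dualExt_eq L φ (DFun.mreal (by simpa only [hφ] using hd)) hφ
    refine ⟨f, ?_⟩
    rw [tendsto_subtype_rng]
    change Tendsto (fun n => hj.dualExt (s n)) atTop (𝓝 (hj.dualExt f))
    rw [hf]
    exact hL

theorem dualSpace_opens : X.dualSpace.opens = metricOpens M hj.dualEmb := by
  ext O
  refine and_congr_right fun _ => ?_
  have : ∀ f g : X.Dual, X.supNorm (fun x => (g.toFun x).val - (f.toFun x).val) =
      dist (hj.dualEmb g) (hj.dualEmb f) := by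
    intro f g
    rw [hj.dist_dualEmb, ← hj.supNorm_eq]
    simp [hj.dualExt_apply]
  simp only [this]

theorem interprets_dual : Interprets M X.dualSpace inferInstance hj.dualEmb :=
  have : CompleteSpace hj.dualClosure := hj.dualClosure_closed.completeSpace_coe
  interprets_congr rfl hj.dualSpace_opens hj.isMetricIn_dualEmb.interprets

/-- The cut is definable: a rational is below the norm exactly when f exceeds it somewhere on the
unit ball. The ball is symmetric, so absolute values are not needed. -/
theorem exists_dualNorm (f : X.Dual) : ∃ r : MReal M, r.val = ‖hj.dualExt f‖ := by
  apply exists_MReal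
  have : DSet M fun q : QCode => ∃ x : X.carrier, (X.norm x).val ≤ 1 / (((0 : ℕ) : ℝ) + 1) ∧
      qv q < (f.toFun x).val :=
    DSet.ex (DSet.and (DSet.mreal_le_inv (by fun_prop) (by fun_prop)) (by fun_prop))
  refine this.congr fun q => ?_
  simp only [← hj.dualExt_apply, Nat.cast_zero, zero_add, div_one]
  constructor
  · intro hq
    by_contra! hcon
    have h0 : 0 ≤ qv q := by
      have := hcon 0 (by rw [norm_val_zero]; exact zero_le_one)
      rwa [hj.map_zero, _root_.map_zero] at this
    refine absurd ((hj.norm_le_iff h0).2 fun x hx => ?_) (not_le.2 hq)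
    rw [abs_le]
    have h1 := hcon x hx
    have h2 := hcon (-x) (by rwa [norm_val_neg])
    rw [hj.map_neg, _root_.map_neg] at h2
    exact ⟨by linarith, h1⟩
  · rintro ⟨x, hx, h⟩
    exact h.trans_le ((le_abs_self _).trans ((hj.norm_le_iff (norm_nonneg _)).1 le_rfl x hx))

end IsBanachCompletion

end DualCompletion

/-! ### Zorn's lemma in `M` -/

section Zorn

variable {M : Set ZFSet.{u}} [hM : Fact (IsTransitiveModelZFC M)]
  {A : Type v} [Coded M A] [IsSmall M A] {C : Type w} [Coded M C]

/-- The elements of a set in `M`, as a type. -/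
def Elems (S : MSub M A) : Type v := {a : A // a ∈ S}

/-- The inclusion of the elements of a set. -/
def Elems.val {S : MSub M A} (a : Elems S) : A := Subtype.val a

theorem Elems.val_injective {S : MSub M A} : Function.Injective (Elems.val (S := S)) :=
  Subtype.val_injective

theorem dset_elems (S : MSub M A) : DSet M fun a : A => ∃ d : Elems S, a = d.val := by
  have : DSet M fun a : A => a ∈ S := by fun_prop
  exact this.congr fun a => ⟨fun ⟨d, hd⟩ => hd ▸ d.2, fun h => ⟨⟨a, h⟩, rfl⟩⟩

noncomputable instance instCodedElems (S : MSub M A) : Coded M (Elems S) :=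
  Coded.ofInjective Elems.val Elems.val_injective (dset_elems S)

instance instIsSmallElems (S : MSub M A) : IsSmall M (Elems S) :=
  IsSmall.ofInjective Elems.val Elems.val_injective (dset_elems S)

@[fun_prop]
theorem DFun.elemsVal {S : MSub M A} {f : C → Elems S} (hf : DFun M f) :
    DFun M fun c => (f c).val := hf

/-- Zorn's lemma in `M`. -/
theorem exists_maximal_of_chains [Nonempty A] (R : MSub M (A × A))
    (refl : ∀ a, (a, a) ∈ R) (antisymm : ∀ a b, (a, b) ∈ R → (b, a) ∈ R → a = b)
    (trans : ∀ a b c, (a, b) ∈ R → (b, c) ∈ R → (a, c) ∈ R)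
    (chains : ∀ S : MSub M A, (∃ a, a ∈ S) → (∀ a b, a ∈ S → b ∈ S → (a, b) ∈ R ∨ (b, a) ∈ R) →
      ∃ u, (∀ a, a ∈ S → (a, u) ∈ R) ∧ ∀ v, (∀ a, a ∈ S → (a, v) ∈ R) → (u, v) ∈ R) :
    ∃ m, ∀ a, (m, a) ∈ R → a = m := by
  by_contra! hcon
  -- Without a maximal element, choice in `M` gives a definable strictly increasing map. What
  -- follows is the Bourbaki–Witt argument, in which every set must be definable.
  obtain ⟨s, hs, hs'⟩ := exists_choice (M := M) (A := A) (B := A)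
    (R := fun a b => (a, b) ∈ R ∧ ¬ b = a) (by fun_prop) hcon
  have a₀ : A := Classical.arbitrary A
  let IsSup : MSub M A → A → Prop := fun S u =>
    (∀ a, a ∈ S → (a, u) ∈ R) ∧ ∀ v, (∀ a, a ∈ S → (a, v) ∈ R) → (u, v) ∈ R
  let IsChain : MSub M A → Prop := fun S =>
    (∃ a, a ∈ S) ∧ ∀ a b, a ∈ S → b ∈ S → (a, b) ∈ R ∨ (b, a) ∈ R
  -- The least tower `T₀` will turn out to be a chain. Its supremum u then belongs to it, and so
  -- does s u, which forces s u ≤ u.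
  let Tower : MSub M A → Prop := fun T => a₀ ∈ T ∧ (∀ a, a ∈ T → s a ∈ T) ∧
    ∀ S, IsChain S → (∀ a, a ∈ S → a ∈ T) → ∀ u, IsSup S u → u ∈ T
  have hT₀ : DSet M fun a : A => ∀ T, Tower T → a ∈ T := by
    simp only [Tower, IsChain, IsSup]
    fun_prop
  let T₀ : MSub M A := MSub.mk _ hT₀
  have tower₀ : Tower T₀ := by
    refine ⟨fun T hT => hT.1, fun a ha T hT => hT.2.1 a (ha T hT), fun S hS hST u hu T hT => ?_⟩
    exact hT.2.2 S hS (fun a ha => hST a ha T hT) u hu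
  have ind : ∀ (P : A → Prop) (hP : DSet M P), Tower (MSub.mk (fun a => a ∈ T₀ ∧ P a)
      (DSet.and (by fun_prop) hP)) → ∀ a, a ∈ T₀ → P a := fun P hP hT a ha => (ha _ hT).2
  have bot : ∀ a, a ∈ T₀ → (a₀, a) ∈ R := by
    refine ind (fun a => (a₀, a) ∈ R) (by fun_prop) ⟨⟨tower₀.1, refl _⟩, fun a ha =>
      ⟨tower₀.2.1 a ha.1, trans _ _ _ ha.2 (hs' a).1⟩, fun S hS hST u hu => ?_⟩
    refine ⟨tower₀.2.2 S hS (fun a ha => (hST a ha).1) u hu, ?_⟩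
    obtain ⟨a, ha⟩ := hS.1
    exact trans _ _ _ (hST a ha).2 (hu.1 a ha)
  -- Extreme elements: by `step`, no element of `T₀` lies strictly between such a c and s c or is
  -- incomparable to both. Induction over the least tower shows that all its elements are extreme.
  let Ext : A → Prop := fun c => ∀ x, x ∈ T₀ → (x, c) ∈ R → ¬ x = c → (s x, c) ∈ R
  have hExt : DSet M Ext := by
    simp only [Ext]
    fun_prop
  have step : ∀ c, c ∈ T₀ → Ext c → ∀ x, x ∈ T₀ → (x, c) ∈ R ∨ (s c, x) ∈ R := by
    intro c hc hce
    refine ind (fun x => (x, c) ∈ R ∨ (s c, x) ∈ R) (by fun_prop)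
      ⟨⟨tower₀.1, Or.inl (bot c hc)⟩, fun x hx => ⟨tower₀.2.1 x hx.1, ?_⟩, fun S hS hST u hu => ?_⟩
    · rcases hx.2 with h | h
      · by_cases hxc : x = c
        · exact Or.inr (hxc ▸ refl _)
        · exact Or.inl (hce x hx.1 h hxc)
      · exact Or.inr (trans _ _ _ h (hs' x).1)
    · refine ⟨tower₀.2.2 S hS (fun a ha => (hST a ha).1) u hu, ?_⟩
      by_cases hall : ∀ a, a ∈ S → (a, c) ∈ R
      · exact Or.inl (hu.2 c hall)
      · push Not at hall
        obtain ⟨a, ha, hac⟩ := hall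
        exact Or.inr (trans _ _ _ ((hST a ha).2.resolve_left hac) (hu.1 a ha))
  have ext_all : ∀ c, c ∈ T₀ → Ext c := by
    refine ind Ext hExt ⟨⟨tower₀.1, fun x hx h hne =>
      absurd (antisymm _ _ h (bot x hx)) hne⟩, fun c hc => ⟨tower₀.2.1 c hc.1, ?_⟩,
      fun S hS hST u hu => ⟨tower₀.2.2 S hS (fun a ha => (hST a ha).1) u hu, ?_⟩⟩
    · intro x hx hxs hne
      rcases step c hc.1 hc.2 x hx with h | h
      · by_cases hxc : x = c
        · exact hxc ▸ refl _
        · exact trans _ _ _ (hc.2 x hx h hxc) (hs' c).1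
      · exact absurd (antisymm _ _ hxs h) hne
    · intro x hx hxu hne
      by_cases hall : ∀ a, a ∈ S → (a, x) ∈ R
      · exact absurd (antisymm _ _ hxu (hu.2 x hall)) hne
      · push Not at hall
        obtain ⟨c, hc, hcx⟩ := hall
        rcases step c (hST c hc).1 (hST c hc).2 x hx with h | h
        · have hxc : ¬ x = c := fun e => hcx (e ▸ refl _)
          exact trans _ _ _ ((hST c hc).2 x hx h hxc) (hu.1 c hc)
        · exact absurd (trans _ _ _ (hs' c).1 h) hcx
  have chain₀ : IsChain T₀ := by
    refine ⟨⟨a₀, tower₀.1⟩, fun x y hx hy => ?_⟩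
    rcases step y hy (ext_all y hy) x hx with h | h
    · exact Or.inl h
    · exact Or.inr (trans _ _ _ (hs' y).1 h)
  obtain ⟨u, hu⟩ := chains T₀ chain₀.1 chain₀.2
  have huT : u ∈ T₀ := tower₀.2.2 T₀ chain₀ (fun _ h => h) u hu
  exact (hs' u).2 (antisymm _ _ (hu.1 _ (tower₀.2.1 u huT)) (hs' u).1)

/-- Zorn's lemma in `M` for families of sets closed under unions of chains. -/
theorem exists_maximal_set (F : MSub M (MSub M A)) (K₀ : MSub M A) (h₀ : K₀ ∈ F)
    (hF : ∀ S : MSub M (MSub M A), (∃ K, K ∈ S) → (∀ K, K ∈ S → K ∈ F) →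
      (∀ K L, K ∈ S → L ∈ S → (∀ a, a ∈ K → a ∈ L) ∨ ∀ a, a ∈ L → a ∈ K) →
      ∀ U : MSub M A, (∀ a, a ∈ U ↔ ∃ K, K ∈ S ∧ a ∈ K) → U ∈ F) :
    ∃ K, K ∈ F ∧ ∀ L, L ∈ F → (∀ a, a ∈ K → a ∈ L) → ∀ a, a ∈ L → a ∈ K := by
  have hR : DSet M fun p : Elems F × Elems F => ∀ a, a ∈ p.1.val → a ∈ p.2.val := by fun_prop
  have : Nonempty (Elems F) := ⟨⟨K₀, h₀⟩⟩
  obtain ⟨m, hm⟩ := exists_maximal_of_chains (MSub.mk _ hR) (fun _ _ h => h)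
    (fun K L h h' => Elems.val_injective (MSub.ext fun a => ⟨h a, h' a⟩))
    (fun _ _ _ h h' a ha => h' a (h a ha)) (by
      rintro S ⟨K, hK⟩ hS
      have hd : DSet M fun L : MSub M A => ∃ K : Elems F, K ∈ S ∧ L = K.val := by fun_prop
      have hU : DSet M fun a : A => ∃ K : Elems F, K ∈ S ∧ a ∈ K.val := by fun_prop
      refine ⟨⟨MSub.mk _ hU, hF (MSub.mk _ hd) ⟨_, K, hK, rfl⟩ ?_ ?_ _ fun a => ?_⟩, ?_, ?_⟩
      · rintro _ ⟨K, _, rfl⟩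
        exact K.2
      · rintro _ _ ⟨K, hK, rfl⟩ ⟨L, hL, rfl⟩
        exact hS K L hK hL
      · constructor
        · rintro ⟨K, hK, ha⟩
          exact ⟨_, ⟨K, hK, rfl⟩, ha⟩
        · rintro ⟨_, ⟨K, hK, rfl⟩, ha⟩
          exact ⟨K, hK, ha⟩
      · intro K hK a ha
        exact ⟨K, hK, ha⟩
      · rintro V hV a ⟨K, hK, ha⟩
        exact hV K hK a ha)
  refine ⟨m.val, m.2, fun L hL hmL a ha => ?_⟩
  have := hm ⟨L, hL⟩ hmL
  rw [← this]
  exact ha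

end Zorn

/-! ### Maximal positive cones in `M` -/

section HahnBanach

variable {M : Set ZFSet.{u}} [hM : Fact (IsTransitiveModelZFC M)] {X : BanachIn M}

variable (X) in
/-- `X` as a vector space over the rationals. -/
@[reducible]
noncomputable def ratModule : Module ℚ X.carrier where
  smul q x := X.smul (ratReal M q) x
  one_smul x := X.one_smul _ x (by rw [ratReal_val]; simp)
  mul_smul p q x := X.mul_smul _ _ _ x (by simp [ratReal_val])
  smul_zero q := by
    have : X.smul (ratReal M q) 0 = 0 := by
      have := X.smul_add (ratReal M q) 0 0
      simpa using this
    exact this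
  smul_add q x y := X.smul_add _ x y
  add_smul p q x := X.add_smul _ _ _ x (by simp [ratReal_val])
  zero_smul x := smul_of_val_eq_zero (by rw [ratReal_val]; simp) x

/-- A cone in the rational vector space `X` which does not contain `0` and which contains a
neighbourhood of `x`. -/
structure IsPosCone (x : X.carrier) (K : MSub M X.carrier) : Prop where
  add : ∀ y z, y ∈ K → z ∈ K → y + z ∈ K
  div : ∀ (n : ℕ) y, (n + 1) • y ∈ K → y ∈ K
  zero : (0 : X.carrier) ∉ K
  ball : ∀ y, (∃ t : MReal M, (ratReal M 0).val < t.val ∧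
    (X.norm ((y - X.smul t x) + (y - X.smul t x))).val < (X.norm (X.smul t x)).val) → y ∈ K

theorem isPosCone_iff (x : X.carrier) (K : MSub M X.carrier) : IsPosCone x K ↔
    (∀ y z, y ∈ K → z ∈ K → y + z ∈ K) ∧ (∀ (n : ℕ) y, (n + 1) • y ∈ K → y ∈ K) ∧
    ¬ ((0 : X.carrier) ∈ K) ∧ ∀ y, (∃ t : MReal M, (ratReal M 0).val < t.val ∧
    (X.norm ((y - X.smul t x) + (y - X.smul t x))).val < (X.norm (X.smul t x)).val) → y ∈ K :=
  ⟨fun h => ⟨h.1, h.2, h.3, h.4⟩, fun h => ⟨h.1, h.2.1, h.2.2.1, h.2.2.2⟩⟩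

theorem dset_isPosCone (x : X.carrier) : DSet M fun K : MSub M X.carrier => IsPosCone x K := by
  simp only [isPosCone_iff]
  fun_prop

/-- The condition on t is open, so a real witness can be replaced by one in the dense set of reals
of `M`. The sum of two equal vectors in the definition expresses the factor 2 without scalars; it
reappears as the constant in `exists_dual_eq_one`. -/
theorem ball_iff {Z : Type w} [NormedAddCommGroup Z] [NormedSpace ℝ Z] {j : X.carrier → Z}
    (hj : IsBanachCompletion X j) (x y : X.carrier) :
    (∃ t : MReal M, (ratReal M 0).val < t.val ∧
      (X.norm ((y - X.smul t x) + (y - X.smul t x))).val < (X.norm (X.smul t x)).val) ↔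
    ∃ t : ℝ, 0 < t ∧ 2 * ‖j y - t • j x‖ < t * ‖j x‖ := by
  have key : ∀ t : MReal M, ((ratReal M 0).val < t.val ∧
      (X.norm ((y - X.smul t x) + (y - X.smul t x))).val < (X.norm (X.smul t x)).val) ↔
      0 < t.val ∧ 2 * ‖j y - t.val • j x‖ < t.val * ‖j x‖ := by
    intro t
    rw [ratReal_val, Rat.cast_zero]
    refine and_congr_right fun ht => ?_
    rw [X.norm_smul, abs_of_pos ht, ← hj.norm_map, ← hj.norm_map, hj.map_add, hj.map_sub,
      hj.map_smul, ← two_smul ℝ (j y - _), norm_smul]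
    simp
  simp only [key]
  constructor
  · rintro ⟨t, ht⟩
    exact ⟨t.val, ht⟩
  · intro h
    have ho : IsOpen {t : ℝ | 0 < t ∧ 2 * ‖j y - t • j x‖ < t * ‖j x‖} :=
      IsOpen.inter (s := {t : ℝ | 0 < t}) (t := {t : ℝ | 2 * ‖j y - t • j x‖ < t * ‖j x‖})
        (isOpen_lt continuous_const continuous_id)
        (isOpen_lt (f := fun t : ℝ => 2 * ‖j y - t • j x‖) (g := fun t : ℝ => t * ‖j x‖)
          (by fun_prop) (by fun_prop))
    obtain ⟨t, ht⟩ := denseRange_val.exists_mem_open (s := {t : ℝ | 0 < t ∧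
      2 * ‖j y - t • j x‖ < t * ‖j x‖}) (f := MReal.val (M := M)) ho h
    exact ⟨t, ht⟩

/-- Zorn's lemma starts from the cone generated by the ball around x. Unions of chains keep all the
conditions, which mention at most two elements at a time. -/
theorem exists_maximal_cone (x : X.carrier) : ∃ K, IsPosCone x K ∧
    ∀ L, IsPosCone x L → (∀ y, y ∈ K → y ∈ L) → ∀ y, y ∈ L → y ∈ K := by
  obtain ⟨Z, _, _, j, _, _, hj⟩ := exists_isBanachCompletion X
  have hd : DSet M fun y : X.carrier => ∃ t : MReal M, (ratReal M 0).val < t.val ∧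
    (X.norm ((y - X.smul t x) + (y - X.smul t x))).val < (X.norm (X.smul t x)).val := by fun_prop
  have hK : IsPosCone x (MSub.mk _ hd) := by
    refine ⟨?_, ?_, ?_, fun y h => h⟩
    · simp only [MSub.mem_mk, ball_iff hj]
      rintro y z ⟨t, ht, h⟩ ⟨s, hs, h'⟩
      refine ⟨t + s, by positivity, ?_⟩
      have : j (y + z) - (t + s) • j x = (j y - t • j x) + (j z - s • j x) := by
        rw [hj.map_add, add_smul]; abel
      rw [this]
      have := norm_add_le (j y - t • j x) (j z - s • j x)
      linarith
    · simp only [MSub.mem_mk, ball_iff hj]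
      rintro n y ⟨t, ht, h⟩
      have hn : (0 : ℝ) < (n : ℝ) + 1 := by positivity
      refine ⟨t / (n + 1), by positivity, ?_⟩
      have e : j ((n + 1) • y) - t • j x = ((n : ℝ) + 1) • (j y - (t / ((n : ℝ) + 1)) • j x) := by
        rw [hj.map_nsmul, smul_sub, smul_smul, mul_div_cancel₀ _ hn.ne', ← Nat.cast_smul_eq_nsmul ℝ]
        push_cast
        rfl
      rw [e, norm_smul, Real.norm_of_nonneg hn.le] at h
      rw [div_mul_eq_mul_div, lt_div_iff₀ hn]
      linarith
    · simp only [MSub.mem_mk, ball_iff hj]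
      rintro ⟨t, ht, h⟩
      rw [hj.map_zero, zero_sub, norm_neg, norm_smul, Real.norm_of_nonneg ht.le] at h
      have := mul_nonneg ht.le (norm_nonneg (j x))
      linarith
  obtain ⟨K, hK, hmax⟩ := exists_maximal_set (MSub.mk _ (dset_isPosCone x)) _ hK (by
    rintro S ⟨K₀, hK₀⟩ hS hchain U hU
    refine ⟨?_, ?_, ?_, ?_⟩
    · intro y z hy hz
      obtain ⟨K, hK, hy⟩ := (hU y).1 hy
      obtain ⟨L, hL, hz⟩ := (hU z).1 hz
      rcases hchain K L hK hL with h | h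
      · exact (hU _).2 ⟨L, hL, (hS L hL).add y z (h y hy) hz⟩
      · exact (hU _).2 ⟨K, hK, (hS K hK).add y z hy (h z hz)⟩
    · intro n y hy
      obtain ⟨K, hK, hy⟩ := (hU _).1 hy
      exact (hU _).2 ⟨K, hK, (hS K hK).div n y hy⟩
    · intro h
      obtain ⟨K, hK, h⟩ := (hU _).1 h
      exact (hS K hK).zero h
    · intro y hy
      exact (hU _).2 ⟨K₀, hK₀, (hS K₀ hK₀).ball y hy⟩)
  exact ⟨K, hK, hmax⟩

theorem IsPosCone.nsmul {x y : X.carrier} {K : MSub M X.carrier} (hK : IsPosCone x K)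
    (hy : y ∈ K) (n : ℕ) : (n + 1) • y ∈ K := by
  induction n with
  | zero => simpa using hy
  | succ n ih => rw [succ_nsmul]; exact hK.add _ _ ih hy

/-- A maximal cone contains each vector, up to sign and a small perturbation. -/
theorem IsPosCone.neg_mem_or {x : X.carrier} {K : MSub M X.carrier} (hK : IsPosCone x K)
    (hmax : ∀ L, IsPosCone x L → (∀ y, y ∈ K → y ∈ L) → ∀ y, y ∈ L → y ∈ K) (hx : x ∈ K)
    (z : X.carrier) : -z ∈ K ∨ ∀ a b : ℕ, b • z + (a + 1) • x ∈ K := by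
  -- This set is the cone generated by `K` and z. If it contains 0, then -z is in `K`; otherwise it
  -- is a positive cone, and maximality puts it inside `K`.
  have hd : DSet M fun y : X.carrier => ∃ n m : ℕ, (n + 1) • y - m • z ∈ K := by fun_prop
  have hsub : ∀ y, y ∈ K → y ∈ MSub.mk _ hd := fun y hy => ⟨0, 0, by simpa using hy⟩
  by_cases h0 : (0 : X.carrier) ∈ MSub.mk _ hd
  · left
    obtain ⟨n, m, h⟩ := h0
    rw [smul_zero, zero_sub] at h
    cases m with
    | zero => exact absurd (by simpa using h) hK.zero
    | succ m =>
      rw [← smul_neg] at h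
      exact hK.div m _ h
  · right
    intro a b
    refine hmax (MSub.mk _ hd) ⟨?_, ?_, h0, fun y hy => hsub y (hK.ball y hy)⟩ hsub _ ?_
    · rintro y y' ⟨n, m, h⟩ ⟨n', m', h'⟩
      refine ⟨n * n' + n + n', (n' + 1) * m + (n + 1) * m', ?_⟩
      have e : (n * n' + n + n' + 1) • (y + y') - ((n' + 1) * m + (n + 1) * m') • z =
          (n' + 1) • ((n + 1) • y - m • z) + (n + 1) • ((n' + 1) • y' - m' • z) := by
        have e1 : n * n' + n + n' + 1 = (n' + 1) * (n + 1) := by ring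
        have e2 : n * n' + n + n' + 1 = (n + 1) * (n' + 1) := by ring
        rw [smul_add, smul_sub, smul_sub, add_smul _ _ z, mul_smul, mul_smul]
        nth_rewrite 1 [e1]
        rw [e2, mul_smul, mul_smul]
        abel
      rw [e]
      exact hK.add _ _ (hK.nsmul h _) (hK.nsmul h' _)
    · rintro l y ⟨n, m, h⟩
      refine ⟨n * l + n + l, m, ?_⟩
      have e1 : n * l + n + l + 1 = (n + 1) * (l + 1) := by ring
      rw [e1, mul_smul]
      exact h
    · refine ⟨0, b, ?_⟩
      have : (0 + 1) • (b • z + (a + 1) • x) - b • z = (a + 1) • x := by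
        rw [zero_add, one_smul]; abel
      rw [this]
      exact hK.nsmul hx a

end HahnBanach

/-- The functional given by an almost total cone in a rational vector space. -/
theorem exists_additive_of_cone {E : Type*} [AddCommGroup E] [Module ℚ E] (K : Set E) (x : E)
    (add : ∀ y z, y ∈ K → z ∈ K → y + z ∈ K) (div : ∀ (n : ℕ) y, (n + 1) • y ∈ K → y ∈ K)
    (nsmul : ∀ y ∈ K, ∀ n : ℕ, (n + 1) • y ∈ K) (zero : (0 : E) ∉ K) (hx : x ∈ K)
    (dich : ∀ z, -z ∈ K ∨ ∀ a b : ℕ, b • z + (a + 1) • x ∈ K)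
    (absorb : ∀ y, ∃ t : ℚ, y + t • x ∈ K) :
    ∃ g : E →+ ℝ, g x = 1 ∧ ∀ y (p : ℝ), p < g y ↔ ∃ q : ℚ, p < q ∧ y - q • x ∈ K := by
  have hden : ∀ q : ℚ, q.den - 1 + 1 = q.den := fun q => Nat.sub_add_cancel q.den_pos
  have hnum : ∀ q : ℚ, 0 < q → ∃ a : ℕ, ∀ y : E, q.den • (q • y) = (a + 1) • y := by
    intro q hq
    have hq' := Rat.num_pos.2 hq
    refine ⟨q.num.toNat - 1, fun y => ?_⟩
    have e : q.num.toNat - 1 + 1 = q.num.toNat := by omega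
    rw [e, ← Nat.cast_smul_eq_nsmul ℚ, smul_smul, mul_comm, Rat.mul_den_eq_num,
      ← Nat.cast_smul_eq_nsmul ℚ]
    congr 1
    have : ((q.num.toNat : ℤ) : ℚ) = q.num := by rw [Int.toNat_of_nonneg hq'.le]
    exact_mod_cast this.symm
  have hsmul : ∀ q : ℚ, 0 < q → ∀ y ∈ K, q • y ∈ K := by
    intro q hq y hy
    obtain ⟨a, ha⟩ := hnum q hq
    apply div (q.den - 1)
    rw [hden, ha]
    exact nsmul y hy a
  have hle : ∀ y (q p : ℚ), y - q • x ∈ K → p ≤ q → y - p • x ∈ K := by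
    intro y q p h hpq
    rcases hpq.eq_or_lt with rfl | hpq
    · exact h
    · have := add _ _ h (hsmul (q - p) (sub_pos.2 hpq) x hx)
      rwa [show y - q • x + (q - p) • x = y - p • x by module] at this
  have hadd : ∀ y z (q p : ℚ), y - q • x ∈ K → z - p • x ∈ K → (y + z) - (q + p) • x ∈ K := by
    intro y z q p h h'
    have := add _ _ h h'
    rwa [show y - q • x + (z - p • x) = (y + z) - (q + p) • x by module] at this
  have hzero : ∀ q : ℚ, (0 : E) - q • x ∈ K ↔ q < 0 := by
    intro q
    constructor
    · intro h
      by_contra! hq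
      have := hle 0 q 0 h hq
      rw [zero_smul, sub_zero] at this
      exact zero this
    · intro h
      have := hsmul (-q) (neg_pos.2 h) x hx
      rwa [neg_smul, ← zero_sub] at this
  -- The dichotomy for the cone, divided by the denominator of ε.
  have hneg : ∀ y (q ε : ℚ), y - q • x ∉ K → 0 < ε → -y - (-q - ε) • x ∈ K := by
    intro y q ε h hε
    obtain ⟨a, ha⟩ := hnum ε hε
    rcases dich (-(y - q • x)) with h' | h'
    · rw [neg_neg] at h'
      exact absurd h' h
    · apply div (ε.den - 1)
      rw [hden]
      have := h' a ε.den
      rw [← ha, ← smul_add] at this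
      rwa [show -(y - q • x) + ε • x = -y - (-q - ε) • x by module] at this
  let D : E → Set ℝ := fun y => {r | ∃ q : ℚ, y - q • x ∈ K ∧ (q : ℝ) = r}
  have hne : ∀ y, (D y).Nonempty := by
    intro y
    obtain ⟨t, ht⟩ := absorb y
    exact ⟨((-t : ℚ) : ℝ), -t, by rwa [neg_smul, sub_neg_eq_add], rfl⟩
  have hsum : ∀ y (q p : ℚ), y - q • x ∈ K → -y - p • x ∈ K → q + p < 0 := by
    intro y q p h h'
    have := hadd _ _ _ _ h h'
    rwa [add_neg_cancel, hzero] at this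
  have hbdd : ∀ y, BddAbove (D y) := by
    intro y
    obtain ⟨t, ht⟩ := absorb (-y)
    refine ⟨(t : ℝ), ?_⟩
    rintro _ ⟨q, hq, rfl⟩
    have := hsum y q (-t) hq (by rwa [neg_smul, sub_neg_eq_add])
    exact_mod_cast (by linarith : q ≤ t)
  -- The cone acts as the positivity domain of the functional: its value at y is the supremum of the
  -- rationals q for which y - q • x is in `K`. Superadditivity comes from closure under sums, the
  -- behaviour under negation from the dichotomy.
  let g : E → ℝ := fun y => sSup (D y)
  have hlt : ∀ y (p : ℝ), p < g y ↔ ∃ q : ℚ, p < q ∧ y - q • x ∈ K := by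
    intro y p
    rw [lt_csSup_iff (hbdd y) (hne y)]
    constructor
    · rintro ⟨_, ⟨q, hq, rfl⟩, h⟩
      exact ⟨q, h, hq⟩
    · rintro ⟨q, h, hq⟩
      exact ⟨_, ⟨q, hq, rfl⟩, h⟩
  have hge : ∀ y (q : ℚ), y - q • x ∈ K → (q : ℝ) ≤ g y := fun y q h =>
    le_csSup (hbdd y) ⟨q, h, rfl⟩
  have hsuper : ∀ y z, g y + g z ≤ g (y + z) := by
    intro y z
    by_contra! hcon
    have h1 : g (y + z) - g z < g y := by linarith
    obtain ⟨q, hq, hqK⟩ := (hlt _ _).1 h1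
    have h2 : g (y + z) - q < g z := by linarith
    obtain ⟨p, hp, hpK⟩ := (hlt _ _).1 h2
    have := hge _ _ (hadd _ _ _ _ hqK hpK)
    push_cast at this
    linarith
  have hg0 : g 0 ≤ 0 := by
    refine csSup_le (hne 0) ?_
    rintro _ ⟨q, hq, rfl⟩
    exact_mod_cast ((hzero q).1 hq).le
  have hgneg : ∀ y, g (-y) = - g y := by
    intro y
    apply le_antisymm
    · have := hsuper (-y) y
      rw [neg_add_cancel] at this
      linarith
    · by_contra! hcon
      -- Two rationals are needed: the larger one gives a non-member of `K`, and their difference is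
      -- the perturbation allowed in `hneg`.
      obtain ⟨p, hp, hp'⟩ := exists_rat_btwn hcon
      obtain ⟨p', hpp, hp''⟩ := exists_rat_btwn hp'
      have h1 : y - (-p') • x ∉ K := by
        intro h
        have := hge _ _ h
        push_cast at this
        linarith
      have h2 := hge _ _ (hneg y (-p') (p' - p) h1 (sub_pos.2 (by exact_mod_cast hpp)))
      push_cast at h2
      linarith
  refine ⟨AddMonoidHom.mk' g fun y z => le_antisymm ?_ (hsuper y z), ?_, hlt⟩
  -- Superadditivity at y + z and -z, together with oddness, is the reverse inequality.
  · have := hsuper (y + z) (-z)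
    rw [hgneg, add_neg_cancel_right] at this
    linarith
  · change g x = 1
    have h1 : ∀ q : ℚ, x - q • x ∈ K ↔ q < 1 := by
      intro q
      rw [show x - q • x = 0 - (q - 1) • x by module, hzero, sub_neg]
    apply le_antisymm
    · refine csSup_le (hne x) ?_
      rintro _ ⟨q, hq, rfl⟩
      exact_mod_cast ((h1 q).1 hq).le
    · refine le_of_forall_lt fun c hc => ?_
      obtain ⟨q, hq, hq'⟩ := exists_rat_btwn hc
      exact (hlt _ _).2 ⟨q, hq, (h1 q).2 (by exact_mod_cast hq')⟩

/-! ### The Hahn–Banach theorem in `M` -/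

section HahnBanach

variable {M : Set ZFSet.{u}} [hM : Fact (IsTransitiveModelZFC M)] {X : BanachIn M}

/-- A form of the Hahn–Banach theorem in `M`. -/
theorem exists_dual_eq_one {x : X.carrier} (hx : x ≠ 0) : ∃ f : X.Dual, (f.toFun x).val = 1 ∧
    ∀ y, |(f.toFun y).val| * (X.norm x).val ≤ 2 * (X.norm y).val := by
  obtain ⟨Z, _, _, j, _, _, hj⟩ := exists_isBanachCompletion X
  let _ := ratModule X
  obtain ⟨K, hK, hmax⟩ := exists_maximal_cone x
  have hjx : 0 < ‖j x‖ := by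
    rw [norm_pos_iff, ← hj.map_zero]
    exact hj.injective.ne hx
  have hjr : ∀ (q : ℚ) y, j (q • y) = (q : ℝ) • j y := fun q y => by
    rw [← ratReal_val (M := M) q]
    exact hj.map_smul _ _
  have hxK : x ∈ K := hK.ball x ((ball_iff hj x x).2 ⟨1, one_pos, by simpa using hjx⟩)
  -- The vector y + t • x lies in the ball around t • x that the cone must contain; this will bound
  -- the norm of the functional.
  have hbound : ∀ y (t : ℚ), 2 * ‖j y‖ < t * ‖j x‖ → y + t • x ∈ K := by
    intro y t ht
    refine hK.ball _ ((ball_iff hj x _).2 ⟨t, ?_, ?_⟩)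
    · by_contra! hcon
      have := norm_nonneg (j y)
      nlinarith
    · rw [hj.map_add, hjr, add_sub_cancel_right]
      exact ht
  have hrat : ∀ y (r : ℝ), 2 * ‖j y‖ / ‖j x‖ < r → ∃ t : ℚ, (t : ℝ) < r ∧ y + t • x ∈ K := by
    intro y r hr
    obtain ⟨t, ht, ht'⟩ := exists_rat_btwn hr
    exact ⟨t, ht', hbound y t ((div_lt_iff₀ hjx).1 ht)⟩
  obtain ⟨g, hg, hlt⟩ := exists_additive_of_cone {y | y ∈ K} x hK.add hK.div
    (fun y hy n => hK.nsmul hy n) hK.zero hxK (hK.neg_mem_or hmax hxK) (fun y =>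
      let ⟨t, _, ht⟩ := hrat y _ (lt_add_one _)
      ⟨t, ht⟩)
  have hlow : ∀ y, -(2 * ‖j y‖ / ‖j x‖) ≤ g y := by
    intro y
    refine le_of_forall_lt fun c hc => ?_
    obtain ⟨t, ht, htK⟩ := hrat y (-c) (by linarith)
    refine (hlt _ _).2 ⟨-t, by push_cast; linarith, ?_⟩
    rwa [neg_smul, sub_neg_eq_add]
  have habs : ∀ y, |g y| ≤ 2 * ‖j y‖ / ‖j x‖ := by
    intro y
    have h1 := hlow y
    have h2 := hlow (-y)
    rw [hj.map_neg, norm_neg, map_neg] at h2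
    exact abs_le.2 ⟨h1, by linarith⟩
  -- The functional is built in `V` from a cone of `M`. Clearing denominators expresses its cuts
  -- through integer multiples and membership in `K`, so the functional belongs to `M`.
  have hd : DSet M fun p : X.carrier × QCode => qv p.2 < g p.1 := by
    have : DSet M fun p : X.carrier × QCode => ∃ q : QCode, qv p.2 < qv q ∧
        (q.2.2 + 1) • p.1 + q.2.1 • x - q.1 • x ∈ K :=
      DSet.ex (DSet.and (DSet.qv_lt_qv (by fun_prop) (by fun_prop)) (by fun_prop))
    refine this.congr fun p => ?_
    rw [hlt]
    have key : ∀ (q : QCode) (r : ℚ), qv q = r →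
        (p.1 - r • x ∈ K ↔ (q.2.2 + 1) • p.1 + q.2.1 • x - q.1 • x ∈ K) := by
      intro q r hr
      have h0 : ((q.2.2 : ℚ) + 1) ≠ 0 := by positivity
      have hr' : r * ((q.2.2 : ℚ) + 1) = q.1 - q.2.1 := by
        have h0' : ((q.2.2 : ℝ) + 1) ≠ 0 := by positivity
        rw [qv, div_eq_iff h0'] at hr
        exact_mod_cast hr.symm
      have e : (q.2.2 + 1) • p.1 + q.2.1 • x - q.1 • x = (q.2.2 + 1) • (p.1 - r • x) := by
        rw [← Nat.cast_smul_eq_nsmul ℚ, ← Nat.cast_smul_eq_nsmul ℚ, ← Nat.cast_smul_eq_nsmul ℚ,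
          ← Nat.cast_smul_eq_nsmul ℚ, smul_sub, smul_smul]
        push_cast
        rw [mul_comm _ r, hr']
        module
      rw [e]
      exact ⟨fun h => hK.nsmul h _, hK.div _ _⟩
    constructor
    · rintro ⟨r, hr, h⟩
      obtain ⟨q, hq⟩ := exists_qv_eq r
      exact ⟨q, by rwa [hq], (key q r hq).1 h⟩
    · rintro ⟨q, hq, h⟩
      have hr : qv q = (((q.1 : ℚ) - q.2.1) / (q.2.2 + 1) : ℚ) := by
        rw [qv]; push_cast; rfl
      exact ⟨_, by rwa [← hr], (key q _ hr).2 h⟩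
  have hex : ∀ y, ∃ r : MReal M, r.val = g y := fun y => exists_MReal
    (DFun.comp_set (f := fun q : QCode => (y, q)) hd (by fun_prop))
  choose φ hφ using hex
  obtain ⟨k, hk⟩ := exists_nat_gt (2 / ‖j x‖)
  obtain ⟨f, hf⟩ := exists_dual φ (DFun.mreal (by simpa only [hφ] using hd))
    (fun y z => by rw [hφ, hφ, hφ, map_add]) (by
      refine ⟨k, fun y hy => ?_⟩
      rw [hφ]
      refine (habs y).trans ?_
      rw [← hj.norm_map, le_div_iff₀ (by positivity)] at hy
      rw [mul_div_right_comm]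
      have := norm_nonneg (j y)
      nlinarith)
  refine ⟨f, by rw [hf, hφ, hg], fun y => ?_⟩
  rw [hf, hφ, ← hj.norm_map, ← hj.norm_map, ← le_div_iff₀ hjx]
  exact habs y

end HahnBanach

/-! ### Helly's lemma and the Milman–Pettis theorem -/

section Reflexive

variable {Z : Type w} [NormedAddCommGroup Z] [NormedSpace ℝ Z]

/-- Helly's lemma. -/
theorem mem_closure_image_closedBall {ι : Type*} [Finite ι]
    (G : StrongDual ℝ (StrongDual ℝ Z)) (hG : ‖G‖ ≤ 1) (F : ι → StrongDual ℝ Z) :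
    (fun i => G (F i)) ∈ closure ((fun y i => F i y) '' Metric.closedBall (0 : Z) 1) := by
  have := Fintype.ofFinite ι
  classical
  by_contra hcon
  let T : Z →ₗ[ℝ] ι → ℝ := LinearMap.pi fun i => (F i).toLinearMap
  have hconv : Convex ℝ (closure (T '' Metric.closedBall (0 : Z) 1)) :=
    ((convex_closedBall 0 1).linear_image T).closure
  -- A separating functional on the finite-dimensional space yields a combination H of the F i that
  -- is at most c on the unit ball, so ‖H‖ ≤ c, while G H > c contradicts ‖G‖ ≤ 1.
  obtain ⟨f, c, hf, hc⟩ := geometric_hahn_banach_closed_point hconv isClosed_closure hcon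
  have hsum : ∀ a : ι → ℝ, f a = ∑ i, a i * f (Pi.single i 1) := by
    intro a
    conv_lhs => rw [pi_eq_sum_univ' a]
    rw [map_sum]
    refine Finset.sum_congr rfl fun i _ => ?_
    rw [map_smul, smul_eq_mul]
  let H : StrongDual ℝ Z := ∑ i, f (Pi.single i 1) • F i
  have hH : ∀ y, H y = f (T y) := fun y => by
    rw [hsum]
    simp [H, T, mul_comm]
  have hGH : G H = f fun i => G (F i) := by
    rw [hsum]
    simp [H, mul_comm]
  have hle : ∀ y, ‖y‖ ≤ 1 → H y ≤ c := fun y hy => by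
    rw [hH]
    exact (hf _ (subset_closure ⟨y, by simpa using hy, rfl⟩)).le
  have hc0 : 0 ≤ c := by simpa using hle 0 (by simp)
  have hn : ‖H‖ ≤ c := by
    refine H.opNorm_le_of_unit_norm hc0 fun y hy => ?_
    rw [Real.norm_eq_abs, abs_le]
    have := hle (-y) (by rw [norm_neg]; exact hy.le)
    rw [map_neg] at this
    exact ⟨by linarith, hle y hy.le⟩
  have h1 : G H ≤ ‖H‖ := (le_abs_self _).trans ((G.le_opNorm H).trans
    (mul_le_of_le_one_left (norm_nonneg _) hG))
  rw [← hGH] at hc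
  linarith

set_option maxSynthPendingDepth 3 in
/-- The Milman–Pettis theorem. -/
theorem exists_forall_apply_eq [CompleteSpace Z] [UniformConvexSpace Z]
    (G : StrongDual ℝ (StrongDual ℝ Z)) : ∃ y : Z, ∀ F : StrongDual ℝ Z, F y = G F := by
  suffices h : ∀ G : StrongDual ℝ (StrongDual ℝ Z), ‖G‖ = 1 → ∃ y : Z, ∀ F, F y = G F by
    rcases eq_or_ne G 0 with rfl | hG
    · exact ⟨0, fun F => by simp⟩
    · obtain ⟨y, hy⟩ := h (‖G‖⁻¹ • G) (by
        rw [norm_smul, norm_inv, norm_norm, inv_mul_cancel₀ (norm_ne_zero_iff.2 hG)])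
      refine ⟨‖G‖ • y, fun F => ?_⟩
      have h0 : ‖G‖ ≠ 0 := norm_ne_zero_iff.2 hG
      rw [map_smul, hy]
      simp [h0]
  intro G hG
  let T : Z → StrongDual ℝ Z → ℝ := fun y F => F y
  -- The points of the unit ball that converge weakly to G. Helly's lemma makes this filter proper,
  -- and uniform convexity will make it Cauchy in norm.
  let l : Filter Z := comap T (𝓝 fun F => G F) ⊓ 𝓟 (Metric.closedBall 0 1)
  have hcl : (fun F => G F) ∈ closure (T '' Metric.closedBall 0 1) := by
    rw [mem_closure_iff_nhds_basis (nhds_pi (A := fun _ : StrongDual ℝ Z => ℝ) ▸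
      hasBasis_pi fun F => Metric.nhds_basis_ball)]
    rintro ⟨I, r⟩ ⟨hI, hr⟩
    have := hI.to_subtype
    obtain ⟨_, hy, y, hyB, rfl⟩ := mem_closure_iff.1
      (mem_closure_image_closedBall G hG.le fun F : I => (F : StrongDual ℝ Z))
      (Set.univ.pi fun F : I => Metric.ball (G F) (r F))
      (isOpen_set_pi Set.finite_univ fun _ _ => Metric.isOpen_ball)
      fun F _ => Metric.mem_ball_self (hr F F.2)
    exact ⟨_, ⟨y, hyB, rfl⟩, fun F hF => hy ⟨F, hF⟩ trivial⟩
  have hne : l.NeBot := by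
    refine inf_principal_neBot_iff.2 fun s hs => ?_
    obtain ⟨t, ht, hts⟩ := mem_comap.1 hs
    obtain ⟨_, hy, y, hyB, rfl⟩ := mem_closure_iff_nhds.1 hcl t ht
    exact ⟨y, hts hy, hyB⟩
  have hT : ∀ F : StrongDual ℝ Z, Tendsto F l (𝓝 (G F)) := fun F =>
    (tendsto_pi_nhds.1 (tendsto_comap.mono_left inf_le_left : Tendsto T l _)) F
  have hB : ∀ᶠ y in l, ‖y‖ ≤ 1 := by
    refine mem_of_superset (mem_inf_of_right (mem_principal_self _)) fun y hy => ?_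
    simpa using hy
  have hcauchy : Cauchy l := by
    rw [Metric.cauchy_iff]
    refine ⟨hne, fun ε hε => ?_⟩
    obtain ⟨δ, hδ, h⟩ := exists_forall_closed_ball_dist_add_le_two_sub Z hε
    -- A functional that nearly attains ‖G‖ = 1. Two points of the ball where F exceeds 1 - δ/2 have
    -- a sum of norm more than 2 - δ, so they are less than ε apart.
    obtain ⟨F, hF, hGF⟩ : ∃ F : StrongDual ℝ Z, ‖F‖ ≤ 1 ∧ 1 - δ / 2 < G F := by
      obtain ⟨F, hF, hGF⟩ := G.exists_lt_apply_of_lt_opNorm (r := 1 - δ / 2) (by linarith)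
      rw [Real.norm_eq_abs] at hGF
      rcases lt_abs.1 hGF with h | h
      · exact ⟨F, hF.le, h⟩
      · exact ⟨-F, by rw [norm_neg]; exact hF.le, by rwa [map_neg]⟩
    refine ⟨_, hB.and ((hT F).eventually (lt_mem_nhds hGF)), ?_⟩
    rintro x ⟨hx, hFx⟩ y ⟨hy, hFy⟩
    rw [dist_eq_norm]
    by_contra! hcon
    have h1 := h hx hy hcon
    have h2 : F (x + y) ≤ ‖x + y‖ := (le_abs_self _).trans ((F.le_opNorm _).trans
      (mul_le_of_le_one_left (norm_nonneg _) hF))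
    rw [map_add] at h2
    linarith
  obtain ⟨y, hy⟩ := CompleteSpace.complete hcauchy
  exact ⟨y, fun F => tendsto_nhds_unique (F.continuous.continuousAt.mono_left hy) (hT F)⟩

end Reflexive

/-! ### Uniformly convex spaces: the closure of the dual is everything -/

section UniformlyConvex

variable {M : Set ZFSet.{u}} [hM : Fact (IsTransitiveModelZFC M)] {X : BanachIn M}
  {Z : Type w} [NormedAddCommGroup Z] [NormedSpace ℝ Z] {j : X.carrier → Z}

namespace IsBanachCompletion

variable (hj : IsBanachCompletion X j)
include hj

/-- An approximant from X is normalised with the reciprocal of its norm in `M`. Normalising moves it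
by at most its original distance from z, hence the tolerance η/2; the bound 1 keeps it away from 0.
-/
theorem exists_norm_eq_one {z : Z} (hz : ‖z‖ = 1) {η : ℝ} (hη : 0 < η) :
    ∃ x, (X.norm x).val = 1 ∧ ‖j x - z‖ < η := by
  obtain ⟨x, hx⟩ := hj.dense.exists_dist_lt z (ε := min (η / 2) 1) (by positivity)
  rw [lt_min_iff, dist_comm, dist_eq_norm] at hx
  have h1 := abs_norm_sub_norm_le (j x) z
  rw [hz] at h1
  have h0 : 0 < ‖j x‖ := by linarith [abs_le.1 h1]
  have h0' := h0
  rw [hj.norm_map] at h0'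
  obtain ⟨t, ht⟩ := exists_rinv _ h0'
  rw [← hj.norm_map] at ht
  refine ⟨X.smul t x, ?_, ?_⟩
  · rw [X.norm_smul, ht, ← hj.norm_map, abs_of_pos (inv_pos.2 h0), inv_mul_cancel₀ h0.ne']
  · have h2 : ‖j (X.smul t x) - j x‖ = |‖j x‖ - 1| := by
      have e : j (X.smul t x) - j x = (‖j x‖⁻¹ - 1) • j x := by
        rw [hj.map_smul, ht, sub_smul, one_smul]
      rw [e, norm_smul, Real.norm_eq_abs, ← abs_of_pos h0, ← abs_mul, abs_of_pos h0, sub_mul,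
        inv_mul_cancel₀ h0.ne', one_mul, abs_sub_comm]
    have := norm_sub_le_norm_sub_add_norm_sub (j (X.smul t x)) (j x) z
    linarith

theorem uniformConvexSpace (hX : X.UniformlyConvex) : UniformConvexSpace Z where
  uniform_convex ε hε := by
    obtain ⟨δ, hδ, h⟩ := hX (ε / 2) (half_pos hε)
    refine ⟨δ, hδ, fun z hz z' hz' hzz => le_of_forall_pos_le_add fun η hη => ?_⟩
    -- Two errors of ε/4 keep the approximants ε/2 apart, as the choice of δ requires, and two
    -- errors of η/2 add up to the slack η.
    have hη' : 0 < min (η / 2) (ε / 4) := by positivity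
    obtain ⟨x, hx, hxz⟩ := hj.exists_norm_eq_one hz hη'
    obtain ⟨x', hx', hxz'⟩ := hj.exists_norm_eq_one hz' hη'
    rw [lt_min_iff] at hxz hxz'
    have h1 := h x x' hx hx'
    rw [← hj.norm_map, ← hj.norm_map, hj.map_sub, hj.map_add] at h1
    have h2 : ‖z - z'‖ ≤ ‖j x - j x'‖ + ‖j x - z‖ + ‖j x' - z'‖ := by
      have := norm_add₃_le (a := j x - j x') (b := -(j x - z)) (c := j x' - z')
      rw [norm_neg] at this
      refine le_trans (le_of_eq (congrArg _ ?_)) this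
      abel
    have h3 : ‖z + z'‖ ≤ ‖j x + j x'‖ + ‖j x - z‖ + ‖j x' - z'‖ := by
      have := norm_add₃_le (a := j x + j x') (b := -(j x - z)) (c := -(j x' - z'))
      rw [norm_neg, norm_neg] at this
      refine le_trans (le_of_eq (congrArg _ ?_)) this
      abel
    have h4 := h1 (by linarith)
    linarith

/-- The dual of a uniformly convex space is dense in the dual of the completion. -/
theorem dualClosure_eq_top [CompleteSpace Z] (hX : X.UniformlyConvex) : hj.dualClosure = ⊤ := by
  have := hj.uniformConvexSpace hX
  by_contra hne
  obtain ⟨G, hG, hGC⟩ : ∃ G : StrongDual ℝ (StrongDual ℝ Z), G ≠ 0 ∧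
      ∀ F ∈ hj.dualClosure, G F = 0 := by
    obtain ⟨F₀, hF₀⟩ : ∃ F, F ∉ hj.dualClosure := by
      by_contra! h
      exact hne (Submodule.eq_top_iff'.2 h)
    obtain ⟨G, c, hG, hc⟩ := geometric_hahn_banach_closed_point hj.dualClosure.convex
      hj.dualClosure_closed hF₀
    refine ⟨G, ?_, fun F hF => ?_⟩
    · rintro rfl
      have := hG 0 (zero_mem _)
      exact absurd hc (not_lt.2 this.le)
    -- A functional bounded above on a subspace vanishes there: the multiple of F by c / G F would
    -- attain the value c, which is excluded.
    · by_contra h0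
      have := hG ((c / G F) • F) (hj.dualClosure.smul_mem _ hF)
      rw [_root_.map_smul, smul_eq_mul, div_mul_cancel₀ _ h0] at this
      exact lt_irrefl _ this
  obtain ⟨y, hy⟩ := exists_forall_apply_eq G
  have hy0 : 0 < ‖y‖ := by
    rw [norm_pos_iff]
    rintro rfl
    exact hG (by ext F; simp [← hy])
  -- With tolerance ‖y‖/4, ‖j x‖ is at least 3‖y‖/4. A functional of `M` that is 1 at x and 0 at y,
  -- of norm at most 2/‖j x‖, gives ‖j x‖ ≤ 2‖j x - y‖ < ‖y‖/2, a contradiction.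
  obtain ⟨x, hx⟩ := hj.dense.exists_dist_lt y (ε := ‖y‖ / 4) (by positivity)
  rw [dist_comm, dist_eq_norm] at hx
  have h1 := norm_sub_le_norm_sub_add_norm_sub y (j x) 0
  rw [sub_zero, sub_zero, norm_sub_rev] at h1
  have hx0 : x ≠ 0 := by
    rintro rfl
    rw [hj.map_zero, norm_zero] at h1
    rw [hj.map_zero] at hx
    linarith
  obtain ⟨f, hf, hfb⟩ := exists_dual_eq_one hx0
  have hb : ∀ z, |hj.dualExt f z| * ‖j x‖ ≤ 2 * ‖z‖ := by
    intro z
    refine hj.dense.induction_on (p := fun z => |hj.dualExt f z| * ‖j x‖ ≤ 2 * ‖z‖) z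
      (isClosed_le (by fun_prop) (by fun_prop)) fun y => ?_
    rw [hj.dualExt_apply, hj.norm_map, hj.norm_map]
    exact hfb y
  have h2 := hb (j x - y)
  rw [_root_.map_sub, hj.dualExt_apply, hf, hy, hGC _ (subset_closure ⟨f, rfl⟩), sub_zero, abs_one,
    one_mul] at h2
  linarith

end IsBanachCompletion

end UniformlyConvex

/-! ### Assembly and transport to an arbitrary interpretation -/

section Main

variable {M : Set ZFSet.{u}} [hM : Fact (IsTransitiveModelZFC M)]

/-- The interpretations of the operations, the norm and the dual in a Banach completion. -/
theorem interpretsMap_of_isBanachCompletion (X : BanachIn M)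
    {Z : Type w} [NormedAddCommGroup Z] [NormedSpace ℝ Z] [CompleteSpace Z] {j : X.carrier → Z}
    (hj : IsBanachCompletion X j) :
      InterpretsMap (S := X.space.prod M X.space) (T := X.space) M
        (Prod.map j j) j (fun p : X.carrier × X.carrier => p.1 + p.2)
        (fun p : Z × Z => p.1 + p.2) ∧
      InterpretsMap (S := (realSpace M).prod M X.space) (T := X.space) M
        (Prod.map MReal.val j) j (fun p => X.smul p.1 p.2)
        (fun p : ℝ × Z => p.1 • p.2) ∧
      InterpretsMap (S := X.space) (T := realSpace M) M
        j MReal.val X.norm (fun x : Z => ‖x‖) ∧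
      ∃ (C : Submodule ℝ (StrongDual ℝ Z)) (ι : X.Dual → C),
        (∀ f : X.Dual, InterpretsMap (S := X.space) (T := realSpace M) M
          j MReal.val f.toFun (ι f : StrongDual ℝ Z)) ∧
        IsClosed (C : Set (StrongDual ℝ Z)) ∧
        Interprets M X.dualSpace inferInstance ι ∧
        (∃ dualNorm : X.Dual → MReal M,
          (∀ f, (dualNorm f).val = X.supNorm (fun x => (f.toFun x).val)) ∧
          InterpretsMap (S := X.dualSpace) (T := realSpace M) M
            ι MReal.val dualNorm (fun f : C => ‖(f : StrongDual ℝ Z)‖)) ∧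
        InterpretsMap (S := X.space.prod M X.dualSpace) (T := realSpace M) M
          (Prod.map j ι) MReal.val (fun p => p.2.toFun p.1)
          (fun p : Z × C => (p.2 : StrongDual ℝ Z) p.1) ∧
        (X.UniformlyConvex → C = ⊤) := by
  have hX := hj.interprets
  have hR := interprets_realSpace (M := M)
  have hD := hj.interprets_dual
  have : CompleteSpace hj.dualClosure := hj.dualClosure_closed.completeSpace_coe
  refine ⟨⟨?_, hX, by fun_prop, fun p => (hj.map_add _ _).symm⟩,
    ⟨?_, hX, by fun_prop, fun p => (hj.map_smul _ _).symm⟩,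
    ⟨hX, hR, continuous_norm, hj.norm_map⟩, hj.dualClosure, hj.dualEmb,
    fun f => ⟨hX, hR, (hj.dualExt f).continuous, hj.dualExt_apply f⟩, hj.dualClosure_closed, hD,
    ?_, ⟨?_, hR, ?_, fun p => hj.dualExt_apply p.2 p.1⟩,
    hj.dualClosure_eq_top⟩
  · exact interprets_prod hj.isMetricIn hj.isMetricIn rfl hj.space_opens rfl hj.space_opens
  · exact interprets_prod isMetricIn_val hj.isMetricIn realSpace_code realSpace_opens rfl
      hj.space_opens
  · choose N hN using hj.exists_dualNorm
    refine ⟨N, fun f => ?_, hD, hR, by fun_prop, fun f => (hN f).symm⟩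
    rw [hN, ← hj.supNorm_eq]
    simp only [hj.dualExt_apply]
  · exact interprets_prod hj.isMetricIn hj.isMetricIn_dualEmb rfl hj.space_opens rfl
      hj.dualSpace_opens
  · fun_prop

/-- Each interpretation of a Banach space in `M` is a Banach completion. -/
theorem exists_isBanachCompletion_of_interprets (X : BanachIn M)
    (Xhat : VSpace.{u}) (π : X.carrier → Xhat.Pt)
    (hπ : Interprets M X.space Xhat.top π) :
    ∃ (_ : NormedAddCommGroup Xhat.Pt) (_ : NormedSpace ℝ Xhat.Pt),
      Xhat.top = (inferInstance : TopologicalSpace Xhat.Pt) ∧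
      CompleteSpace Xhat.Pt ∧ IsBanachCompletion X π := by
  obtain ⟨Z, _, _, j, _, _, hj⟩ := exists_isBanachCompletion X
  -- Uniqueness of interpretations compares spaces in `Type u`, so the completion is first replaced
  -- by an isometric copy there.
  let σ : Z ≃ Shrink.{u} Z := equivShrink Z
  let m : MetricSpace (Shrink.{u} Z) := MetricSpace.induced σ.symm σ.symm.injective inferInstance
  have hσ : Isometry σ := Isometry.of_dist_eq fun x y => by
    change dist (σ.symm (σ x)) (σ.symm (σ y)) = dist x y
    simp
  have : CompleteSpace (Shrink.{u} Z) := by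
    have := hσ.isUniformInducing.completeSpace_congr σ.surjective
    exact this.1 inferInstance
  have hd : ∀ x y, dist (σ (j x)) (σ (j y)) = dist (j x) (j y) := fun x y => hσ.dist_eq _ _
  have hm : IsMetricIn M fun x => σ (j x) :=
    { dense := σ.surjective.denseRange.comp hj.dense hσ.continuous
      dist_le := by simpa only [hd] using hj.isMetricIn.dist_le
      complete := fun s hs hc => by
        obtain ⟨x, hx⟩ := hj.isMetricIn.complete s hs (hσ.isUniformInducing.cauchy_map_iff.1
          (by rw [Filter.map_map]; exact hc))
        exact ⟨x, (hσ.continuous.tendsto _).comp hx⟩ }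
  have hint : Interprets M X.space inferInstance fun x => σ (j x) := by
    refine interprets_congr rfl ?_ hm.interprets
    change X.space.opens = _
    rw [hj.space_opens]
    unfold metricOpens
    simp only [hd]
    rfl
  obtain ⟨e, he, hetop⟩ : ∃ e : Xhat.Pt ≃ Shrink.{u} Z, (∀ x, e (π x) = σ (j x)) ∧
      Xhat.top = TopologicalSpace.induced e inferInstance := by
    let _ := Xhat.top
    obtain ⟨e, he⟩ := exists_homeomorph_of_interprets hπ hint
    exact ⟨e.toEquiv, he, e.isInducing.eq_induced⟩
  -- The vector space structure and the norm are pulled back along this bijection. It is a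
  -- homeomorphism onto the completion, so the norm induces the given topology.
  let T : Xhat.Pt ≃ Z := e.trans σ.symm
  have hT : ∀ x, T (π x) = j x := fun x => by
    change σ.symm (e (π x)) = j x
    rw [he, Equiv.symm_apply_apply]
  let _ : AddCommGroup Xhat.Pt := T.addCommGroup
  let _ : Module ℝ Xhat.Pt := T.module ℝ
  let L : Xhat.Pt ≃ₗ[ℝ] Z := T.linearEquiv ℝ
  have hL : ∀ x, L (π x) = j x := hT
  let n : NormedAddCommGroup Xhat.Pt := NormedAddCommGroup.induced Xhat.Pt Z L L.injective
  let ns : NormedSpace ℝ Xhat.Pt := NormedSpace.induced ℝ Xhat.Pt Z L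
  have hLi : Isometry L := Isometry.of_dist_eq fun x y => rfl
  have htop : Xhat.top = TopologicalSpace.induced L inferInstance := by
    rw [hetop]
    change TopologicalSpace.induced e (TopologicalSpace.induced σ.symm inferInstance) = _
    rw [induced_compose]
    rfl
  refine ⟨n, ns, htop, ?_, ?_⟩
  · exact (hLi.isUniformInducing.completeSpace_congr L.surjective).2 inferInstance
  · refine ⟨fun x y => L.injective ?_, fun r x => L.injective ?_, fun x => ?_, ?_⟩
    · rw [map_add, hL, hL, hL, hj.map_add]
    · rw [map_smul, hL, hL, hj.map_smul]
    · rw [← hj.norm_map, ← hL]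
      rfl
    · have : DenseRange (L ∘ π) := by
        have : L ∘ π = j := funext hL
        rw [this]
        exact hj.dense
      exact hLi.isUniformInducing.isInducing.dense_iff.2 fun z => by
        rw [← Set.range_comp]
        exact this (L z)

end Main

end ModelInterpretation

theorem mainTheorem9 {M : Set ZFSet.{u}} (hM : IsTransitiveModelZFC M) (X : BanachIn M)
    (Xhat : VSpace.{u}) (π : X.carrier → Xhat.Pt)
    (hπ : Interprets M X.space Xhat.top π) :
    ∃ (_ : NormedAddCommGroup Xhat.Pt) (_ : NormedSpace ℝ Xhat.Pt),
      -- the interpretations of the operations and of the norm of `X` make `Xhat` a Banach space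
      Xhat.top = (inferInstance : TopologicalSpace Xhat.Pt) ∧
      CompleteSpace Xhat.Pt ∧
      InterpretsMap (S := X.space.prod M X.space) (T := X.space) M
        (Prod.map π π) π (fun p : X.carrier × X.carrier => p.1 + p.2)
        (fun p : Xhat.Pt × Xhat.Pt => p.1 + p.2) ∧
      InterpretsMap (S := (realSpace M).prod M X.space) (T := X.space) M
        (Prod.map MReal.val π) π (fun p => X.smul p.1 p.2)
        (fun p : ℝ × Xhat.Pt => p.1 • p.2) ∧
      InterpretsMap (S := X.space) (T := realSpace M) M
        π MReal.val X.norm (fun x : Xhat.Pt => ‖x‖) ∧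
      -- the interpretation of the dual
      ∃ (C : Submodule ℝ (StrongDual ℝ Xhat.Pt)) (ι : X.Dual → C),
        (∀ f : X.Dual, InterpretsMap (S := X.space) (T := realSpace M) M
          π MReal.val f.toFun (ι f : StrongDual ℝ Xhat.Pt)) ∧
        IsClosed (C : Set (StrongDual ℝ Xhat.Pt)) ∧
        Interprets M X.dualSpace inferInstance ι ∧
        (∃ dualNorm : X.Dual → MReal M,
          (∀ f, (dualNorm f).val = X.supNorm (fun x => (f.toFun x).val)) ∧
          InterpretsMap (S := X.dualSpace) (T := realSpace M) M
            ι MReal.val dualNorm (fun f : C => ‖(f : StrongDual ℝ Xhat.Pt)‖)) ∧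
        InterpretsMap (S := X.space.prod M X.dualSpace) (T := realSpace M) M
          (Prod.map π ι) MReal.val (fun p => p.2.toFun p.1)
          (fun p : Xhat.Pt × C => (p.2 : StrongDual ℝ Xhat.Pt) p.1) ∧
        (X.UniformlyConvex → C = ⊤) := by
  have : Fact (IsTransitiveModelZFC M) := ⟨hM⟩
  obtain ⟨n, ns, htop, hcomplete, hj⟩ :=
    ModelInterpretation.exists_isBanachCompletion_of_interprets X Xhat π hπ
  exact ⟨n, ns, htop, hcomplete, ModelInterpretation.interpretsMap_of_isBanachCompletion X hj⟩
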